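/- Let $p\ge 1$ be an integer and let $e_1,\dots,e_p,d_1,\dots,d_p$ be real numbers with $e_j>0$ and $d_j>-p$ for all $j$ and $d_1\cdots d_p=0$. Put $E=\sum_j e_j$, $D=\sum_j d_j$ and assume $$1<\frac{E-D}{p}<p-1$$ (hence $p\ge 3$). For $n\ge 0$ let $\lambda_n=\prod_{j=1}^p(pn+e_j)$, $\mu_n=\prod_{j=1}^p(pn+d_j)$, $a_n=\lambda_n+\mu_n$ and $b_n=\sqrt{\lambda_n\mu_{n+1}}$. Let $P_n,Q_n$ be the solutions of $$z\,r_n(z)=b_nr_{n+1}(z)+a_nr_n(z)+b_{n-1}r_{n-1}(z),\quad n\ge 0,\qquad b_{-1}:=1,$$ with $P_{-1}=0$, $P_0=1$ and $Q_{-1}=-1$, $Q_0=0$. Then the corresponding Stieltjes moment problem is indeterminate: there is more than one positive measure on $[0,\infty)$ with moments of every order for which $(P_n)$ is orthonormal. The four series in $$A(z)=z\sum_{k\ge 0}Q_k(0)Q_k(z),\quad B(z)=-1+z\sum_{k\ge 0}Q_k(0)P_k(z),\quad C(z)=1+z\sum_{k\ge 0}P_k(0)Q_k(z),\quad D(z)=z\sum_{k\ge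 0}P_k(0)P_k(z)$$ (the entries of the Nevanlinna matrix of the problem) converge locally uniformly on $\mathbb C$, and $A,B,C,D$ are entire functions of order $1/p$ and of the same type $\tau$, called the type of the moment problem. For $n\ge 1$ let $$\gamma_n(p)=\sum_{1\le k_1\le k_2<k_3\le k_4<\dots<k_{2n-1}\le k_{2n}}(k_1k_2\cdots k_{2n})^{-p/2}$$ (a convergent series). Then $G_p(z)=\sum_{n=1}^\infty\gamma_n(p)z^n$ is an entire function of order $1/p$, and, if $\tau_p$ denotes its type, $$\tau=\frac{\tau_p}{p}.$$ In particular $\tau$ depends only on $p$, not on the $e_j,d_j$. Here, with $M_f(r)=\max_{|z|=r}|f(z)|$, the order of an entire function $f$ is $\rho_f=\limsup_{r\to\infty}\frac{\log\log M_f(r)}{\log r}$, and its type, when $0<\rho_f<\infty$, is $\limsup_{r\to\infty}\frac{\log M_f(r)}{r^{\rho_f}}$. -/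

import Mathlib

open Filter Topology MeasureTheory

noncomputable section

/-- The polynomials `r_n` with prescribed `r_0`, `r_1` that satisfy the three term recurrence
`x r_n(x) = b_n r_{n+1}(x) + a_n r_n(x) + b_{n-1} r_{n-1}(x)` for `n ≥ 1`. -/
def jacobiRec (a b : ℕ → ℝ) (r₀ r₁ : Polynomial ℝ) : ℕ → Polynomial ℝ
  | 0 => r₀
  | 1 => r₁
  | n + 2 =>
      Polynomial.C (b (n + 1))⁻¹ *
        ((Polynomial.X - Polynomial.C (a (n + 1))) * jacobiRec a b r₀ r₁ (n + 1)
          - Polynomial.C (b n) * jacobiRec a b r₀ r₁ n)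

/-- The orthonormal polynomials `P_n` for the Jacobi parameters `(a_n)`, `(b_n)`:
`P_{-1} = 0`, `P_0 = 1`. -/
def orthPoly (a b : ℕ → ℝ) : ℕ → Polynomial ℝ :=
  jacobiRec a b 1 (Polynomial.C (b 0)⁻¹ * (Polynomial.X - Polynomial.C (a 0)))

/-- The polynomials of the second kind `Q_n` for the Jacobi parameters `(a_n)`, `(b_n)`:
`Q_{-1} = -1`, `Q_0 = 0`, with `b_{-1} = 1`, so that `Q_1 = 1 / b_0`. -/
def secondPoly (a b : ℕ → ℝ) : ℕ → Polynomial ℝ :=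
  jacobiRec a b 0 (Polynomial.C (b 0)⁻¹)

/-- `σ` solves the (normalized) Stieltjes moment problem with Jacobi parameters `(a_n)`, `(b_n)`:
it is carried by `[0, ∞)`, has moments of every order, and the `P_n` are orthonormal in `L²(σ)`.
The orthonormality fixes all the moments of `σ`. -/
structure IsStieltjesSolution (a b : ℕ → ℝ) (σ : Measure ℝ) : Prop where
  support : σ (Set.Iio 0) = 0
  moments : ∀ n : ℕ, Integrable (fun x : ℝ => x ^ n) σ
  orthonormal : ∀ m n : ℕ,
    ∫ x, (orthPoly a b m).eval x * (orthPoly a b n).eval x ∂σ = if m = n then 1 else 0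

/-- The Stieltjes moment problem is indeterminate: it has more than one solution. -/
def IsStieltjesIndeterminate (a b : ℕ → ℝ) : Prop :=
  ∃ σ₁ σ₂ : Measure ℝ, IsStieltjesSolution a b σ₁ ∧ IsStieltjesSolution a b σ₂ ∧ σ₁ ≠ σ₂

/-- The polynomial matrices `(A_n, B_n; C_n, D_n)` that approximate the Nevanlinna matrix. -/
def nevanlinnaApprox (a b : ℕ → ℝ) (n : ℕ) (z : ℂ) : Matrix (Fin 2) (Fin 2) ℂ :=
  let P (k : ℕ) (w : ℂ) : ℂ := Polynomial.aeval w (orthPoly a b k)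
  let Q (k : ℕ) (w : ℂ) : ℂ := Polynomial.aeval w (secondPoly a b k)
  !![z * ∑ k ∈ Finset.range n, Q k 0 * Q k z, -1 + z * ∑ k ∈ Finset.range n, Q k 0 * P k z;
     1 + z * ∑ k ∈ Finset.range n, P k 0 * Q k z, z * ∑ k ∈ Finset.range n, P k 0 * P k z]

/-- `N` is the Nevanlinna matrix of the moment problem with Jacobi parameters `(a_n)`, `(b_n)`:
its entries `A, B, C, D` are the limits of `A_n, B_n, C_n, D_n`, uniformly on compact sets. -/
def IsNevanlinnaMatrix (a b : ℕ → ℝ) (N : ℂ → Matrix (Fin 2) (Fin 2) ℂ) : Prop :=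
  ∀ i j : Fin 2, TendstoLocallyUniformly (fun (n : ℕ) (z : ℂ) => nevanlinnaApprox a b n z i j)
    (fun z => N z i j) atTop

/-- The maximum modulus of `f` on the circle of radius `r` about the origin. -/
def maxModulus (f : ℂ → ℂ) (r : ℝ) : ℝ :=
  sSup ((fun z : ℂ => ‖f z‖) '' Metric.sphere (0 : ℂ) r)

/-- The order of an entire function. -/
def entireOrder (f : ℂ → ℂ) : EReal :=
  limsup (fun r : ℝ => ((Real.log (Real.log (maxModulus f r)) / Real.log r : ℝ) : EReal)) atTop

/-- The type, with respect to its order, of an entire function of positive finite order. -/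
def entireType (f : ℂ → ℂ) : EReal :=
  limsup (fun r : ℝ => ((Real.log (maxModulus f r) / r ^ (entireOrder f).toReal : ℝ) : EReal))
    atTop

/-- The index tuples `1 ≤ k_1 ≤ k_2 < k_3 ≤ k_4 < ⋯ < k_{2n-1} ≤ k_{2n}`; here `k i` stands for
`k_{i+1}`. -/
def alternatingTuples (n : ℕ) : Set (Fin (2 * n) → ℕ) :=
  {k | (∀ i, 1 ≤ k i) ∧ ∀ i j : Fin (2 * n), (j : ℕ) = i + 1 →
    (Even (i : ℕ) → k i ≤ k j) ∧ (Odd (i : ℕ) → k i < k j)}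

/-- The term `(k_1 k_2 ⋯ k_{2n})^{-p/2}`. -/
def multiZetaTerm (p : ℝ) (n : ℕ) (k : Fin (2 * n) → ℕ) : ℝ :=
  (∏ i, (k i : ℝ)) ^ (-(p / 2))

/-- The multi-zeta value `γ_n(p)`. -/
def multiZeta (p : ℝ) (n : ℕ) : ℝ :=
  ∑' k : alternatingTuples n, multiZetaTerm p n k

/-- The function `G_p(z) = ∑_{n ≥ 1} γ_n(p) z^n`. -/
def multiZetaFun (p : ℝ) (z : ℂ) : ℂ :=
  ∑' n : ℕ, (multiZeta p (n + 1) : ℂ) * z ^ (n + 1)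

/-- The polynomial rates `(pn + c_1) ⋯ (pn + c_p)`. -/
def polyRate (p : ℕ) (c : Fin p → ℝ) (n : ℕ) : ℝ :=
  ∏ j, ((p : ℝ) * n + c j)

/-- The coefficients `a_n = λ_n + μ_n` of a birth and death process with rates `lam`, `mu`. -/
def bdDiag (lam mu : ℕ → ℝ) (n : ℕ) : ℝ := lam n + mu n

/-- The coefficients `b_n = √(λ_n μ_{n+1})` of a birth and death process with rates `lam`, `mu`. -/
def bdOffDiag (lam mu : ℕ → ℝ) (n : ℕ) : ℝ := Real.sqrt (lam n * mu (n + 1))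

end

/-! Put π_n = λ_0⋯λ_{n-1}/(μ_1⋯μ_n). Since μ_0 = 0, P_n(0) = (-1)^n √π_n, and the substitution
P_n(z) = P_n(0) X_n turns the three term recurrence into the first order system Y_{n+1} = Y_n + w
π_n X_n, X_{n+1} = X_n + Y_{n+1}/(λ_n π_n) with w = -z (`aeval_orthPoly`). The Q_n arise in the same
way, up to sign, from the initial state (0, 1) instead of (1, 0). For w = r > 0 everything is
positive, so the growth of a Nevanlinna entry on |z| = r can be read off at z = -r, and it agrees up
to powers of r with that of Φ(r) = lim X_n (`bdNevanlinna_entry`). Powers of r change log M(r) by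
O(log r), which neither order 1/p nor type can see.

Up to such powers Φ depends on very little (`bdLimX_polyLE`): weights (u, v) may be exchanged for
(u', v') as soon as u_n v_n/(u'_n v'_n) and the ratios of consecutive quotients u_n/u'_n are 1 +
O(1/n). Up to an index N that is a power of r the errors multiply to a power of N, and beyond N the
system contributes a bounded factor. Here the product of the two weights is 1/λ_n ≈
p^{-p}(n+1)^{-p}, so they can be replaced by (n+1)^{-p/2} and p^{-p}(n+1)^{-p/2}, and the e_j, d_j
disappear. For u = v = (n+1)^{-p/2} the expansion of X_n in powers of r produces the multi-zeta
sums, so Φ(r) = 1 + G_p(r) (`hasSum_multiZeta`), which lies between exp(c r^{1/p}) and exp(C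
r^{1/p}). The constant p^{-p} only rescales r, and (p^{-p})^{1/p} = 1/p is the factor in the type.

Since π_n behaves like n^{(E-D)/p - p}, the condition 1 < (E-D)/p < p-1 makes both Σ π_n and Σ
1/(λ_n π_n) converge. Spectral measures of the truncated Jacobi matrices CᵀC have weak limits that
solve the moment problem. With last birth rate 0 the limit keeps an atom at 0 of mass at least 1/Σ
π_n. With the true last rate the integrals of 1/(|x| + ε) stay below Σ 1/(λ_n π_n), so the limit has
no atom at 0. Hence there are two solutions. -/

noncomputable section

/-! ### The first order system behind a birth and death process -/

/-- The state `(X_n, Y_n)` of the first order system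
`Y_{n+1} = Y_n + w u_n X_n`, `X_{n+1} = X_n + v_n Y_{n+1}` that starts from `s`. -/
def bdState {K : Type*} [Field K] (u v : ℕ → K) (w : K) (s : K × K) : ℕ → K × K
  | 0 => s
  | n + 1 =>
      ((bdState u v w s n).1 + v n * ((bdState u v w s n).2 + w * u n * (bdState u v w s n).1),
        (bdState u v w s n).2 + w * u n * (bdState u v w s n).1)

theorem bdState_zero {K : Type*} [Field K] (u v : ℕ → K) (w : K) (s : K × K) :
    bdState u v w s 0 = s := rfl

theorem bdState_snd_succ {K : Type*} [Field K] (u v : ℕ → K) (w : K) (s : K × K) (n : ℕ) :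
    (bdState u v w s (n + 1)).2
      = (bdState u v w s n).2 + w * u n * (bdState u v w s n).1 := rfl

theorem bdState_fst_succ {K : Type*} [Field K] (u v : ℕ → K) (w : K) (s : K × K) (n : ℕ) :
    (bdState u v w s (n + 1)).1
      = (bdState u v w s n).1 + v n * (bdState u v w s (n + 1)).2 := rfl

theorem bdState_snd_eq_sum {K : Type*} [Field K] (u v : ℕ → K) (w : K) (s : K × K) (n : ℕ) :
    (bdState u v w s n).2 = s.2 + w * ∑ k ∈ Finset.range n, u k * (bdState u v w s k).1 := by
  induction n with
  | zero => simp [bdState_zero]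
  | succ n ih => rw [bdState_snd_succ, ih, Finset.sum_range_succ]; ring

theorem bdState_fst_eq_sum {K : Type*} [Field K] (u v : ℕ → K) (w : K) (s : K × K) (n : ℕ) :
    (bdState u v w s n).1 = s.1 + ∑ k ∈ Finset.range n, v k * (bdState u v w s (k + 1)).2 := by
  induction n with
  | zero => simp [bdState_zero]
  | succ n ih => rw [bdState_fst_succ, ih, Finset.sum_range_succ]; ring

theorem bdState_ofReal (u v : ℕ → ℝ) (w : ℝ) (s : ℝ × ℝ) (n : ℕ) :
    bdState (fun k => (u k : ℂ)) (fun k => (v k : ℂ)) (w : ℂ) ((s.1 : ℂ), (s.2 : ℂ)) n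
      = (((bdState u v w s n).1 : ℂ), ((bdState u v w s n).2 : ℂ)) := by
  induction n with
  | zero => rfl
  | succ n ih =>
    apply Prod.ext
    · simp only [bdState, ih]; push_cast; ring
    · simp only [bdState, ih]; push_cast; ring

section Real

variable {u v : ℕ → ℝ} {r : ℝ} {s : ℝ × ℝ}

theorem bdState_nonneg (hu : ∀ n, 0 < u n) (hv : ∀ n, 0 < v n) (hr : 0 ≤ r)
    (h1 : 0 ≤ s.1) (h2 : 0 ≤ s.2) (n : ℕ) :
    0 ≤ (bdState u v r s n).1 ∧ 0 ≤ (bdState u v r s n).2 := by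
  induction n with
  | zero => exact ⟨h1, h2⟩
  | succ n ih =>
    obtain ⟨hx, hy⟩ := ih
    have := (hu n).le
    have := (hv n).le
    constructor <;> simp only [bdState] <;> positivity

theorem bdState_fst_mono (hu : ∀ n, 0 < u n) (hv : ∀ n, 0 < v n) (hr : 0 ≤ r)
    (h1 : 0 ≤ s.1) (h2 : 0 ≤ s.2) : Monotone fun n => (bdState u v r s n).1 := by
  refine monotone_nat_of_le_succ fun n => ?_
  rw [bdState_fst_succ]
  have := (bdState_nonneg hu hv hr h1 h2 (n + 1)).2
  have := (hv n).le
  have : 0 ≤ v n * (bdState u v r s (n + 1)).2 := by positivity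
  linarith

theorem bdState_snd_mono (hu : ∀ n, 0 < u n) (hv : ∀ n, 0 < v n) (hr : 0 ≤ r)
    (h1 : 0 ≤ s.1) (h2 : 0 ≤ s.2) : Monotone fun n => (bdState u v r s n).2 := by
  refine monotone_nat_of_le_succ fun n => ?_
  rw [bdState_snd_succ]
  have := (bdState_nonneg hu hv hr h1 h2 n).1
  have := (hu n).le
  have : 0 ≤ r * u n * (bdState u v r s n).1 := by positivity
  linarith

/-- The coefficients are positive, so by the triangle inequality the real system at `r` majorizes
all complex ones with `‖w‖ ≤ r`. -/
theorem norm_bdState_le (hu : ∀ n, 0 < u n) (hv : ∀ n, 0 < v n) (w : ℂ) (hw : ‖w‖ ≤ r)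
    (x y : ℂ) (h1 : ‖x‖ ≤ s.1) (h2 : ‖y‖ ≤ s.2) (n : ℕ) :
    ‖(bdState (fun k => (u k : ℂ)) (fun k => (v k : ℂ)) w (x, y) n).1‖
        ≤ (bdState u v r s n).1 ∧
      ‖(bdState (fun k => (u k : ℂ)) (fun k => (v k : ℂ)) w (x, y) n).2‖
        ≤ (bdState u v r s n).2 := by
  have hr : 0 ≤ r := (norm_nonneg w).trans hw
  induction n with
  | zero => exact ⟨h1, h2⟩
  | succ n ih =>
    obtain ⟨hx, hy⟩ := ih
    have hu' := (hu n).le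
    have hv' := (hv n).le
    have hY : ‖(bdState (fun k => (u k : ℂ)) (fun k => (v k : ℂ)) w (x, y) (n + 1)).2‖
        ≤ (bdState u v r s (n + 1)).2 := by
      rw [bdState_snd_succ, bdState_snd_succ]
      refine (norm_add_le _ _).trans (add_le_add hy ?_)
      rw [norm_mul, norm_mul, Complex.norm_real, Real.norm_of_nonneg hu']
      gcongr
    refine ⟨?_, hY⟩
    rw [bdState_fst_succ, bdState_fst_succ]
    refine (norm_add_le _ _).trans (add_le_add hx ?_)
    rw [norm_mul, Complex.norm_real, Real.norm_of_nonneg hv']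
    gcongr

/-- Growth of the weighted sum `X + t Y` from the index `N` on. -/
theorem bdState_weighted_le (hu : ∀ n, 0 < u n) (hv : ∀ n, 0 < v n) (hr : 0 ≤ r)
    (h1 : 0 ≤ s.1) (h2 : 0 ≤ s.2) {t : ℝ} (ht : 0 < t) (N k : ℕ) :
    (bdState u v r s (N + k)).1 + t * (bdState u v r s (N + k)).2
      ≤ ((bdState u v r s N).1 + t * (bdState u v r s N).2)
        * ∏ i ∈ Finset.range k, ((1 + t * r * u (N + i)) * (1 + v (N + i) / t)) := by
  induction k with
  | zero => simp
  | succ k ih =>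
    rw [Finset.prod_range_succ, ← mul_assoc]
    have hu' := (hu (N + k)).le
    have hv' := (hv (N + k)).le
    obtain ⟨hx, hy⟩ := bdState_nonneg hu hv hr h1 h2 (N + k)
    obtain ⟨-, hy'⟩ := bdState_nonneg hu hv hr h1 h2 (N + k + 1)
    refine le_trans ?_ (mul_le_mul_of_nonneg_right ih (by positivity))
    rw [← add_assoc, bdState_fst_succ]
    set X := (bdState u v r s (N + k)).1
    set Y := (bdState u v r s (N + k)).2
    have e : (bdState u v r s (N + k + 1)).2 = Y + r * u (N + k) * X := bdState_snd_succ ..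
    have hX : 0 ≤ X := hx
    have hYY : 0 ≤ Y := hy
    rw [e]
    -- The half step for Y costs the factor 1 + t r u, the half step for X the factor 1 + v/t.
    have hA : X + t * (Y + r * u (N + k) * X) ≤ (X + t * Y) * (1 + t * r * u (N + k)) := by
      have : 0 ≤ t * Y * (t * r * u (N + k)) := by positivity
      nlinarith
    have hB : X + v (N + k) * (Y + r * u (N + k) * X) + t * (Y + r * u (N + k) * X)
        ≤ (X + t * (Y + r * u (N + k) * X)) * (1 + v (N + k) / t) := by
      have e2 : (X + t * (Y + r * u (N + k) * X)) * (1 + v (N + k) / t)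
        = X + v (N + k) * (Y + r * u (N + k) * X) + t * (Y + r * u (N + k) * X)
          + X * (v (N + k) / t) := by field_simp; ring
      rw [e2]
      have : 0 ≤ X * (v (N + k) / t) := by positivity
      linarith
    calc _ ≤ _ := hB
      _ ≤ ((X + t * Y) * (1 + t * r * u (N + k))) * (1 + v (N + k) / t) := by gcongr
      _ = _ := by ring

/-- The weight t = 1 together with 1 + x ≤ e^x. It bounds the system globally and, with large `N`,
shows that the tail contributes little. -/
theorem bdState_add_le_exp (hu : ∀ n, 0 < u n) (hv : ∀ n, 0 < v n) (hr : 0 ≤ r)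
    (h1 : 0 ≤ s.1) (h2 : 0 ≤ s.2) (N k : ℕ) :
    (bdState u v r s (N + k)).1 + (bdState u v r s (N + k)).2
      ≤ ((bdState u v r s N).1 + (bdState u v r s N).2)
        * Real.exp (r * ∑ i ∈ Finset.range k, u (N + i) + ∑ i ∈ Finset.range k, v (N + i)) := by
  have h := bdState_weighted_le hu hv hr h1 h2 one_pos N k
  simp only [one_mul, div_one] at h
  obtain ⟨hx, hy⟩ := bdState_nonneg hu hv hr h1 h2 N
  refine h.trans (mul_le_mul_of_nonneg_left ?_ (by positivity))
  rw [Finset.mul_sum, ← Finset.sum_add_distrib, Real.exp_sum]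
  refine Finset.prod_le_prod (fun i _ => ?_) fun i _ => ?_
  · have := (hu (N + i)).le
    have := (hv (N + i)).le
    positivity
  · have := (hu (N + i)).le
    have := (hv (N + i)).le
    rw [Real.exp_add]
    have a1 := Real.add_one_le_exp (r * u (N + i))
    have a2 := Real.add_one_le_exp (v (N + i))
    gcongr <;> linarith

/-- Comparison of two systems. -/
theorem bdState_le_mul {u' v' g ρ : ℕ → ℝ} {s' : ℝ × ℝ} (hu : ∀ n, 0 < u n) (hv : ∀ n, 0 < v n)
    (hu' : ∀ n, 0 < u' n) (hv' : ∀ n, 0 < v' n) (hr : 0 ≤ r) (h1' : 0 ≤ s'.1) (h2' : 0 ≤ s'.2)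
    (hρ : ∀ n, 1 ≤ ρ n)
    (hug : ∀ n, u n ≤ g n * u' n) (hvg : ∀ n, v n * g n ≤ ρ n * v' n)
    (hg : ∀ n, g n ≤ ρ n * g (n + 1)) {K : ℝ} (hK : 0 ≤ K) (m : ℕ)
    (hX : (bdState u v r s m).1 ≤ K * (bdState u' v' r s' m).1)
    (hY : (bdState u v r s m).2 ≤ K * g m * (bdState u' v' r s' m).2) (k : ℕ) :
    (bdState u v r s (m + k)).1
        ≤ K * (∏ i ∈ Finset.range k, ρ (m + i)) * (bdState u' v' r s' (m + k)).1 ∧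
      (bdState u v r s (m + k)).2
        ≤ K * (∏ i ∈ Finset.range k, ρ (m + i)) * g (m + k) * (bdState u' v' r s' (m + k)).2 := by
  induction k with
  | zero => simpa using ⟨hX, hY⟩
  | succ k ih =>
    obtain ⟨ihX, ihY⟩ := ih
    set n := m + k
    obtain ⟨hx', hy'⟩ := bdState_nonneg hu' hv' hr h1' h2' n
    obtain ⟨-, hy1'⟩ := bdState_nonneg hu' hv' hr h1' h2' (n + 1)
    set P := ∏ i ∈ Finset.range k, ρ (m + i)
    have hP : 0 ≤ P := Finset.prod_nonneg fun i _ => zero_le_one.trans (hρ _)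
    have hn : m + (k + 1) = n + 1 := by omega
    rw [Finset.prod_range_succ, hn]
    have hun := (hu n).le
    have hvn := (hv n).le
    -- The update of Y uses only u ≤ g u' and costs nothing. The factor ρ n is spent later: on v g ≤
    -- ρ v' in the update of X, and on passing from g n to g (n + 1).
    have key : (bdState u v r s (n + 1)).2 ≤ K * P * g n * (bdState u' v' r s' (n + 1)).2 := by
      rw [bdState_snd_succ, bdState_snd_succ]
      have a : r * u n * (bdState u v r s n).1
          ≤ r * (g n * u' n) * (K * P * (bdState u' v' r s' n).1) :=
        (mul_le_mul_of_nonneg_left ihX (by positivity)).trans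
          (mul_le_mul_of_nonneg_right (mul_le_mul_of_nonneg_left (hug n) hr) (by positivity))
      calc _ ≤ K * P * g n * (bdState u' v' r s' n).2
            + r * (g n * u' n) * (K * P * (bdState u' v' r s' n).1) := add_le_add ihY a
        _ = _ := by ring
    constructor
    · rw [bdState_fst_succ, bdState_fst_succ]
      have a : v n * (bdState u v r s (n + 1)).2
          ≤ K * P * (ρ n * v' n) * (bdState u' v' r s' (n + 1)).2 := by
        calc _ ≤ v n * (K * P * g n * (bdState u' v' r s' (n + 1)).2) := by gcongr
          _ = K * P * (v n * g n) * (bdState u' v' r s' (n + 1)).2 := by ring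
          _ ≤ _ := mul_le_mul_of_nonneg_right
            (mul_le_mul_of_nonneg_left (hvg n) (by positivity)) hy1'
      have b : K * P * (bdState u' v' r s' n).1 ≤ K * P * ρ n * (bdState u' v' r s' n).1 := by
        have : K * P * 1 ≤ K * P * ρ n := mul_le_mul_of_nonneg_left (hρ n) (by positivity)
        nlinarith
      calc _ ≤ K * P * ρ n * (bdState u' v' r s' n).1
            + K * P * (ρ n * v' n) * (bdState u' v' r s' (n + 1)).2 := add_le_add (ihX.trans b) a
        _ = _ := by ring
    · refine key.trans (mul_le_mul_of_nonneg_right ?_ hy1')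
      calc K * P * g n ≤ K * P * (ρ n * g (n + 1)) :=
            mul_le_mul_of_nonneg_left (hg n) (by positivity)
        _ = _ := by ring

end Real

/-! ### Limits of the system for summable weights -/

/-- Positive weights for which the limits of the system exist, with a little room. -/
structure IsGoodWeights (u v : ℕ → ℝ) : Prop where
  pos_u : ∀ n, 0 < u n
  pos_v : ∀ n, 0 < v n
  summable_v : Summable v
  summable_u : ∃ δ : ℝ, 0 < δ ∧ Summable fun n : ℕ => u n * ((n : ℝ) + 1) ^ δ

theorem IsGoodWeights.summable {u v : ℕ → ℝ} (h : IsGoodWeights u v) : Summable u := by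
  obtain ⟨δ, hδ, hs⟩ := h.summable_u
  refine Summable.of_nonneg_of_le (fun n => (h.pos_u n).le) (fun n => ?_) hs
  have : (1 : ℝ) ≤ ((n : ℝ) + 1) ^ δ :=
    Real.one_le_rpow (by linarith [Nat.cast_nonneg (α := ℝ) n]) hδ.le
  nlinarith [h.pos_u n]

/-- The limit of the first component. -/
def bdLimX (u v : ℕ → ℝ) (s : ℝ × ℝ) (r : ℝ) : ℝ := ⨆ n, (bdState u v r s n).1

/-- The limit of the second component. -/
def bdLimY (u v : ℕ → ℝ) (s : ℝ × ℝ) (r : ℝ) : ℝ := ⨆ n, (bdState u v r s n).2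

section Limits

variable {u v : ℕ → ℝ} {r : ℝ} {s : ℝ × ℝ}

theorem IsGoodWeights.bdState_le (h : IsGoodWeights u v) (hr : 0 ≤ r)
    (h1 : 0 ≤ s.1) (h2 : 0 ≤ s.2) (n : ℕ) :
    (bdState u v r s n).1 + (bdState u v r s n).2
      ≤ (s.1 + s.2) * Real.exp (r * ∑' k, u k + ∑' k, v k) := by
  have := bdState_add_le_exp h.pos_u h.pos_v hr h1 h2 0 n
  simp only [zero_add, bdState_zero] at this
  refine this.trans (mul_le_mul_of_nonneg_left (Real.exp_le_exp.2 ?_) (by positivity))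
  have a := h.summable.sum_le_tsum (Finset.range n) fun i _ => (h.pos_u i).le
  have b := h.summable_v.sum_le_tsum (Finset.range n) fun i _ => (h.pos_v i).le
  gcongr

theorem IsGoodWeights.bddAbove_fst (h : IsGoodWeights u v) (hr : 0 ≤ r)
    (h1 : 0 ≤ s.1) (h2 : 0 ≤ s.2) : BddAbove (Set.range fun n => (bdState u v r s n).1) := by
  refine ⟨(s.1 + s.2) * Real.exp (r * ∑' k, u k + ∑' k, v k), ?_⟩
  rintro _ ⟨n, rfl⟩
  have := h.bdState_le hr h1 h2 n
  have := (bdState_nonneg h.pos_u h.pos_v hr h1 h2 n).2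
  dsimp only
  linarith

theorem IsGoodWeights.bddAbove_snd (h : IsGoodWeights u v) (hr : 0 ≤ r)
    (h1 : 0 ≤ s.1) (h2 : 0 ≤ s.2) : BddAbove (Set.range fun n => (bdState u v r s n).2) := by
  refine ⟨(s.1 + s.2) * Real.exp (r * ∑' k, u k + ∑' k, v k), ?_⟩
  rintro _ ⟨n, rfl⟩
  have := h.bdState_le hr h1 h2 n
  have := (bdState_nonneg h.pos_u h.pos_v hr h1 h2 n).1
  dsimp only
  linarith

theorem IsGoodWeights.tendsto_snd (h : IsGoodWeights u v) (hr : 0 ≤ r)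
    (h1 : 0 ≤ s.1) (h2 : 0 ≤ s.2) :
    Tendsto (fun n => (bdState u v r s n).2) atTop (𝓝 (bdLimY u v s r)) :=
  tendsto_atTop_ciSup (bdState_snd_mono h.pos_u h.pos_v hr h1 h2) (h.bddAbove_snd hr h1 h2)

theorem IsGoodWeights.fst_le_lim (h : IsGoodWeights u v) (hr : 0 ≤ r)
    (h1 : 0 ≤ s.1) (h2 : 0 ≤ s.2) (n : ℕ) : (bdState u v r s n).1 ≤ bdLimX u v s r :=
  le_ciSup (h.bddAbove_fst hr h1 h2) n

theorem IsGoodWeights.snd_le_lim (h : IsGoodWeights u v) (hr : 0 ≤ r)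
    (h1 : 0 ≤ s.1) (h2 : 0 ≤ s.2) (n : ℕ) : (bdState u v r s n).2 ≤ bdLimY u v s r :=
  le_ciSup (h.bddAbove_snd hr h1 h2) n

/-- X is increasing, so each X_k in the sum for Y_n may be replaced by X_n. With
`IsGoodWeights.limX_le` this makes the two components interchangeable at the cost of a power of r.
-/
theorem IsGoodWeights.snd_le (h : IsGoodWeights u v) (hr : 0 ≤ r)
    (h1 : 0 ≤ s.1) (h2 : 0 ≤ s.2) (n : ℕ) :
    (bdState u v r s n).2 ≤ s.2 + r * (∑' k, u k) * (bdState u v r s n).1 := by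
  rw [bdState_snd_eq_sum, mul_assoc]
  gcongr
  have a := h.summable.sum_le_tsum (Finset.range n) fun i _ => (h.pos_u i).le
  have hx := (bdState_nonneg h.pos_u h.pos_v hr h1 h2 n).1
  calc _ ≤ ∑ k ∈ Finset.range n, u k * (bdState u v r s n).1 := by
        refine Finset.sum_le_sum fun k hk => mul_le_mul_of_nonneg_left ?_ (h.pos_u k).le
        exact bdState_fst_mono h.pos_u h.pos_v hr h1 h2 (Finset.mem_range.1 hk).le
    _ = (∑ k ∈ Finset.range n, u k) * (bdState u v r s n).1 := by rw [Finset.sum_mul]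
    _ ≤ _ := by gcongr

theorem IsGoodWeights.limX_le (h : IsGoodWeights u v) (hr : 0 ≤ r)
    (h1 : 0 ≤ s.1) (h2 : 0 ≤ s.2) :
    bdLimX u v s r ≤ s.1 + (∑' k, v k) * bdLimY u v s r := by
  refine ciSup_le fun n => ?_
  rw [bdState_fst_eq_sum]
  gcongr
  have hY : 0 ≤ bdLimY u v s r := h2.trans (h.snd_le_lim hr h1 h2 0)
  calc _ ≤ ∑ k ∈ Finset.range n, v k * bdLimY u v s r := by
        refine Finset.sum_le_sum fun k _ => mul_le_mul_of_nonneg_left ?_ (h.pos_v k).le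
        exact h.snd_le_lim hr h1 h2 (k + 1)
    _ = (∑ k ∈ Finset.range n, v k) * bdLimY u v s r := by rw [Finset.sum_mul]
    _ ≤ _ := by
      gcongr
      exact h.summable_v.sum_le_tsum (Finset.range n) fun i _ => (h.pos_v i).le

end Limits

/-! ### Comparison of growth up to polynomial factors -/

/-- `f` is bounded by a polynomial multiple of `g + 1` near `+∞`. -/
def PolyLE (f g : ℝ → ℝ) : Prop :=
  ∃ C : ℝ, 0 < C ∧ ∃ m : ℕ, ∀ᶠ r : ℝ in atTop, f r ≤ C * r ^ m * (g r + 1)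

/-- `ρ n ≤ 1 + O(1/n)`. -/
def NearOne (ρ : ℕ → ℝ) : Prop :=
  ∃ C : ℕ, ∀ n : ℕ, ρ n ≤ 1 + C / ((n : ℝ) + 1)

/-- By Bernoulli each factor is at most ((i + 2)/(i + 1))^C, and these telescope. -/
theorem prod_one_add_le (C N : ℕ) :
    ∏ i ∈ Finset.range N, (1 + (C : ℝ) / ((i : ℝ) + 1)) ≤ ((N : ℝ) + 1) ^ C := by
  induction N with
  | zero => simp
  | succ N ih =>
    rw [Finset.prod_range_succ]
    have hN : (0 : ℝ) < (N : ℝ) + 1 := by positivity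
    have := one_add_mul_le_pow (a := 1 / ((N : ℝ) + 1)) (by
      have : 0 ≤ 1 / ((N : ℝ) + 1) := by positivity
      linarith) C
    calc _ ≤ ((N : ℝ) + 1) ^ C * (1 + 1 / ((N : ℝ) + 1)) ^ C := by
          gcongr
          calc _ = 1 + (C : ℝ) * (1 / ((N : ℝ) + 1)) := by ring
            _ ≤ _ := this
      _ = _ := by
        rw [← mul_pow]; congr 1; push_cast; field_simp

/-- Up to an index N of polynomial size in r, `bdState_le_mul` loses only a product of factors 1 +
c/(i + 1), hence a power of N. Past N the sum r Σ u_i is bounded because of the spare exponent δ, so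
the rest of the system contributes a constant factor. -/
theorem bdLimX_polyLE {u v u' v' : ℕ → ℝ} (h : IsGoodWeights u v) (h' : IsGoodWeights u' v')
    (hprod : NearOne fun n => u n * v n / (u' n * v' n))
    (hquot : NearOne fun n => (u n / u' n) / (u (n + 1) / u' (n + 1))) :
    PolyLE (bdLimX u v (1, 0)) (bdLimX u' v' (1, 0)) := by
  obtain ⟨C1, hC1⟩ := hprod
  obtain ⟨C2, hC2⟩ := hquot
  set c := C1 + C2
  obtain ⟨δ, hδ, hs⟩ := h.summable_u
  obtain ⟨k, hk⟩ := exists_nat_gt (1 / δ)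
  set U := ∑' n : ℕ, u n * ((n : ℝ) + 1) ^ δ
  set V := ∑' n, v n
  set U0 := ∑' n, u n
  have hU0 : 0 ≤ U0 := tsum_nonneg fun n => (h.pos_u n).le
  have hmain : ∀ r : ℝ, 1 ≤ r → bdLimX u v (1, 0) r ≤
      (1 + r * U0) * Real.exp (U + V) * ((2 * r) ^ k + 1) ^ c * bdLimX u' v' (1, 0) r := by
    intro r hr
    have hr0 : 0 ≤ r := zero_le_one.trans hr
    -- Since k δ > 1, this N satisfies (N + 1)^δ ≥ r while remaining polynomial in r.
    set N := ⌈r⌉₊ ^ k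
    have hNlow : r ≤ ((N : ℝ) + 1) ^ δ := by
      have a : (r : ℝ) ^ (k : ℝ) ≤ (N : ℝ) + 1 := by
        have : r ^ k ≤ (N : ℝ) := by
          simp only [N, Nat.cast_pow]; exact pow_le_pow_left₀ hr0 (Nat.le_ceil r) k
        rw [Real.rpow_natCast]; linarith
      have b : 1 ≤ (k : ℝ) * δ := by
        rw [div_lt_iff₀ hδ] at hk; exact hk.le
      calc r = r ^ (1 : ℝ) := (Real.rpow_one r).symm
        _ ≤ r ^ ((k : ℝ) * δ) := Real.rpow_le_rpow_of_exponent_le hr b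
        _ = (r ^ (k : ℝ)) ^ δ := Real.rpow_mul hr0 _ _
        _ ≤ _ := Real.rpow_le_rpow (by positivity) a hδ.le
    have hNup : (N : ℝ) ≤ (2 * r) ^ k := by
      simp only [N, Nat.cast_pow]
      refine pow_le_pow_left₀ (by positivity) ?_ k
      have := Nat.ceil_lt_add_one hr0
      linarith
    have h00 : (0 : ℝ) ≤ ((1 : ℝ), (0 : ℝ)).1 := zero_le_one
    have h01 : (0 : ℝ) ≤ ((1 : ℝ), (0 : ℝ)).2 := le_rfl
    -- With g = u/u' the condition on u is an equality, the one on v becomes the bound on u v/(u'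
    -- v'), and the one on g is the slow variation of u/u'.
    have hcmp := (bdState_le_mul (g := fun n => u n / u' n)
      (ρ := fun n => 1 + (c : ℝ) / ((n : ℝ) + 1)) (s := (1, 0)) (s' := (1, 0))
      h.pos_u h.pos_v h'.pos_u h'.pos_v hr0 h00 h01
      (fun n => by
        have : (0 : ℝ) ≤ (c : ℝ) / ((n : ℝ) + 1) := by positivity
        linarith)
      (fun n => by rw [div_mul_cancel₀ _ (h'.pos_u n).ne'])
      (fun n => by
        have := hC1 n
        have p1 := h'.pos_u n
        have p2 := h'.pos_v n
        rw [div_le_iff₀ (by positivity)] at this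
        have e : v n * (u n / u' n) = u n * v n / u' n := by ring
        rw [e, div_le_iff₀ p1]
        refine this.trans ?_
        have : (1 + (C1 : ℝ) / ((n : ℝ) + 1)) ≤ 1 + (c : ℝ) / ((n : ℝ) + 1) := by
          gcongr; simp [c]
        calc _ ≤ (1 + (c : ℝ) / ((n : ℝ) + 1)) * (u' n * v' n) := by gcongr
          _ = _ := by ring)
      (fun n => by
        have := hC2 n
        have p1 := h'.pos_u (n + 1)
        have p2 := h.pos_u (n + 1)
        rw [div_le_iff₀ (by positivity)] at this
        refine this.trans (mul_le_mul_of_nonneg_right ?_ (by positivity))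
        gcongr; simp [c])
      zero_le_one 0 (by simp [bdState_zero]) (by simp [bdState_zero]) N).1
    simp only [zero_add, one_mul] at hcmp
    have hX'N := h'.fst_le_lim (s := (1, 0)) hr0 h00 h01 N
    have hX'0 := (bdState_nonneg h'.pos_u h'.pos_v hr0 h00 h01 N).1
    have hXN : (bdState u v r (1, 0) N).1
        ≤ ((2 * r) ^ k + 1) ^ c * bdLimX u' v' (1, 0) r := by
      refine hcmp.trans ?_
      refine (mul_le_mul_of_nonneg_right (prod_one_add_le c N) hX'0).trans ?_
      gcongr
    refine ciSup_le fun M => ?_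
    have hM := bdState_fst_mono h.pos_u h.pos_v hr0 h00 h01 (Nat.le_add_left M N)
    refine hM.trans ?_
    have ht := bdState_add_le_exp h.pos_u h.pos_v hr0 h00 h01 N M
    have hy0 := (bdState_nonneg h.pos_u h.pos_v hr0 h00 h01 (N + M)).2
    have hx0 := (bdState_nonneg h.pos_u h.pos_v hr0 h00 h01 N).1
    have hyN := h.snd_le hr0 h00 h01 N
    simp only [zero_add] at hyN
    -- For indices i ≥ N one has r ≤ (i + 1)^δ, so the factor r is absorbed by the weighted sum U,
    -- which does not depend on r.
    have hexp : r * ∑ i ∈ Finset.range M, u (N + i) + ∑ i ∈ Finset.range M, v (N + i) ≤ U + V := by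
      refine add_le_add ?_ ?_
      · rw [Finset.mul_sum]
        calc _ ≤ ∑ i ∈ Finset.range M, u (N + i) * (((N + i : ℕ) : ℝ) + 1) ^ δ := by
              refine Finset.sum_le_sum fun i _ => ?_
              rw [mul_comm]
              refine mul_le_mul_of_nonneg_left (hNlow.trans ?_) (h.pos_u _).le
              refine Real.rpow_le_rpow (by positivity) ?_ hδ.le
              push_cast; linarith [Nat.cast_nonneg (α := ℝ) i]
          _ = ∑ j ∈ (Finset.range M).map (addLeftEmbedding N), u j * ((j : ℝ) + 1) ^ δ := by
              rw [Finset.sum_map]; rfl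
          _ ≤ U := hs.sum_le_tsum _ fun j _ =>
              mul_nonneg (h.pos_u j).le (by positivity)
      · calc _ = ∑ j ∈ (Finset.range M).map (addLeftEmbedding N), v j := by
              rw [Finset.sum_map]; rfl
          _ ≤ V := h.summable_v.sum_le_tsum _ fun j _ => (h.pos_v j).le
    calc (bdState u v r (1, 0) (N + M)).1
        ≤ (bdState u v r (1, 0) (N + M)).1 + (bdState u v r (1, 0) (N + M)).2 := by linarith
      _ ≤ _ := ht
      _ ≤ ((1 + r * U0) * (bdState u v r (1, 0) N).1) * Real.exp (U + V) := by
        gcongr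
        linarith
      _ ≤ ((1 + r * U0) * (((2 * r) ^ k + 1) ^ c * bdLimX u' v' (1, 0) r))
          * Real.exp (U + V) := by gcongr
      _ = _ := by ring
  refine ⟨(1 + U0) * Real.exp (U + V) * (2 ^ k + 1) ^ c, by positivity, 1 + k * c, ?_⟩
  filter_upwards [eventually_ge_atTop 1] with r hr
  have hr0 : 0 ≤ r := zero_le_one.trans hr
  refine (hmain r hr).trans ?_
  have hΦ : 0 ≤ bdLimX u' v' (1, 0) r :=
    zero_le_one.trans (h'.fst_le_lim (s := (1, 0)) hr0 zero_le_one le_rfl 0)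
  have hrk : 1 ≤ r ^ k := one_le_pow₀ hr
  calc _ ≤ ((1 + U0) * r) * Real.exp (U + V) * ((2 ^ k + 1) * r ^ k) ^ c
          * (bdLimX u' v' (1, 0) r + 1) := by
        gcongr
        · nlinarith
        · rw [mul_pow]; nlinarith
        · linarith
    _ = _ := by
        rw [mul_pow, ← pow_mul, pow_add r 1, pow_one]; ring

/-! ### Order and type from the growth of the maximum modulus -/

theorem isLittleO_const_add_mul_log {q : ℝ} (hq : 0 < q) (K m : ℝ) :
    (fun r : ℝ => K + m * Real.log r) =o[atTop] fun r => r ^ q := by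
  refine Asymptotics.IsLittleO.add ?_ ((isLittleO_log_rpow_atTop hq).const_mul_left m)
  refine (Asymptotics.isLittleO_const_left.2 (Or.inr ?_))
  exact tendsto_norm_atTop_atTop.comp (tendsto_rpow_atTop hq)

theorem eventually_mul_pow_le_of_exp_le {Φ : ℝ → ℝ} {q c : ℝ} (hq : 0 < q) (hc : 0 < c)
    (hΦ : ∀ᶠ r in atTop, Real.exp (c * r ^ q) ≤ Φ r) {K : ℝ} (hK : 0 < K) (m : ℕ) :
    ∀ᶠ r in atTop, K * r ^ m ≤ Φ r := by
  have h := (isLittleO_const_add_mul_log hq (Real.log K) m).bound hc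
  filter_upwards [h, hΦ, eventually_gt_atTop 0] with r h1 h2 h3
  refine le_trans ?_ h2
  have : K * r ^ m = Real.exp (Real.log K + m * Real.log r) := by
    rw [Real.exp_add, Real.exp_log hK, mul_comm (m : ℝ), Real.exp_mul, Real.exp_log h3,
      Real.rpow_natCast]
  rw [this, Real.exp_le_exp]
  rw [Real.norm_of_nonneg (by positivity : (0 : ℝ) ≤ r ^ q)] at h1
  exact (le_abs_self _).trans h1

/-- Functions that are polynomially comparable have asymptotically equal logarithms. -/
theorem isLittleO_log_sub_log {M Φ : ℝ → ℝ} {q c : ℝ} (hq : 0 < q) (hc : 0 < c)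
    (hΦ : ∀ᶠ r in atTop, Real.exp (c * r ^ q) ≤ Φ r) (h1 : PolyLE M Φ) (h2 : PolyLE Φ M) :
    (fun r => Real.log (M r) - Real.log (Φ r)) =o[atTop] fun r => r ^ q := by
  obtain ⟨C1, hC1, m1, h1⟩ := h1
  obtain ⟨C2, hC2, m2, h2⟩ := h2
  have hbig := eventually_mul_pow_le_of_exp_le hq hc hΦ (K := 2 * C2) (by positivity) m2
  set K := |Real.log (2 * C1)| + |Real.log (2 * C2)|
  refine Asymptotics.IsBigO.trans_isLittleO (Asymptotics.IsBigO.of_bound 1 ?_)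
    (isLittleO_const_add_mul_log hq K (m1 + m2))
  filter_upwards [h1, h2, hbig, hΦ, eventually_ge_atTop 1] with r a1 a2 a3 a4 hr
  have hr0 : 0 < r := by linarith
  have hlr := Real.log_nonneg hr
  have hΦ1 : 1 ≤ Φ r := (Real.one_le_exp (by positivity)).trans a4
  have hp1 : 0 < C1 * r ^ m1 := by positivity
  have hp2 : 0 < C2 * r ^ m2 := by positivity
  -- If M r < 1, the second comparison would put Φ r below 2 C2 r^m2, against its exponential
  -- growth. This lets the summand 1 in `PolyLE` be absorbed.
  have hM1 : 1 ≤ M r := by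
    by_contra hcon
    push Not at hcon
    have : C2 * r ^ m2 * (M r + 1) < C2 * r ^ m2 * 2 := by gcongr; linarith
    linarith
  have b1 : M r ≤ 2 * C1 * r ^ m1 * Φ r := by nlinarith
  have b2 : Φ r ≤ 2 * C2 * r ^ m2 * M r := by nlinarith
  have key : ∀ {C : ℝ} {m : ℕ} {x y : ℝ}, 0 < C → 1 ≤ x → 1 ≤ y → x ≤ C * r ^ m * y →
      Real.log x - Real.log y ≤ |Real.log C| + m * Real.log r := by
    intro C m x y hC hx hy hxy
    have := Real.log_le_log (by linarith) hxy
    rw [Real.log_mul (by positivity) (by linarith), Real.log_mul hC.ne' (by positivity),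
      Real.log_pow] at this
    have := le_abs_self (Real.log C)
    linarith
  have k1 := key (by positivity) hM1 hΦ1 b1
  have k2 := key (by positivity) hΦ1 hM1 b2
  have : (0 : ℝ) ≤ (m1 : ℝ) * Real.log r := by positivity
  have : (0 : ℝ) ≤ (m2 : ℝ) * Real.log r := by positivity
  have := abs_nonneg (Real.log (2 * C1))
  have := abs_nonneg (Real.log (2 * C2))
  rw [one_mul]
  refine le_trans ?_ (le_abs_self _)
  rw [Real.norm_eq_abs, abs_le]
  simp only [K]
  constructor <;> linarith

theorem entireOrder_eq {f : ℂ → ℂ} {q c C : ℝ} (hc : 0 < c)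
    (hlow : ∀ᶠ r in atTop, c * r ^ q ≤ Real.log (maxModulus f r))
    (hupp : ∀ᶠ r in atTop, Real.log (maxModulus f r) ≤ C * r ^ q) :
    entireOrder f = (q : EReal) := by
  have hlogtop := Real.tendsto_log_atTop
  have hlim : ∀ K : ℝ, Tendsto (fun r => (K + q * Real.log r) / Real.log r) atTop (𝓝 q) := by
    intro K
    have h : Tendsto (fun r => K / Real.log r + q) atTop (𝓝 (0 + q)) :=
      (hlogtop.const_div_atTop K).add_const q
    rw [zero_add] at h
    refine h.congr' ?_
    filter_upwards [eventually_gt_atTop 1] with r hr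
    have := Real.log_pos hr
    field_simp
  refine Tendsto.limsup_eq ?_
  rw [EReal.tendsto_coe]
  refine tendsto_of_tendsto_of_tendsto_of_le_of_le' (hlim (Real.log c)) (hlim (Real.log C)) ?_ ?_
  · filter_upwards [hlow, eventually_gt_atTop 1] with r h1 hr
    have := Real.log_pos hr
    have hr0 : 0 < r := by linarith
    rw [← Real.log_rpow hr0, ← Real.log_mul hc.ne' (by positivity)]
    gcongr
  · filter_upwards [hlow, hupp, eventually_gt_atTop 1] with r h1 h2 hr
    have := Real.log_pos hr
    have hr0 : 0 < r := by linarith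
    have hrq : 0 < r ^ q := by positivity
    have hpos : 0 < Real.log (maxModulus f r) := lt_of_lt_of_le (by positivity) h1
    have hC : 0 < C := by
      by_contra hcon
      push Not at hcon
      nlinarith
    rw [← Real.log_rpow hr0, ← Real.log_mul hC.ne' (by positivity)]
    gcongr

/-- The difference has `limsup` 0, neither `⊤` nor `⊥`, so subadditivity in `EReal` applies even if
the other two are infinite. -/
theorem limsup_coe_le_of_tendsto_sub {f g : ℝ → ℝ}
    (h : Tendsto (fun r => f r - g r) atTop (𝓝 0)) :
    limsup (fun r => (f r : EReal)) atTop ≤ limsup (fun r => (g r : EReal)) atTop := by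
  have h0 : limsup (fun r => ((f r - g r : ℝ) : EReal)) atTop = 0 := by
    have := (EReal.tendsto_coe.2 h).limsup_eq
    simpa using this
  have e : (fun r => (f r : EReal))
      = (fun r => (g r : EReal)) + fun r => ((f r - g r : ℝ) : EReal) := by
    funext r
    simp only [Pi.add_apply]
    rw [← EReal.coe_add]
    congr 1; ring
  rw [e]
  refine (EReal.limsup_add_le (Or.inr ?_) (Or.inr ?_)).trans ?_
  · rw [h0]; exact EReal.zero_ne_top
  · rw [h0]; exact EReal.zero_ne_bot
  · rw [h0, add_zero]

theorem limsup_coe_eq_of_tendsto_sub {f g : ℝ → ℝ}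
    (h : Tendsto (fun r => f r - g r) atTop (𝓝 0)) :
    limsup (fun r => (f r : EReal)) atTop = limsup (fun r => (g r : EReal)) atTop := by
  refine le_antisymm (limsup_coe_le_of_tendsto_sub h) (limsup_coe_le_of_tendsto_sub ?_)
  have := h.neg
  rw [neg_zero] at this
  exact this.congr fun r => by ring

theorem map_const_mul_atTop {κ : ℝ} (hκ : 0 < κ) : map (fun r : ℝ => κ * r) atTop = atTop :=
  (OrderIso.mulLeft₀ κ hκ).map_atTop

/-- The filter `atTop` is invariant under r ↦ κ r, and (κ r)^q = κ^q r^q. -/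
theorem entireType_eq {f g : ℂ → ℂ} {q κ : ℝ} (hκ : 0 < κ)
    (hf : entireOrder f = (q : EReal)) (hg : entireOrder g = (q : EReal))
    (h : (fun r => Real.log (maxModulus f r) - Real.log (maxModulus g (κ * r)))
      =o[atTop] fun r => r ^ q) :
    entireType f = ((κ ^ q : ℝ) : EReal) * entireType g := by
  unfold entireType
  rw [hf, hg, EReal.toReal_coe]
  have hh : Tendsto (fun r => Real.log (maxModulus f r) / r ^ q
      - Real.log (maxModulus g (κ * r)) / r ^ q) atTop (𝓝 0) :=
    h.tendsto_div_nhds_zero.congr fun r => by ring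
  rw [limsup_coe_eq_of_tendsto_sub hh,
    ← EReal.limsup_const_mul_of_nonneg_of_ne_top (EReal.coe_nonneg.2 (by positivity))
      (EReal.coe_ne_top _)]
  conv_rhs => rw [← map_const_mul_atTop hκ]
  rw [← limsup_comp]
  refine limsup_congr ?_
  filter_upwards [eventually_gt_atTop 0] with r hr
  simp only [Function.comp]
  rw [← EReal.coe_mul, Real.mul_rpow hκ.le hr.le]
  congr 1
  have : 0 < κ ^ q := by positivity
  have : 0 < r ^ q := by positivity
  field_simp

theorem maxModulus_le {f : ℂ → ℂ} {r B : ℝ} (hB : 0 ≤ B) (h : ∀ z, ‖z‖ = r → ‖f z‖ ≤ B) :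
    maxModulus f r ≤ B := by
  refine Real.sSup_le ?_ hB
  rintro _ ⟨z, hz, rfl⟩
  exact h z (by simpa using hz)

theorem norm_le_maxModulus {f : ℂ → ℂ} (hf : Continuous f) {r : ℝ} {z : ℂ} (hz : ‖z‖ = r) :
    ‖f z‖ ≤ maxModulus f r :=
  le_csSup ((isCompact_sphere (0 : ℂ) r).image hf.norm).bddAbove ⟨z, by simpa using hz, rfl⟩

/-! ### The reference weights -/

/-- The weights `(n + 1)^{-p/2}`. -/
def refWeight (p : ℝ) (n : ℕ) : ℝ := ((n : ℝ) + 1) ^ (-(p / 2))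

theorem refWeight_pos (p : ℝ) (n : ℕ) : 0 < refWeight p n := by
  unfold refWeight; positivity

theorem summable_add_one_rpow {s : ℝ} (hs : s < -1) :
    Summable fun n : ℕ => ((n : ℝ) + 1) ^ s := by
  have := (summable_nat_add_iff 1).2 (Real.summable_nat_rpow.2 hs)
  simpa using this

theorem isGoodWeights_refWeight {p : ℝ} (hp : 3 ≤ p) :
    IsGoodWeights (refWeight p) (refWeight p) where
  pos_u := refWeight_pos p
  pos_v := refWeight_pos p
  summable_v := summable_add_one_rpow (by linarith)
  summable_u := by
    refine ⟨1 / 4, by norm_num, ?_⟩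
    refine (summable_add_one_rpow (s := -(p / 2) + 1 / 4) (by linarith)).congr fun n => ?_
    rw [refWeight, ← Real.rpow_add (by positivity)]

/-- The growth function of the reference weights. -/
def refGrowth (p : ℝ) : ℝ → ℝ := bdLimX (refWeight p) (refWeight p) (1, 0)

/-- Dropping Y_n from the recursion leaves X_{n+1} ≥ (1 + r (n+1)^{-p}) X_n. The factors with n + 1
≤ r^{1/p} are at least 2, and there are at least r^{1/p}/2 of them. -/
theorem exp_le_refGrowth {p : ℝ} (hp : 3 ≤ p) :
    ∀ᶠ r in atTop, Real.exp (Real.log 2 / 2 * r ^ (1 / p)) ≤ refGrowth p r := by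
  have h := isGoodWeights_refWeight hp
  have hp0 : 0 < p := by linarith
  filter_upwards [eventually_ge_atTop 1] with r hr
  have hr0 : 0 ≤ r := by linarith
  have hprod : ∀ n, ∏ i ∈ Finset.range n, (1 + r * (refWeight p i * refWeight p i))
      ≤ (bdState (refWeight p) (refWeight p) r (1, 0) n).1 := by
    intro n
    induction n with
    | zero => simp [bdState_zero]
    | succ n ih =>
      rw [Finset.prod_range_succ, bdState_fst_succ, bdState_snd_succ]
      obtain ⟨hx, hy⟩ := bdState_nonneg (s := (1, 0)) h.pos_u h.pos_v hr0 zero_le_one le_rfl n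
      have hw := refWeight_pos p n
      refine (mul_le_mul_of_nonneg_right ih (by positivity)).trans ?_
      have : 0 ≤ refWeight p n * (bdState (refWeight p) (refWeight p) r (1, 0) n).2 := by
        positivity
      nlinarith
  set R := r ^ (1 / p)
  have hR : 1 ≤ R := Real.one_le_rpow hr (by positivity)
  have hRr : R ^ p = r := by
    rw [← Real.rpow_mul hr0, one_div_mul_cancel hp0.ne', Real.rpow_one]
  set N := ⌊R⌋₊
  have hN : R / 2 ≤ (N : ℝ) := by
    have a := Nat.lt_floor_add_one R
    have b : (1 : ℝ) ≤ (N : ℝ) := by exact_mod_cast (Nat.one_le_floor_iff R).2 hR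
    linarith
  have hNR : (N : ℝ) ≤ R := Nat.floor_le (by linarith)
  refine le_trans ?_ ((hprod N).trans
    (h.fst_le_lim (s := (1, 0)) hr0 zero_le_one le_rfl N))
  calc Real.exp (Real.log 2 / 2 * R) ≤ Real.exp (Real.log 2 * N) := by
        refine Real.exp_le_exp.2 ?_
        have := Real.log_pos (by norm_num : (1 : ℝ) < 2)
        nlinarith
    _ = ∏ i ∈ Finset.range N, (2 : ℝ) := by
        rw [Finset.prod_const, Finset.card_range, Real.exp_mul, Real.exp_log (by norm_num),
          Real.rpow_natCast]
    _ ≤ _ := by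
        refine Finset.prod_le_prod (fun _ _ => by norm_num) fun i hi => ?_
        have hi' : (i : ℝ) + 1 ≤ R := by
          have : ((i + 1 : ℕ) : ℝ) ≤ N := by exact_mod_cast Finset.mem_range.1 hi
          push_cast at this; linarith
        have e : refWeight p i * refWeight p i = ((i : ℝ) + 1) ^ (-p) := by
          rw [refWeight, ← Real.rpow_add (by positivity)]; congr 1; ring
        have : 1 ≤ r * (refWeight p i * refWeight p i) := by
          rw [e, Real.rpow_neg (by positivity), ← div_eq_mul_inv, le_div_iff₀ (by positivity),
            one_mul, ← hRr]
          exact Real.rpow_le_rpow (by positivity) hi' hp0.le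
        linarith

/-- Telescoping form of the bound for Σ i^{-1/2}; `one_div_mul_sqrt_succ_le` does the same for the
tails of Σ i^{-3/2}. -/
theorem one_div_sqrt_succ_le (n : ℕ) : 1 / √((n : ℝ) + 1) ≤ 2 * (√((n : ℝ) + 1) - √n) := by
  have h0 : (0 : ℝ) ≤ n := Nat.cast_nonneg n
  set a := √((n : ℝ) + 1)
  set b := √(n : ℝ)
  have ha : 0 < a := Real.sqrt_pos.2 (by positivity)
  have hb : 0 ≤ b := Real.sqrt_nonneg _
  have ha2 : a ^ 2 = n + 1 := Real.sq_sqrt (by positivity)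
  have hb2 : b ^ 2 = n := Real.sq_sqrt h0
  rw [div_le_iff₀ ha]
  nlinarith [sq_nonneg (a - b)]

theorem sum_one_div_sqrt_le (N : ℕ) :
    ∑ i ∈ Finset.range N, 1 / √((i : ℝ) + 1) ≤ 2 * √N := by
  induction N with
  | zero => simp
  | succ N ih =>
    rw [Finset.sum_range_succ]
    have := one_div_sqrt_succ_le N
    push_cast
    linarith

theorem one_div_mul_sqrt_succ_le {x : ℝ} (hx : 0 < x) :
    1 / ((x + 1) * √(x + 1)) ≤ 2 * (1 / √x - 1 / √(x + 1)) := by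
  set a := √(x + 1)
  set b := √x
  have ha : 0 < a := Real.sqrt_pos.2 (by positivity)
  have hb : 0 < b := Real.sqrt_pos.2 hx
  have ha2 : a ^ 2 = x + 1 := Real.sq_sqrt (by positivity)
  have hb2 : b ^ 2 = x := Real.sq_sqrt hx.le
  have hab : b ≤ a := Real.sqrt_le_sqrt (by linarith)
  rw [← ha2]
  have e : 2 * (1 / b - 1 / a) = 2 * (a - b) / (a * b) := by field_simp
  rw [e, div_le_div_iff₀ (by positivity) (by positivity)]
  have h1 : (a - b) * (a + b) = 1 := by nlinarith
  have h2 : 0 ≤ a - b := by linarith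
  have h3 : 1 ≤ 2 * (a - b) * a := by nlinarith
  calc 1 * (a * b) ≤ a * a := by nlinarith
    _ = 1 * (a * a) := by ring
    _ ≤ (2 * (a - b) * a) * (a * a) := by gcongr
    _ = _ := by ring

theorem sum_one_div_mul_sqrt_le {N : ℕ} (hN : 0 < N) (k : ℕ) :
    ∑ i ∈ Finset.range k, 1 / ((((N + i : ℕ) : ℝ) + 1) * √(((N + i : ℕ) : ℝ) + 1))
      ≤ 2 / √N := by
  have key : ∑ i ∈ Finset.range k, 1 / ((((N + i : ℕ) : ℝ) + 1) * √(((N + i : ℕ) : ℝ) + 1))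
      ≤ 2 * (1 / √N - 1 / √((N + k : ℕ) : ℝ)) := by
    induction k with
    | zero => simp
    | succ k ih =>
      rw [Finset.sum_range_succ]
      have := one_div_mul_sqrt_succ_le (x := ((N + k : ℕ) : ℝ)) (by positivity)
      have e : ((N + (k + 1) : ℕ) : ℝ) = ((N + k : ℕ) : ℝ) + 1 := by push_cast; ring
      rw [e]
      linarith
  have : 0 ≤ 1 / √((N + k : ℕ) : ℝ) := by positivity
  calc _ ≤ _ := key
    _ ≤ 2 * (1 / √N) := by linarith
    _ = _ := by ring

/-- With s = √x: 1 + s^p ≤ (1 + s)^p ≤ e^{p s}. It is applied where x may be large. -/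
theorem one_add_rpow_le_exp {x p : ℝ} (hx : 0 ≤ x) (hp : 3 ≤ p) :
    1 + x ^ (p / 2) ≤ Real.exp (p * √x) := by
  have hs := Real.sqrt_nonneg x
  have e : x ^ (p / 2) = √x ^ p := by
    rw [Real.sqrt_eq_rpow, ← Real.rpow_mul hx]; congr 1; ring
  have h1 : 1 + √x ^ p ≤ (1 + √x) ^ p := by
    have := Real.add_rpow_le_rpow_add (p := p) zero_le_one hs (by linarith)
    rwa [Real.one_rpow] at this
  rw [e]
  refine h1.trans ?_
  rw [mul_comm, Real.exp_mul]
  refine Real.rpow_le_rpow (by positivity) ?_ (by linarith)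
  have := Real.add_one_le_exp √x
  linarith

/-- For x ≤ 1 and p ≥ 3 the power p/2 may be lowered to 3/2, which is still summable along x = R/(i
+ 1). -/
theorem one_add_rpow_le_exp_of_le_one {x p : ℝ} (hx : 0 ≤ x) (hx1 : x ≤ 1) (hp : 3 ≤ p) :
    1 + x ^ (p / 2) ≤ Real.exp (p * (x * √x)) := by
  have e : x * √x = x ^ (3 / 2 : ℝ) := by
    rcases hx.eq_or_lt with rfl | hx0
    · simp
    · rw [Real.sqrt_eq_rpow]
      nth_rewrite 1 [← Real.rpow_one x]
      rw [← Real.rpow_add hx0]; norm_num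
  have h1 : x ^ (p / 2) ≤ x * √x := by
    rw [e]
    exact Real.rpow_le_rpow_of_exponent_ge_of_imp hx hx1 (by linarith) (by intros; linarith)
  have : 0 ≤ x * √x := by positivity
  have := Real.add_one_le_exp (p * (x * √x))
  nlinarith

/-- Splitting at i ≈ R, the head is controlled by Σ (R/i)^{1/2} and the tail by Σ (R/i)^{3/2}. Both
are O(R). -/
theorem prod_one_add_rpow_le {p R : ℝ} (hp : 3 ≤ p) (hR : 1 ≤ R) (n : ℕ) :
    ∏ i ∈ Finset.range n, (1 + (R / ((i : ℝ) + 1)) ^ (p / 2)) ≤ Real.exp (6 * p * R) := by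
  have hR0 : 0 < R := by linarith
  set N := ⌈R⌉₊
  have hN1 : 0 < N := Nat.ceil_pos.2 hR0
  have hNR : R ≤ N := Nat.le_ceil R
  have hN2 : (N : ℝ) ≤ 2 * R := by
    have := Nat.ceil_lt_add_one hR0.le
    linarith
  have hpos : ∀ i : ℕ, (1 : ℝ) ≤ 1 + (R / ((i : ℝ) + 1)) ^ (p / 2) := fun i => by
    have : 0 ≤ (R / ((i : ℝ) + 1)) ^ (p / 2) := by positivity
    linarith
  have hmono : ∏ i ∈ Finset.range n, (1 + (R / ((i : ℝ) + 1)) ^ (p / 2))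
      ≤ ∏ i ∈ Finset.range (N + n), (1 + (R / ((i : ℝ) + 1)) ^ (p / 2)) :=
    monotone_nat_of_le_succ (f := fun m =>
      ∏ i ∈ Finset.range m, (1 + (R / ((i : ℝ) + 1)) ^ (p / 2))) (fun m => by
      rw [Finset.prod_range_succ]
      exact le_mul_of_one_le_right
        (Finset.prod_nonneg fun i _ => zero_le_one.trans (hpos i)) (hpos m)) (Nat.le_add_left n N)
  refine hmono.trans ?_
  rw [Finset.prod_range_add]
  have hA : ∏ i ∈ Finset.range N, (1 + (R / ((i : ℝ) + 1)) ^ (p / 2)) ≤ Real.exp (4 * p * R) := by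
    calc _ ≤ ∏ i ∈ Finset.range N, Real.exp (p * √(R / ((i : ℝ) + 1))) :=
          Finset.prod_le_prod (fun i _ => zero_le_one.trans (hpos i)) fun i _ =>
            one_add_rpow_le_exp (by positivity) hp
      _ = Real.exp (p * √R * ∑ i ∈ Finset.range N, 1 / √((i : ℝ) + 1)) := by
          rw [← Real.exp_sum, Finset.mul_sum]
          congr 1
          refine Finset.sum_congr rfl fun i _ => ?_
          rw [Real.sqrt_div hR0.le]; ring
      -- N ≤ 2R is weakened to 4R, whose square root is 2√R.
      _ ≤ Real.exp (p * √R * (2 * √(4 * R))) := by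
          refine Real.exp_le_exp.2 ?_
          refine mul_le_mul_of_nonneg_left ((sum_one_div_sqrt_le N).trans ?_) (by positivity)
          gcongr
          linarith
      _ = _ := by
          rw [Real.sqrt_mul (by norm_num), show √(4 : ℝ) = 2 by
            rw [show (4 : ℝ) = 2 ^ 2 by norm_num]; exact Real.sqrt_sq (by norm_num)]
          congr 1
          have := Real.mul_self_sqrt hR0.le
          linear_combination 4 * p * this
  have hB : ∏ i ∈ Finset.range n, (1 + (R / (((N + i : ℕ) : ℝ) + 1)) ^ (p / 2))
      ≤ Real.exp (2 * p * R) := by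
    calc _ ≤ ∏ i ∈ Finset.range n, Real.exp (p * ((R / (((N + i : ℕ) : ℝ) + 1))
            * √(R / (((N + i : ℕ) : ℝ) + 1)))) :=
          Finset.prod_le_prod (fun i _ => zero_le_one.trans (hpos (N + i))) fun i _ =>
            one_add_rpow_le_exp_of_le_one (by positivity) (by
              rw [div_le_one (by positivity)]
              push_cast
              linarith [Nat.cast_nonneg (α := ℝ) i]) hp
      _ = Real.exp (p * (R * √R) * ∑ i ∈ Finset.range n,
            1 / ((((N + i : ℕ) : ℝ) + 1) * √(((N + i : ℕ) : ℝ) + 1))) := by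
          rw [← Real.exp_sum, Finset.mul_sum]
          congr 1
          refine Finset.sum_congr rfl fun i _ => ?_
          rw [Real.sqrt_div hR0.le]; field_simp
      _ ≤ Real.exp (p * (R * √R) * (2 / √R)) := by
          refine Real.exp_le_exp.2 ?_
          refine mul_le_mul_of_nonneg_left ((sum_one_div_mul_sqrt_le hN1 n).trans ?_)
            (by positivity)
          gcongr
      _ = _ := by
          congr 1
          have : 0 < √R := Real.sqrt_pos.2 hR0
          field_simp
  calc _ ≤ Real.exp (4 * p * R) * Real.exp (2 * p * R) := by
        refine mul_le_mul hA hB ?_ (Real.exp_pos _).le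
        exact Finset.prod_nonneg fun i _ => zero_le_one.trans (hpos (N + i))
    _ = _ := by rw [← Real.exp_add]; congr 1; ring

/-- The weight t = r^{-1/2} in `bdState_weighted_le` balances the two factors: both become 1 + √r
(i+1)^{-p/2} = 1 + (R/(i+1))^{p/2} with R = r^{1/p}. -/
theorem refGrowth_le_exp {p : ℝ} (hp : 3 ≤ p) :
    ∀ᶠ r in atTop, refGrowth p r ≤ Real.exp (12 * p * r ^ (1 / p)) := by
  have h := isGoodWeights_refWeight hp
  have hp0 : 0 < p := by linarith
  filter_upwards [eventually_ge_atTop 1] with r hr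
  have hr0 : 0 < r := by linarith
  set R := r ^ (1 / p)
  have hR : 1 ≤ R := Real.one_le_rpow hr (by positivity)
  have hRr : R ^ (p / 2) = √r := by
    rw [← Real.rpow_mul hr0.le, Real.sqrt_eq_rpow]; congr 1; field_simp
  have hs : 0 < √r := Real.sqrt_pos.2 hr0
  refine ciSup_le fun n => ?_
  have hw := bdState_weighted_le (s := (1, 0)) h.pos_u h.pos_v hr0.le zero_le_one le_rfl
    (inv_pos.2 hs) 0 n
  simp only [zero_add, bdState_zero, mul_zero, add_zero, one_mul] at hw
  have hy := (bdState_nonneg (s := (1, 0)) h.pos_u h.pos_v hr0.le zero_le_one le_rfl n).2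
  have hy' : 0 ≤ (√r)⁻¹ * (bdState (refWeight p) (refWeight p) r (1, 0) n).2 := by positivity
  have e : ∀ i : ℕ, (1 + (√r)⁻¹ * r * refWeight p i) * (1 + refWeight p i / (√r)⁻¹)
      = (1 + (R / ((i : ℝ) + 1)) ^ (p / 2)) * (1 + (R / ((i : ℝ) + 1)) ^ (p / 2)) := by
    intro i
    have e1 : (√r)⁻¹ * r = √r := by
      have := Real.mul_self_sqrt hr0.le
      field_simp; linarith
    rw [e1, Real.div_rpow (by linarith) (by positivity), hRr, refWeight,
      Real.rpow_neg (by positivity), div_inv_eq_mul]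
    ring
  simp only [e, Finset.prod_mul_distrib] at hw
  have hb := prod_one_add_rpow_le hp hR n
  have hb0 : 0 ≤ ∏ i ∈ Finset.range n, (1 + (R / ((i : ℝ) + 1)) ^ (p / 2)) :=
    Finset.prod_nonneg fun i _ => by positivity
  calc _ ≤ _ := le_add_of_nonneg_right hy'
    _ ≤ _ := hw
    _ ≤ Real.exp (6 * p * R) * Real.exp (6 * p * R) := by gcongr
    _ = _ := by rw [← Real.exp_add]; congr 1; ring

/-! ### Multi-zeta values as coefficients of the reference growth function -/

theorem alternatingTuples_mono {n : ℕ} {t : Fin (2 * n) → ℕ} (ht : t ∈ alternatingTuples n)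
    (d : ℕ) : ∀ i j : Fin (2 * n), (j : ℕ) = i + d → t i ≤ t j := by
  induction d with
  | zero =>
    intro i j hij
    have : i = j := Fin.ext (by omega)
    rw [this]
  | succ d ih =>
    intro i j hij
    have hlt := j.isLt
    obtain ⟨h1, h2⟩ := ht.2 ⟨i + d, by omega⟩ j (by simp; omega)
    refine (ih i ⟨i + d, by omega⟩ rfl).trans ?_
    rcases Nat.even_or_odd (i + d : ℕ) with h | h
    · exact h1 h
    · exact (h2 h).le

/-- Append the entries `k + 1`, `m + 1` to a tuple. -/
def pushTuple {n : ℕ} (k m : ℕ) (t : Fin (2 * n) → ℕ) : Fin (2 * (n + 1)) → ℕ := fun i =>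
  if h : (i : ℕ) < 2 * n then t ⟨i, h⟩ else if (i : ℕ) = 2 * n then k + 1 else m + 1

/-- Drop the last two entries of a tuple. -/
def popTuple {n : ℕ} (t : Fin (2 * (n + 1)) → ℕ) : Fin (2 * n) → ℕ := fun i =>
  t ⟨i, by have := i.isLt; omega⟩

open Classical in
/-- The alternating tuples with entries at most `N`. -/
def alternatingFinset (N n : ℕ) : Finset (Fin (2 * n) → ℕ) :=
  (Fintype.piFinset fun _ => Finset.Icc 1 N).filter (· ∈ alternatingTuples n)

theorem mem_alternatingFinset {N n : ℕ} {t : Fin (2 * n) → ℕ} :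
    t ∈ alternatingFinset N n ↔ (∀ i, t i ≤ N) ∧ t ∈ alternatingTuples n := by
  simp only [alternatingFinset, Finset.mem_filter, Fintype.mem_piFinset, Finset.mem_Icc]
  exact ⟨fun h => ⟨fun i => (h.1 i).2, h.2⟩, fun h => ⟨fun i => ⟨h.2.1 i, h.1 i⟩, h.2⟩⟩

/-- The old entries are at most k, hence strictly below the new entry k + 1; inside the new pair the
inequality k ≤ m is weak. This is exactly the alternating pattern. -/
theorem pushTuple_mem {N n k m : ℕ} {t : Fin (2 * n) → ℕ} (hm : m < N) (hk : k ≤ m)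
    (ht : t ∈ alternatingFinset k n) : pushTuple k m t ∈ alternatingFinset N (n + 1) := by
  rw [mem_alternatingFinset] at ht ⊢
  obtain ⟨htk, ht1, ht2⟩ := ht
  refine ⟨fun i => ?_, fun i => ?_, fun i j hij => ⟨fun hi => ?_, fun hi => ?_⟩⟩
  · unfold pushTuple
    split_ifs with h1 h2
    · exact (htk _).trans (by omega)
    · omega
    · omega
  · unfold pushTuple
    split_ifs with h1 h2
    · exact ht1 _
    · omega
    · omega
  · unfold pushTuple
    have := j.isLt
    split_ifs with h1 h2 h3 h4 h5 h6
    · exact (ht2 ⟨i, h1⟩ ⟨j, h2⟩ hij).1 hi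
    · exact (htk _).trans (by omega)
    · exact (htk _).trans (by omega)
    · omega
    · omega
    · omega
    · omega
    · omega
    · omega
  · unfold pushTuple
    have := j.isLt
    rw [Nat.odd_iff] at hi
    split_ifs with h1 h2 h3 h4 h5 h6
    · exact (ht2 ⟨i, h1⟩ ⟨j, h2⟩ hij).2 (Nat.odd_iff.2 hi)
    · exact Nat.lt_succ_of_le (htk _)
    · omega
    · omega
    · omega
    · omega
    · omega
    · omega
    · omega

theorem popTuple_mem {N n : ℕ} {t : Fin (2 * (n + 1)) → ℕ}
    (ht : t ∈ alternatingFinset N (n + 1)) :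
    t ⟨2 * n + 1, by omega⟩ - 1 < N ∧ t ⟨2 * n, by omega⟩ ≤ t ⟨2 * n + 1, by omega⟩ ∧
      popTuple t ∈ alternatingFinset (t ⟨2 * n, by omega⟩ - 1) n := by
  rw [mem_alternatingFinset] at ht
  obtain ⟨htN, hta⟩ := ht
  have h1 := hta.1 ⟨2 * n + 1, by omega⟩
  have h2 := htN ⟨2 * n + 1, by omega⟩
  refine ⟨by omega, (hta.2 ⟨2 * n, by omega⟩ ⟨2 * n + 1, by omega⟩ rfl).1 (by simp), ?_⟩
  rw [mem_alternatingFinset]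
  refine ⟨fun i => ?_, fun i => hta.1 _, fun i j hij =>
    hta.2 ⟨i, by omega⟩ ⟨j, by omega⟩ hij⟩
  have hi := i.isLt
  have a := alternatingTuples_mono hta (2 * n - 1 - i) ⟨i, by omega⟩ ⟨2 * n - 1, by omega⟩
    (by simp; omega)
  have b := (hta.2 ⟨2 * n - 1, by omega⟩ ⟨2 * n, by omega⟩ (by simp; omega)).2
    (Nat.odd_iff.2 (by simp; omega))
  unfold popTuple
  omega

theorem multiZetaTerm_nonneg (p : ℝ) (n : ℕ) (t : Fin (2 * n) → ℕ) : 0 ≤ multiZetaTerm p n t := by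
  unfold multiZetaTerm; positivity

theorem multiZetaTerm_pushTuple (p : ℝ) {n k m : ℕ} (t : Fin (2 * n) → ℕ) :
    multiZetaTerm p (n + 1) (pushTuple k m t)
      = refWeight p m * (refWeight p k * multiZetaTerm p n t) := by
  have e : ∏ i, (pushTuple k m t i : ℝ) = (∏ i, (t i : ℝ)) * ((k : ℝ) + 1) * ((m : ℝ) + 1) := by
    change ∏ i : Fin (2 * n + 1 + 1), (pushTuple k m t i : ℝ) = _
    rw [Fin.prod_univ_castSucc, Fin.prod_univ_castSucc]
    simp [pushTuple]
  have h0 : 0 ≤ ∏ i, (t i : ℝ) := Finset.prod_nonneg fun i _ => Nat.cast_nonneg _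
  unfold multiZetaTerm refWeight
  rw [e, Real.mul_rpow (by positivity) (by positivity), Real.mul_rpow h0 (by positivity)]
  ring

/-- The partial sums of the multi-zeta values over tuples with entries at most `N`. -/
def multiZetaPartial (p : ℝ) (N n : ℕ) : ℝ :=
  ∑ t ∈ alternatingFinset N n, multiZetaTerm p n t

/-- Tuples are sorted by their last two entries k + 1 ≤ m + 1; what remains is a shorter tuple with
entries at most k. -/
theorem multiZetaPartial_succ (p : ℝ) (N n : ℕ) :
    multiZetaPartial p N (n + 1) = ∑ m ∈ Finset.range N, refWeight p m
      * ∑ k ∈ Finset.range (m + 1), refWeight p k * multiZetaPartial p k n := by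
  simp only [multiZetaPartial, Finset.mul_sum]
  have hs : ∀ m, (∑ k ∈ Finset.range (m + 1), ∑ t ∈ alternatingFinset k n,
      refWeight p m * (refWeight p k * multiZetaTerm p n t))
      = ∑ x ∈ (Finset.range (m + 1)).sigma fun k => alternatingFinset k n,
        refWeight p m * (refWeight p x.1 * multiZetaTerm p n x.2) := fun m =>
    Finset.sum_sigma' _ _ _
  simp only [hs]
  rw [Finset.sum_sigma']
  refine Finset.sum_nbij'
    (fun t => (⟨t ⟨2 * n + 1, by omega⟩ - 1, ⟨t ⟨2 * n, by omega⟩ - 1, popTuple t⟩⟩ :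
      Σ _ : ℕ, Σ _ : ℕ, (Fin (2 * n) → ℕ)))
    (fun x => pushTuple x.2.1 x.1 x.2.2) ?_ ?_ ?_ ?_ ?_
  · intro t ht
    obtain ⟨h1, h2, h3⟩ := popTuple_mem ht
    simp only [Finset.mem_sigma, Finset.mem_range]
    exact ⟨h1, by omega, h3⟩
  · rintro ⟨m, k, t⟩ h
    simp only [Finset.mem_sigma, Finset.mem_range] at h
    exact pushTuple_mem h.1 (Nat.lt_succ_iff.1 h.2.1) h.2.2
  · intro t ht
    rw [mem_alternatingFinset] at ht
    have h1 := ht.2.1 ⟨2 * n + 1, by omega⟩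
    have h2 := ht.2.1 ⟨2 * n, by omega⟩
    funext i
    have := i.isLt
    simp only [pushTuple, popTuple]
    split_ifs with a b
    · rfl
    · have : i = ⟨2 * n, by omega⟩ := Fin.ext b
      rw [this]; omega
    · have : i = ⟨2 * n + 1, by omega⟩ := Fin.ext (by simp; omega)
      rw [this]; omega
  · rintro ⟨m, k, t⟩ h
    have e : popTuple (pushTuple k m t) = t := by
      funext i
      simp [pushTuple, popTuple]
    simp [e, pushTuple]
  · intro t ht
    rw [mem_alternatingFinset] at ht
    have h1 := ht.2.1 ⟨2 * n + 1, by omega⟩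
    have h2 := ht.2.1 ⟨2 * n, by omega⟩
    dsimp only
    rw [← multiZetaTerm_pushTuple]
    congr 1
    funext i
    have := i.isLt
    simp only [pushTuple, popTuple]
    split_ifs with a b
    · rfl
    · have : i = ⟨2 * n, by omega⟩ := Fin.ext b
      rw [this]; omega
    · have : i = ⟨2 * n + 1, by omega⟩ := Fin.ext (by simp; omega)
      rw [this]; omega

theorem multiZetaPartial_zero (p : ℝ) (N : ℕ) : multiZetaPartial p N 0 = 1 := by
  have e : alternatingFinset N 0 = {fun i => i.elim0} := by
    ext t
    rw [mem_alternatingFinset, Finset.mem_singleton]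
    refine ⟨fun _ => funext fun i => i.elim0, fun _ => ⟨fun i => i.elim0, fun i => i.elim0,
      fun i => i.elim0⟩⟩
  rw [multiZetaPartial, e, Finset.sum_singleton, multiZetaTerm]
  simp

/-- Substituting Y_{m+1} = r Σ_{k ≤ m} w_k X_k into X_N = 1 + Σ_{m < N} w_m Y_{m+1} gives,
coefficient by coefficient in r, the recursion of `multiZetaPartial_succ`. All X_k with k < N occur,
hence the strong induction. -/
theorem hasSum_multiZetaPartial (p r : ℝ) (N : ℕ) :
    HasSum (fun n => multiZetaPartial p N n * r ^ n)
      (bdState (refWeight p) (refWeight p) r (1, 0) N).1 := by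
  induction N using Nat.strong_induction_on with
  | _ N ih =>
    rw [bdState_fst_eq_sum, add_comm]
    have h : HasSum (fun n => multiZetaPartial p N (n + 1) * r ^ (n + 1))
        (∑ m ∈ Finset.range N, refWeight p m *
          (bdState (refWeight p) (refWeight p) r (1, 0) (m + 1)).2) := by
      have e : (fun n => multiZetaPartial p N (n + 1) * r ^ (n + 1))
          = fun n => ∑ m ∈ Finset.range N, refWeight p m * (r *
            ∑ k ∈ Finset.range (m + 1), refWeight p k * (multiZetaPartial p k n * r ^ n)) := by
        funext n
        rw [multiZetaPartial_succ, Finset.sum_mul]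
        refine Finset.sum_congr rfl fun m _ => ?_
        simp only [Finset.mul_sum, Finset.sum_mul]
        refine Finset.sum_congr rfl fun k _ => ?_
        ring
      rw [e]
      refine hasSum_sum fun m hm => ?_
      rw [bdState_snd_eq_sum, zero_add]
      refine HasSum.mul_left _ (HasSum.mul_left _ (hasSum_sum fun k hk => ?_))
      refine HasSum.mul_left _ (ih k ?_)
      have := Finset.mem_range.1 hm
      have := Finset.mem_range.1 hk
      omega
    have := (hasSum_nat_add_iff (f := fun n => multiZetaPartial p N n * r ^ n) 1).1 h
    simpa [multiZetaPartial_zero] using this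

theorem multiZetaPartial_nonneg (p : ℝ) (N n : ℕ) : 0 ≤ multiZetaPartial p N n :=
  Finset.sum_nonneg fun t _ => multiZetaTerm_nonneg p n t

section

variable {p : ℝ}

theorem multiZetaPartial_mul_pow_le (hp : 3 ≤ p) {r : ℝ} (hr : 0 ≤ r) (N : ℕ) (s : Finset ℕ) :
    ∑ n ∈ s, multiZetaPartial p N n * r ^ n ≤ refGrowth p r := by
  have h := hasSum_multiZetaPartial p r N
  refine (sum_le_hasSum s (fun n _ => ?_) h).trans
    ((isGoodWeights_refWeight hp).fst_le_lim (s := (1, 0)) hr zero_le_one le_rfl N)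
  have := multiZetaPartial_nonneg p N n
  positivity

open Classical in
theorem sum_subtype_multiZetaTerm (p : ℝ) (N n : ℕ) :
    ∑ t ∈ (alternatingFinset N n).subtype (· ∈ alternatingTuples n), multiZetaTerm p n t
      = multiZetaPartial p N n := by
  rw [Finset.sum_subtype_eq_sum_filter, Finset.filter_true_of_mem]
  · rfl
  · intro t ht
    exact (mem_alternatingFinset.1 ht).2

open Classical in
theorem tendsto_alternatingFinset (n : ℕ) :
    Tendsto (fun N => (alternatingFinset N n).subtype (· ∈ alternatingTuples n)) atTop atTop := by
  refine tendsto_atTop_finset_of_monotone (fun N M hNM => ?_) fun t => ?_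
  · intro t ht
    rw [Finset.mem_subtype, mem_alternatingFinset] at ht ⊢
    exact ⟨fun i => (ht.1 i).trans hNM, ht.2⟩
  · refine ⟨∑ i, t.1 i, ?_⟩
    rw [Finset.mem_subtype, mem_alternatingFinset]
    exact ⟨fun i => Finset.single_le_sum (f := t.1) (fun _ _ => Nat.zero_le _)
      (Finset.mem_univ i), t.2⟩

/-- A finite sum of terms is at most one coefficient of some X_N, hence at most X_N at r = 1, which
is bounded in N. -/
theorem summable_multiZetaTerm (hp : 3 ≤ p) (n : ℕ) :
    Summable fun k : alternatingTuples n => multiZetaTerm p n k := by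
  refine summable_of_sum_le (c := refGrowth p 1) (fun k => multiZetaTerm_nonneg p n k) fun s => ?_
  obtain ⟨N, hN⟩ := ((tendsto_alternatingFinset n).eventually_ge_atTop s).exists
  refine (Finset.sum_le_sum_of_subset_of_nonneg hN fun t _ _ => multiZetaTerm_nonneg p n t).trans ?_
  rw [sum_subtype_multiZetaTerm]
  simpa using multiZetaPartial_mul_pow_le hp zero_le_one N {n}

theorem tendsto_multiZetaPartial (hp : 3 ≤ p) (n : ℕ) :
    Tendsto (fun N => multiZetaPartial p N n) atTop (𝓝 (multiZeta p n)) := by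
  have := (summable_multiZetaTerm hp n).hasSum.comp (tendsto_alternatingFinset n)
  exact this.congr fun N => sum_subtype_multiZetaTerm p N n

theorem multiZetaPartial_le (hp : 3 ≤ p) (N n : ℕ) : multiZetaPartial p N n ≤ multiZeta p n := by
  rw [← sum_subtype_multiZetaTerm]
  exact (summable_multiZetaTerm hp n).sum_le_tsum _ fun t _ => multiZetaTerm_nonneg p n t

theorem multiZeta_nonneg (p : ℝ) (n : ℕ) : 0 ≤ multiZeta p n :=
  tsum_nonneg fun t => multiZetaTerm_nonneg p n t

/-- All terms are nonnegative and increase with N, so the limit in N and the sum over n can be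
exchanged. -/
theorem hasSum_multiZeta (hp : 3 ≤ p) {r : ℝ} (hr : 0 ≤ r) :
    HasSum (fun n => multiZeta p n * r ^ n) (refGrowth p r) := by
  have hnn : ∀ n, 0 ≤ multiZeta p n * r ^ n := fun n => by
    have := multiZeta_nonneg p n
    positivity
  have hle : ∀ s : Finset ℕ, ∑ n ∈ s, multiZeta p n * r ^ n ≤ refGrowth p r := fun s =>
    le_of_tendsto' (tendsto_finsetSum s fun n _ => (tendsto_multiZetaPartial hp n).mul_const _)
      fun N => multiZetaPartial_mul_pow_le hp hr N s
  have hs : Summable fun n => multiZeta p n * r ^ n := summable_of_sum_le hnn hle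
  have : ∑' n, multiZeta p n * r ^ n = refGrowth p r := by
    refine le_antisymm (hs.tsum_le_of_sum_le hle) (ciSup_le fun N => ?_)
    refine (hasSum_le (fun n => ?_) (hasSum_multiZetaPartial p r N) hs.hasSum)
    exact mul_le_mul_of_nonneg_right (multiZetaPartial_le hp N n) (by positivity)
  rw [← this]
  exact hs.hasSum

theorem multiZeta_zero (hp : 3 ≤ p) : multiZeta p 0 = 1 := by
  refine tendsto_nhds_unique (tendsto_multiZetaPartial hp 0) ?_
  simp only [multiZetaPartial_zero]
  exact tendsto_const_nhds

theorem hasSum_multiZeta_succ (hp : 3 ≤ p) {r : ℝ} (hr : 0 ≤ r) :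
    HasSum (fun n => multiZeta p (n + 1) * r ^ (n + 1)) (refGrowth p r - 1) := by
  have := (hasSum_nat_add_iff' (f := fun n => multiZeta p n * r ^ n) 1).2 (hasSum_multiZeta hp hr)
  simpa [multiZeta_zero hp] using this

theorem norm_multiZeta_mul_pow (p : ℝ) (n : ℕ) (z : ℂ) :
    ‖(multiZeta p n : ℂ) * z ^ n‖ = multiZeta p n * ‖z‖ ^ n := by
  rw [norm_mul, norm_pow, Complex.norm_real, Real.norm_of_nonneg (multiZeta_nonneg p n)]

theorem summable_multiZeta_mul_pow (hp : 3 ≤ p) (z : ℂ) :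
    Summable fun n : ℕ => (multiZeta p (n + 1) : ℂ) * z ^ (n + 1) := by
  refine Summable.of_norm ?_
  simp only [norm_multiZeta_mul_pow]
  exact (hasSum_multiZeta_succ hp (norm_nonneg z)).summable

theorem norm_multiZetaFun_le (hp : 3 ≤ p) (z : ℂ) :
    ‖multiZetaFun p z‖ ≤ refGrowth p ‖z‖ - 1 := by
  have h := hasSum_multiZeta_succ hp (norm_nonneg z)
  exact tsum_of_norm_bounded h fun n => (norm_multiZeta_mul_pow p (n + 1) z).le

theorem multiZetaFun_ofReal (hp : 3 ≤ p) {r : ℝ} (hr : 0 ≤ r) :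
    multiZetaFun p r = ((refGrowth p r - 1 : ℝ) : ℂ) := by
  rw [← (hasSum_multiZeta_succ hp hr).tsum_eq, Complex.ofReal_tsum]
  simp [multiZetaFun]

theorem differentiable_multiZetaFun (hp : 3 ≤ p) : Differentiable ℂ (multiZetaFun p) := by
  intro z
  have hd : DifferentiableOn ℂ (multiZetaFun p) (Metric.ball 0 (‖z‖ + 1)) := by
    refine Complex.differentiableOn_tsum_of_summable_norm
      (u := fun n => multiZeta p (n + 1) * (‖z‖ + 1) ^ (n + 1))
      (hasSum_multiZeta_succ hp (by positivity)).summable (fun n => ?_) Metric.isOpen_ball ?_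
    · fun_prop
    · intro n w hw
      rw [norm_multiZeta_mul_pow]
      have := multiZeta_nonneg p (n + 1)
      have hw' : ‖w‖ ≤ ‖z‖ + 1 := by simpa using (Metric.mem_ball.1 hw).le
      gcongr
  exact hd.differentiableAt (Metric.isOpen_ball.mem_nhds (by simp))

/-- Since γ_n ≥ 0, the maximum of |G_p| on a circle is taken at the positive point, where it equals
`refGrowth` minus 1. The reverse comparison `refGrowth_polyLE` uses that point. -/
theorem polyLE_maxModulus_multiZetaFun (hp : 3 ≤ p) :
    PolyLE (maxModulus (multiZetaFun p)) (refGrowth p) := by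
  refine ⟨1, one_pos, 0, ?_⟩
  filter_upwards [eventually_ge_atTop 0] with r hr
  have h1 : 1 ≤ refGrowth p r :=
    (isGoodWeights_refWeight hp).fst_le_lim (s := (1, 0)) hr zero_le_one le_rfl 0
  refine maxModulus_le (by simp; linarith) fun z hz => ?_
  have := norm_multiZetaFun_le hp z
  rw [hz] at this
  simp
  linarith

theorem refGrowth_polyLE (hp : 3 ≤ p) :
    PolyLE (refGrowth p) (maxModulus (multiZetaFun p)) := by
  refine ⟨1, one_pos, 0, ?_⟩
  filter_upwards [eventually_ge_atTop 0] with r hr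
  have := norm_le_maxModulus (differentiable_multiZetaFun hp).continuous (r := r) (z := (r : ℂ))
    (by simpa using hr)
  rw [multiZetaFun_ofReal hp hr, Complex.norm_real] at this
  have := (le_abs_self (refGrowth p r - 1)).trans this
  simp
  linarith

end

/-! ### Orthogonal polynomials of a birth and death process -/

/-- The potential coefficients `π_n = λ_0 ⋯ λ_{n-1} / (μ_1 ⋯ μ_n)` of a birth and death process. -/
def bdPotential (lam mu : ℕ → ℝ) (n : ℕ) : ℝ := ∏ i ∈ Finset.range n, lam i / mu (i + 1)

/-- The coefficients `1 / (λ_n π_n)`. -/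
def bdScale (lam mu : ℕ → ℝ) (n : ℕ) : ℝ := (lam n * bdPotential lam mu n)⁻¹

/-- The value `P_n(0) = (-1)^n √π_n`. -/
def bdSign (lam mu : ℕ → ℝ) (n : ℕ) : ℝ := (-1) ^ n * √(bdPotential lam mu n)

section Rates

variable {lam mu : ℕ → ℝ}

theorem bdPotential_succ (lam mu : ℕ → ℝ) (n : ℕ) :
    bdPotential lam mu (n + 1) = bdPotential lam mu n * (lam n / mu (n + 1)) :=
  Finset.prod_range_succ _ _

theorem bdPotential_pos (hl : ∀ n, 0 < lam n) (hm : ∀ n, 0 < mu (n + 1)) (n : ℕ) :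
    0 < bdPotential lam mu n :=
  Finset.prod_pos fun i _ => div_pos (hl i) (hm i)

theorem bdScale_pos (hl : ∀ n, 0 < lam n) (hm : ∀ n, 0 < mu (n + 1)) (n : ℕ) :
    0 < bdScale lam mu n := by
  have := bdPotential_pos hl hm n
  have := hl n
  unfold bdScale
  positivity

theorem bdOffDiag_pos (hl : ∀ n, 0 < lam n) (hm : ∀ n, 0 < mu (n + 1)) (n : ℕ) :
    0 < bdOffDiag lam mu n :=
  Real.sqrt_pos.2 (mul_pos (hl n) (hm n))

theorem bdSign_mul_self (hl : ∀ n, 0 < lam n) (hm : ∀ n, 0 < mu (n + 1)) (n : ℕ) :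
    bdSign lam mu n * bdSign lam mu n = bdPotential lam mu n := by
  have := Real.mul_self_sqrt (bdPotential_pos hl hm n).le
  unfold bdSign
  calc _ = ((-1) ^ n * (-1) ^ n) * (√(bdPotential lam mu n) * √(bdPotential lam mu n)) := by ring
    _ = _ := by rw [this, ← mul_pow]; simp

/-- Together with `bdOffDiag_mul_bdSign` this replaces the square roots b_n by the rates, once the
values P_n(0) are factored out. -/
theorem bdOffDiag_mul_bdSign_succ (hl : ∀ n, 0 < lam n) (hm : ∀ n, 0 < mu (n + 1)) (n : ℕ) :
    bdOffDiag lam mu n * bdSign lam mu (n + 1) = -(lam n * bdSign lam mu n) := by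
  have h1 := hl n
  have h2 := hm n
  have h3 := bdPotential_pos hl hm n
  unfold bdOffDiag bdSign
  rw [bdPotential_succ, Real.sqrt_mul h3.le, pow_succ]
  have e : √(lam n * mu (n + 1)) * √(lam n / mu (n + 1)) = lam n := by
    rw [← Real.sqrt_mul (by positivity)]
    have : lam n * mu (n + 1) * (lam n / mu (n + 1)) = lam n ^ 2 := by field_simp
    rw [this, Real.sqrt_sq h1.le]
  linear_combination (-(-1) ^ n * √(bdPotential lam mu n)) * e

theorem bdOffDiag_mul_bdSign (hl : ∀ n, 0 < lam n) (hm : ∀ n, 0 < mu (n + 1)) (n : ℕ) :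
    bdOffDiag lam mu n * bdSign lam mu n = -(mu (n + 1) * bdSign lam mu (n + 1)) := by
  have h1 := hl n
  have h2 := hm n
  have h3 := bdPotential_pos hl hm n
  unfold bdOffDiag bdSign
  rw [bdPotential_succ, Real.sqrt_mul h3.le, pow_succ]
  have e : √(lam n * mu (n + 1)) = mu (n + 1) * √(lam n / mu (n + 1)) := by
    have : lam n * mu (n + 1) = mu (n + 1) ^ 2 * (lam n / mu (n + 1)) := by field_simp
    rw [this, Real.sqrt_mul (by positivity), Real.sqrt_sq h2.le]
  rw [e]
  ring

/-- The solutions of the three term recurrence in terms of the first order system. -/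
theorem aeval_jacobiRec (hl : ∀ n, 0 < lam n) (hm : ∀ n, 0 < mu (n + 1)) (z c : ℂ) (s : ℂ × ℂ)
    (r₀ r₁ : Polynomial ℝ)
    (h0 : Polynomial.aeval z r₀ = c * s.1)
    (h1 : Polynomial.aeval z r₁ = c * bdSign lam mu 1
      * (bdState (fun k => (bdPotential lam mu k : ℂ)) (fun k => (bdScale lam mu k : ℂ))
        (-z) s 1).1) (n : ℕ) :
    Polynomial.aeval z (jacobiRec (bdDiag lam mu) (bdOffDiag lam mu) r₀ r₁ n)
      = c * bdSign lam mu n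
        * (bdState (fun k => (bdPotential lam mu k : ℂ)) (fun k => (bdScale lam mu k : ℂ))
          (-z) s n).1 := by
  induction n using Nat.strong_induction_on with
  | _ n ih =>
    match n with
    | 0 => rw [jacobiRec, h0]; simp [bdSign, bdPotential, bdState_zero]
    | 1 => rw [jacobiRec, h1]
    | n + 2 =>
      have i1 := ih (n + 1) (by omega)
      have i0 := ih n (by omega)
      rw [jacobiRec]
      simp only [map_mul, map_sub, Polynomial.aeval_C, Polynomial.aeval_X, i1, i0]
      have hb := bdOffDiag_pos hl hm (n + 1)
      have hbC : (bdOffDiag lam mu (n + 1) : ℂ) ≠ 0 := by exact_mod_cast hb.ne'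
      have hπ := bdPotential_pos hl hm (n + 1)
      have hπC : (bdPotential lam mu (n + 1) : ℂ) ≠ 0 := by exact_mod_cast hπ.ne'
      -- After removal of the sign factor the recurrence reads λ(X2 - X1) - μ(X1 - X0) = -z X1. By
      -- `e3` and `e4` the two differences on the left are 1/π times consecutive values of Y.
      have e1 := congrArg (fun x : ℝ => (x : ℂ)) (bdOffDiag_mul_bdSign_succ hl hm (n + 1))
      have e2 := congrArg (fun x : ℝ => (x : ℂ)) (bdOffDiag_mul_bdSign hl hm n)
      have e3 : (lam (n + 1) : ℂ) * bdScale lam mu (n + 1) = (bdPotential lam mu (n + 1) : ℂ)⁻¹ := by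
        have := (hl (n + 1)).ne'
        rw [bdScale]; push_cast
        have : (lam (n + 1) : ℂ) ≠ 0 := by exact_mod_cast this
        field_simp
      have e4 : (bdScale lam mu n : ℂ) * mu (n + 1) = (bdPotential lam mu (n + 1) : ℂ)⁻¹ := by
        rw [bdScale, bdPotential_succ]; push_cast
        have : (lam n : ℂ) ≠ 0 := by exact_mod_cast (hl n).ne'
        have : (mu (n + 1) : ℂ) ≠ 0 := by exact_mod_cast (hm n).ne'
        have : (bdPotential lam mu n : ℂ) ≠ 0 := by exact_mod_cast (bdPotential_pos hl hm n).ne'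
        field_simp
      have e5 := inv_mul_cancel₀ hπC
      push_cast at e1 e2
      have x2 := bdState_fst_succ (fun k => (bdPotential lam mu k : ℂ))
        (fun k => (bdScale lam mu k : ℂ)) (-z) s (n + 1)
      have y2 := bdState_snd_succ (fun k => (bdPotential lam mu k : ℂ))
        (fun k => (bdScale lam mu k : ℂ)) (-z) s (n + 1)
      have x1 := bdState_fst_succ (fun k => (bdPotential lam mu k : ℂ))
        (fun k => (bdScale lam mu k : ℂ)) (-z) s n
      rw [y2] at x2
      generalize (bdState (fun k => (bdPotential lam mu k : ℂ))
        (fun k => (bdScale lam mu k : ℂ)) (-z) s (n + 1 + 1)).1 = X2 at *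
      generalize (bdState (fun k => (bdPotential lam mu k : ℂ))
        (fun k => (bdScale lam mu k : ℂ)) (-z) s (n + 1)).1 = X1 at *
      generalize (bdState (fun k => (bdPotential lam mu k : ℂ))
        (fun k => (bdScale lam mu k : ℂ)) (-z) s n).1 = X0 at *
      generalize (bdState (fun k => (bdPotential lam mu k : ℂ))
        (fun k => (bdScale lam mu k : ℂ)) (-z) s (n + 1)).2 = Y1 at *
      simp only [Complex.coe_algebraMap, bdDiag]
      push_cast
      rw [inv_mul_eq_iff_eq_mul₀ hbC]
      generalize (bdSign lam mu (n + 1) : ℂ) = σ at *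
      linear_combination c * (-X0 * e2 - X2 * e1 + lam (n + 1) * σ * x2 - mu (n + 1) * σ * x1
        + σ * (Y1 - z * bdPotential lam mu (n + 1) * X1) * e3 - σ * Y1 * e4 - z * σ * X1 * e5)

/-- Because μ_0 = 0, a_0 = λ_0, and b_0 P_1 = z - λ_0 is what the state (1, 0) produces. -/
theorem aeval_orthPoly (hl : ∀ n, 0 < lam n) (hm : ∀ n, 0 < mu (n + 1)) (hm0 : mu 0 = 0)
    (z : ℂ) (n : ℕ) :
    Polynomial.aeval z (orthPoly (bdDiag lam mu) (bdOffDiag lam mu) n)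
      = bdSign lam mu n * (bdState (fun k => (bdPotential lam mu k : ℂ))
        (fun k => (bdScale lam mu k : ℂ)) (-z) (1, 0) n).1 := by
  rw [orthPoly, aeval_jacobiRec hl hm z 1 (1, 0), one_mul]
  · simp
  · have hbC : (bdOffDiag lam mu 0 : ℂ) ≠ 0 := by exact_mod_cast (bdOffDiag_pos hl hm 0).ne'
    have e1 := congrArg (fun x : ℝ => (x : ℂ)) (bdOffDiag_mul_bdSign_succ hl hm 0)
    have hl0 : (lam 0 : ℂ) ≠ 0 := by exact_mod_cast (hl 0).ne'
    have s0 : bdSign lam mu 0 = 1 := by simp [bdSign, bdPotential]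
    rw [s0] at e1
    push_cast at e1
    simp only [map_mul, map_sub, Polynomial.aeval_C, Polynomial.aeval_X, bdState, bdDiag, hm0,
      Complex.coe_algebraMap]
    push_cast
    rw [inv_mul_eq_iff_eq_mul₀ hbC]
    have e2 : (bdScale lam mu 0 : ℂ) = (lam 0 : ℂ)⁻¹ := by simp [bdScale, bdPotential]
    have e3 : (bdPotential lam mu 0 : ℂ) = 1 := by simp [bdPotential]
    rw [e2, e3]
    have e4 := inv_mul_cancel₀ hl0
    linear_combination (-(1 - (lam 0 : ℂ)⁻¹ * z)) * e1 - z * e4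

/-- From (0, 1) the first step gives X_1 = 1/λ_0, and -P_1(0)/λ_0 = 1/b_0 = Q_1. -/
theorem aeval_secondPoly (hl : ∀ n, 0 < lam n) (hm : ∀ n, 0 < mu (n + 1)) (z : ℂ) (n : ℕ) :
    Polynomial.aeval z (secondPoly (bdDiag lam mu) (bdOffDiag lam mu) n)
      = -(bdSign lam mu n * (bdState (fun k => (bdPotential lam mu k : ℂ))
        (fun k => (bdScale lam mu k : ℂ)) (-z) (0, 1) n).1) := by
  rw [secondPoly, aeval_jacobiRec hl hm z (-1) (0, 1)]
  · ring
  · simp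
  · have hbC : (bdOffDiag lam mu 0 : ℂ) ≠ 0 := by exact_mod_cast (bdOffDiag_pos hl hm 0).ne'
    have e1 := congrArg (fun x : ℝ => (x : ℂ)) (bdOffDiag_mul_bdSign_succ hl hm 0)
    have hl0 : (lam 0 : ℂ) ≠ 0 := by exact_mod_cast (hl 0).ne'
    have s0 : bdSign lam mu 0 = 1 := by simp [bdSign, bdPotential]
    rw [s0] at e1
    push_cast at e1
    have e2 : (bdScale lam mu 0 : ℂ) = (lam 0 : ℂ)⁻¹ := by simp [bdScale, bdPotential]
    simp only [Polynomial.aeval_C, bdState, Complex.coe_algebraMap, e2]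
    push_cast
    rw [inv_eq_iff_eq_inv, eq_comm, inv_eq_of_mul_eq_one_left]
    have e4 := inv_mul_cancel₀ hl0
    linear_combination (-(lam 0 : ℂ)⁻¹) * e1 + e4

end Rates

theorem bdState_zero_fst_one {u v : ℕ → ℂ} (n : ℕ) : (bdState u v 0 (1, 0) n).1 = 1 := by
  have h2 : ∀ k, (bdState u v 0 (1, 0) k).2 = 0 := fun k => by rw [bdState_snd_eq_sum]; simp
  rw [bdState_fst_eq_sum]
  simp [h2]

theorem bdState_zero_fst_zero {u v : ℕ → ℂ} (n : ℕ) :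
    (bdState u v 0 (0, 1) n).1 = ∑ k ∈ Finset.range n, v k := by
  have h2 : ∀ k, (bdState u v 0 (0, 1) k).2 = 1 := fun k => by rw [bdState_snd_eq_sum]; simp
  rw [bdState_fst_eq_sum]
  simp [h2]

theorem differentiable_bdState (u v : ℕ → ℂ) (s : ℂ × ℂ) (n : ℕ) :
    Differentiable ℂ (fun w => (bdState u v w s n).1) ∧
      Differentiable ℂ (fun w => (bdState u v w s n).2) := by
  induction n with
  | zero => exact ⟨differentiable_const s.1, differentiable_const s.2⟩
  | succ n ih =>
    obtain ⟨h1, h2⟩ := ih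
    constructor <;> simp only [bdState] <;> fun_prop

/-! ### Entire functions built from the system -/

section Entire

variable {u v c : ℕ → ℝ} {s : ℝ × ℝ}

/-- The partial sums `κ + ε z ∑_{k < n} c_k X_k(-z)`. -/
def bdPartial (u v c : ℕ → ℝ) (s : ℝ × ℝ) (κ ε : ℂ) (n : ℕ) (z : ℂ) : ℂ :=
  κ + ∑ k ∈ Finset.range n, ε * z * (c k * (bdState (fun k => (u k : ℂ)) (fun k => (v k : ℂ))
    (-z) ((s.1 : ℂ), (s.2 : ℂ)) k).1)

/-- The entire function `κ + ε z ∑_k c_k X_k(-z)`. -/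
def bdEntire (u v c : ℕ → ℝ) (s : ℝ × ℝ) (κ ε : ℂ) (z : ℂ) : ℂ :=
  κ + ∑' k, ε * z * (c k * (bdState (fun k => (u k : ℂ)) (fun k => (v k : ℂ))
    (-z) ((s.1 : ℂ), (s.2 : ℂ)) k).1)

theorem norm_bdTerm_le (h : IsGoodWeights u v) (hc : ∀ n, 0 ≤ c n) (h1 : 0 ≤ s.1) (h2 : 0 ≤ s.2)
    {ε : ℂ} (hε : ‖ε‖ = 1) {r : ℝ} {z : ℂ} (hz : ‖z‖ ≤ r) (k : ℕ) :
    ‖ε * z * (c k * (bdState (fun k => (u k : ℂ)) (fun k => (v k : ℂ))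
      (-z) ((s.1 : ℂ), (s.2 : ℂ)) k).1)‖ ≤ c k * (r * bdLimX u v s r) := by
  have hr : 0 ≤ r := (norm_nonneg z).trans hz
  have a := (norm_bdState_le (s := s) h.pos_u h.pos_v (-z) (by simpa using hz) (s.1 : ℂ) (s.2 : ℂ)
    (by simp [abs_of_nonneg h1]) (by simp [abs_of_nonneg h2]) k).1
  have b := h.fst_le_lim hr h1 h2 k
  rw [norm_mul, norm_mul, norm_mul, hε, one_mul, Complex.norm_real, Real.norm_of_nonneg (hc k)]
  have := hc k
  calc _ ≤ r * (c k * bdLimX u v s r) := by gcongr; exact a.trans b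
    _ = _ := by ring

theorem tendstoLocallyUniformly_bdPartial (h : IsGoodWeights u v) (hc : ∀ n, 0 ≤ c n)
    (hcs : Summable c) (h1 : 0 ≤ s.1) (h2 : 0 ≤ s.2) (κ : ℂ) {ε : ℂ} (hε : ‖ε‖ = 1) :
    TendstoLocallyUniformly (bdPartial u v c s κ ε) (bdEntire u v c s κ ε) atTop := by
  rw [Metric.tendstoLocallyUniformly_iff]
  intro δ hδ x
  refine ⟨Metric.ball 0 (‖x‖ + 1), Metric.isOpen_ball.mem_nhds (by simp), ?_⟩
  have hu := tendstoUniformlyOn_tsum_nat (f := fun k z => ε * z * (c k *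
      (bdState (fun k => (u k : ℂ)) (fun k => (v k : ℂ)) (-z) ((s.1 : ℂ), (s.2 : ℂ)) k).1))
    (s := Metric.ball 0 (‖x‖ + 1))
    (hcs.mul_right ((‖x‖ + 1) * bdLimX u v s (‖x‖ + 1)))
    fun k z hz => norm_bdTerm_le h hc h1 h2 hε (by simpa using (Metric.mem_ball.1 hz).le) k
  filter_upwards [Metric.tendstoUniformlyOn_iff.1 hu δ hδ] with n hn y hy
  simp only [bdPartial, bdEntire, dist_add_left]
  exact hn y hy

theorem differentiable_bdEntire (h : IsGoodWeights u v) (hc : ∀ n, 0 ≤ c n)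
    (hcs : Summable c) (h1 : 0 ≤ s.1) (h2 : 0 ≤ s.2) (κ : ℂ) {ε : ℂ} (hε : ‖ε‖ = 1) :
    Differentiable ℂ (bdEntire u v c s κ ε) := by
  intro x
  have hd : DifferentiableOn ℂ (bdEntire u v c s κ ε) (Metric.ball 0 (‖x‖ + 1)) := by
    refine (differentiableOn_const κ).add (Complex.differentiableOn_tsum_of_summable_norm
      (hcs.mul_right ((‖x‖ + 1) * bdLimX u v s (‖x‖ + 1))) (fun k => ?_) Metric.isOpen_ball
      fun k z hz => norm_bdTerm_le h hc h1 h2 hε (by simpa using (Metric.mem_ball.1 hz).le) k)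
    have := ((differentiable_bdState (fun k => (u k : ℂ)) (fun k => (v k : ℂ))
      ((s.1 : ℂ), (s.2 : ℂ)) k).1.comp differentiable_neg)
    exact ((differentiable_id.const_mul ε).mul (this.const_mul _)).differentiableOn
  exact hd.differentiableAt (Metric.isOpen_ball.mem_nhds (by simp))

theorem norm_bdEntire_le (h : IsGoodWeights u v) (hc : ∀ n, 0 ≤ c n)
    (hcs : Summable c) (h1 : 0 ≤ s.1) (h2 : 0 ≤ s.2) {κ ε : ℂ} (hκ : ‖κ‖ ≤ 1) (hε : ‖ε‖ = 1)
    (z : ℂ) :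
    ‖bdEntire u v c s κ ε z‖ ≤ 1 + ‖z‖ * (∑' k, c k) * bdLimX u v s ‖z‖ := by
  refine (norm_add_le _ _).trans (add_le_add hκ ?_)
  have := tsum_of_norm_bounded (hcs.hasSum.mul_right (‖z‖ * bdLimX u v s ‖z‖))
    fun k => norm_bdTerm_le h hc h1 h2 hε le_rfl k
  refine this.trans (le_of_eq ?_)
  ring

/-- At z = -r the terms of the series share one phase, so its modulus is r Σ c_k X_k(r), which
dominates m times r Σ u_k X_k = Y_∞ - s.2. The index 0 is left out because the weight
`bdSecondWeight` vanishes there. -/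
theorem sub_one_le_norm_bdEntire (h : IsGoodWeights u v) (hc : ∀ n, 0 ≤ c n)
    (hcs : Summable c) (h1 : 0 ≤ s.1) (h2 : 0 ≤ s.2) {κ ε : ℂ} (hκ : ‖κ‖ ≤ 1) (hε : ‖ε‖ = 1)
    {m : ℝ} (hmc : ∀ k, m * u (k + 1) ≤ c (k + 1)) {r : ℝ} (hr : 0 ≤ r) :
    m * (bdLimY u v s r - s.2 - r * u 0 * s.1) - 1
      ≤ ‖bdEntire u v c s κ ε ((-r : ℝ) : ℂ)‖ := by
  have hX : ∀ k, 0 ≤ (bdState u v r s k).1 := fun k =>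
    (bdState_nonneg h.pos_u h.pos_v hr h1 h2 k).1
  have hsum : Summable fun k => c k * (bdState u v r s k).1 :=
    Summable.of_nonneg_of_le (fun k => mul_nonneg (hc k) (hX k))
      (fun k => mul_le_mul_of_nonneg_left (h.fst_le_lim hr h1 h2 k) (hc k))
      (hcs.mul_right (bdLimX u v s r))
  have e : bdEntire u v c s κ ε ((-r : ℝ) : ℂ)
      = κ - ε * ((r * ∑' k, c k * (bdState u v r s k).1 : ℝ) : ℂ) := by
    unfold bdEntire
    rw [sub_eq_add_neg]
    congr 1
    rw [Complex.ofReal_mul, Complex.ofReal_tsum, ← mul_assoc, ← neg_mul, ← tsum_mul_left]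
    congr 1
    funext k
    have := bdState_ofReal u v r s k
    push_cast
    rw [neg_neg, this]
    ring
  have hlow : m * (bdLimY u v s r - s.2 - r * u 0 * s.1)
      ≤ r * ∑' k, c k * (bdState u v r s k).1 := by
    have hlim : Tendsto (fun n => m * ((bdState u v r s (n + 1)).2 - s.2 - r * u 0 * s.1)) atTop
        (𝓝 (m * (bdLimY u v s r - s.2 - r * u 0 * s.1))) :=
      ((((h.tendsto_snd hr h1 h2).comp (tendsto_add_atTop_nat 1)).sub_const _).sub_const _).const_mul
        m
    refine le_of_tendsto' hlim fun n => ?_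
    rw [bdState_snd_eq_sum, Finset.sum_range_succ', bdState_zero]
    have e2 : m * (s.2 + r * (∑ k ∈ Finset.range n, u (k + 1) * (bdState u v r s (k + 1)).1
        + u 0 * s.1) - s.2 - r * u 0 * s.1)
        = r * ∑ k ∈ Finset.range n, m * u (k + 1) * (bdState u v r s (k + 1)).1 := by
      simp only [mul_assoc, ← Finset.mul_sum]; ring
    rw [e2]
    refine mul_le_mul_of_nonneg_left ?_ hr
    have a := hsum.sum_le_tsum (Finset.range (n + 1)) fun k _ => mul_nonneg (hc k) (hX k)
    rw [Finset.sum_range_succ'] at a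
    have b : ∑ k ∈ Finset.range n, m * u (k + 1) * (bdState u v r s (k + 1)).1
        ≤ ∑ k ∈ Finset.range n, c (k + 1) * (bdState u v r s (k + 1)).1 :=
      Finset.sum_le_sum fun k _ => mul_le_mul_of_nonneg_right (hmc k) (hX _)
    have := mul_nonneg (hc 0) (hX 0)
    linarith
  rw [e]
  have a := norm_sub_norm_le (ε * ((r * ∑' k, c k * (bdState u v r s k).1 : ℝ) : ℂ)) κ
  rw [norm_sub_rev, norm_mul, hε, one_mul, Complex.norm_real] at a
  have := Real.le_norm_self (r * ∑' k, c k * (bdState u v r s k).1)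
  linarith

/-- The two standard initial states are comparable. -/
theorem bdState_second_le (h : IsGoodWeights u v) {r : ℝ} (hr : 1 ≤ r) (k : ℕ) :
    (bdState u v r (0, 1) (1 + k)).1 ≤ 1 / u 0 * (bdState u v r (1, 0) (1 + k)).1 := by
  have hr0 : 0 ≤ r := by linarith
  have hu := h.pos_u 0
  have hv := h.pos_v 0
  -- The system is compared with itself, g = ρ = 1, from index 1 on: at index 0 the state (1, 0) has
  -- second component 0 and dominates nothing.
  have := (bdState_le_mul (g := fun _ => 1) (ρ := fun _ => 1) (s := (0, 1)) (s' := (1, 0))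
    h.pos_u h.pos_v h.pos_u h.pos_v hr0 zero_le_one le_rfl (fun _ => le_rfl)
    (fun n => by simp) (fun n => by simp) (fun n => by simp) (K := 1 / u 0) (by positivity) 1
    (by
      simp only [bdState]
      have : 0 < r * u 0 := by positivity
      rw [one_div, ← div_eq_inv_mul, le_div_iff₀ hu]
      nlinarith [mul_nonneg hv.le (mul_nonneg (sub_nonneg.2 hr) hu.le)])
    (by
      simp only [bdState]
      rw [mul_one, one_div, ← div_eq_inv_mul, le_div_iff₀ hu]
      nlinarith) k).1
  simpa using this

theorem bdState_first_le (h : IsGoodWeights u v) {r : ℝ} (hr : 0 ≤ r) (k : ℕ) :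
    (bdState u v r (1, 0) (1 + k)).2
      ≤ (r * u 0 + 1 / v 0) * (bdState u v r (0, 1) (1 + k)).2 := by
  have hu := h.pos_u 0
  have hv := h.pos_v 0
  have := (bdState_le_mul (g := fun _ => 1) (ρ := fun _ => 1) (s := (1, 0)) (s' := (0, 1))
    h.pos_u h.pos_v h.pos_u h.pos_v hr le_rfl zero_le_one (fun _ => le_rfl)
    (fun n => by simp) (fun n => by simp) (fun n => by simp) (K := r * u 0 + 1 / v 0)
    (by positivity) 1
    (by
      simp only [bdState]
      have : 1 / v 0 * v 0 = 1 := by field_simp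
      nlinarith)
    (by
      simp only [bdState]
      have : 0 < 1 / v 0 := by positivity
      nlinarith) k).2
  simpa using this

theorem polyLE_maxModulus_bdEntire (h : IsGoodWeights u v) (hc : ∀ n, 0 ≤ c n)
    (hcs : Summable c) (hs : s = (1, 0) ∨ s = (0, 1)) {κ ε : ℂ} (hκ : ‖κ‖ ≤ 1) (hε : ‖ε‖ = 1) :
    PolyLE (maxModulus (bdEntire u v c s κ ε)) (bdLimX u v (1, 0)) := by
  have hu := h.pos_u 0
  have h1 : 0 ≤ s.1 := by rcases hs with rfl | rfl <;> simp
  have h2 : 0 ≤ s.2 := by rcases hs with rfl | rfl <;> simp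
  have hS : 0 ≤ ∑' k, c k := tsum_nonneg hc
  refine ⟨1 + (∑' k, c k) * (1 + 1 / u 0), by positivity, 1, ?_⟩
  filter_upwards [eventually_ge_atTop 1] with r hr
  have hr0 : 0 ≤ r := by linarith
  have hΦ : 1 ≤ bdLimX u v (1, 0) r := h.fst_le_lim (s := (1, 0)) hr0 zero_le_one le_rfl 0
  have hXs : bdLimX u v s r ≤ (1 + 1 / u 0) * bdLimX u v (1, 0) r := by
    have hp : 0 < 1 / u 0 := by positivity
    rcases hs with rfl | rfl
    · nlinarith
    · refine ciSup_le fun n => ?_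
      have a := bdState_fst_mono (s := (0, 1)) h.pos_u h.pos_v hr0 le_rfl zero_le_one
        (Nat.le_add_left n 1)
      have b := h.fst_le_lim (s := (1, 0)) hr0 zero_le_one le_rfl (1 + n)
      have d := bdState_second_le h hr n
      dsimp only at a
      nlinarith
  refine maxModulus_le (by positivity) fun z hz => ?_
  refine (norm_bdEntire_le h hc hcs h1 h2 hκ hε z).trans ?_
  rw [hz, pow_one]
  calc 1 + r * (∑' k, c k) * bdLimX u v s r
      ≤ r * bdLimX u v (1, 0) r
        + r * (∑' k, c k) * ((1 + 1 / u 0) * bdLimX u v (1, 0) r) := by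
        gcongr
        nlinarith
    _ = (1 + (∑' k, c k) * (1 + 1 / u 0)) * r * bdLimX u v (1, 0) r := by ring
    _ ≤ _ := by gcongr; linarith

/-- Chain of bounds: the limit of X is controlled by that of Y, the limit of Y from (1, 0) by the
one from `s`, and the latter by the modulus at -r. -/
theorem bdLimX_polyLE_maxModulus_bdEntire (h : IsGoodWeights u v) (hc : ∀ n, 0 ≤ c n)
    (hcs : Summable c) (hs : s = (1, 0) ∨ s = (0, 1)) {κ ε : ℂ} (hκ : ‖κ‖ ≤ 1) (hε : ‖ε‖ = 1)
    {m : ℝ} (hm : 0 < m) (hmc : ∀ k, m * u (k + 1) ≤ c (k + 1)) :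
    PolyLE (bdLimX u v (1, 0)) (maxModulus (bdEntire u v c s κ ε)) := by
  have hu := h.pos_u 0
  have hv := h.pos_v 0
  have h1 : 0 ≤ s.1 := by rcases hs with rfl | rfl <;> simp
  have h2 : 0 ≤ s.2 := by rcases hs with rfl | rfl <;> simp
  have h1' : s.1 ≤ 1 := by rcases hs with rfl | rfl <;> simp
  have h2' : s.2 ≤ 1 := by rcases hs with rfl | rfl <;> simp
  set V := ∑' k, v k
  have hV : 0 ≤ V := tsum_nonneg fun k => (h.pos_v k).le
  refine ⟨1 + V * ((1 + u 0 + 1 / v 0) * (1 / m + 1 + u 0)), by positivity, 2, ?_⟩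
  filter_upwards [eventually_ge_atTop 1] with r hr
  have hr0 : 0 ≤ r := by linarith
  set M := maxModulus (bdEntire u v c s κ ε) r
  have hM : m * (bdLimY u v s r - s.2 - r * u 0 * s.1) - 1 ≤ M :=
    (sub_one_le_norm_bdEntire h hc hcs h1 h2 hκ hε hmc hr0).trans
      (norm_le_maxModulus (differentiable_bdEntire h hc hcs h1 h2 κ hε).continuous
        (by simpa using hr0))
  have hM0 : 0 ≤ M := (norm_nonneg _).trans
      (norm_le_maxModulus (differentiable_bdEntire h hc hcs h1 h2 κ hε).continuous
        (z := (r : ℂ)) (by simpa using hr0))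
  have hY : bdLimY u v s r ≤ (1 / m + 1 + u 0) * r * (M + 1) := by
    have a : m * (bdLimY u v s r - s.2 - r * u 0 * s.1) ≤ M + 1 := by linarith
    rw [← le_div_iff₀' hm] at a
    have b : r * u 0 * s.1 ≤ r * u 0 * 1 := by gcongr
    have d : (M + 1) / m = 1 / m * 1 * (M + 1) := by ring
    calc bdLimY u v s r ≤ 1 / m * 1 * (M + 1) + 1 * 1 * 1 + u 0 * r * 1 := by linarith
      _ ≤ 1 / m * r * (M + 1) + 1 * r * (M + 1) + u 0 * r * (M + 1) := by
        gcongr <;> linarith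
      _ = _ := by ring
  have hYF : bdLimY u v (1, 0) r ≤ (1 + u 0 + 1 / v 0) * r * bdLimY u v s r := by
    have hp : 0 < 1 / v 0 := by positivity
    have hYs : 0 ≤ bdLimY u v s r := h2.trans (h.snd_le_lim hr0 h1 h2 0)
    rcases hs with rfl | rfl
    · have : 1 ≤ (1 + u 0 + 1 / v 0) * r := by nlinarith
      nlinarith
    · refine ciSup_le fun n => ?_
      have a := bdState_snd_mono (s := (1, 0)) h.pos_u h.pos_v hr0 zero_le_one le_rfl
        (Nat.le_add_left n 1)
      have b := h.snd_le_lim (s := (0, 1)) hr0 le_rfl zero_le_one (1 + n)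
      have d := bdState_first_le h hr0 n
      have e : r * u 0 + 1 / v 0 ≤ (1 + u 0 + 1 / v 0) * r := by nlinarith
      calc _ ≤ _ := a
        _ ≤ _ := d
        _ ≤ (r * u 0 + 1 / v 0) * bdLimY u v (0, 1) r := by gcongr
        _ ≤ _ := by gcongr
  calc bdLimX u v (1, 0) r ≤ 1 + V * bdLimY u v (1, 0) r :=
        h.limX_le (s := (1, 0)) hr0 zero_le_one le_rfl
    _ ≤ 1 + V * ((1 + u 0 + 1 / v 0) * r * ((1 / m + 1 + u 0) * r * (M + 1))) := by
        gcongr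
        exact hYF.trans (by gcongr)
    _ ≤ 1 * r ^ 2 * (M + 1)
        + V * ((1 + u 0 + 1 / v 0) * r * ((1 / m + 1 + u 0) * r * (M + 1))) := by
        gcongr
        have := one_le_pow₀ (n := 2) hr
        nlinarith
    _ = _ := by ring

end Entire

/-! ### Order and type of functions comparable to the scaled reference growth -/

theorem PolyLE.trans {f g h : ℝ → ℝ} (hfg : PolyLE f g) (hgh : PolyLE g h)
    (hh : ∀ᶠ r in atTop, 0 ≤ h r) : PolyLE f h := by
  obtain ⟨C1, hC1, m1, h1⟩ := hfg
  obtain ⟨C2, hC2, m2, h2⟩ := hgh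
  refine ⟨C1 * (C2 + 1), by positivity, m1 + m2, ?_⟩
  filter_upwards [h1, h2, hh, eventually_ge_atTop 1] with r a1 a2 a3 hr
  have hr0 : 0 ≤ r := by linarith
  have hp : 1 ≤ r ^ m2 := one_le_pow₀ hr
  calc f r ≤ C1 * r ^ m1 * (g r + 1) := a1
    _ ≤ C1 * r ^ m1 * (C2 * r ^ m2 * (h r + 1) + r ^ m2 * (h r + 1)) := by
        gcongr
        nlinarith
    _ = _ := by rw [pow_add]; ring

theorem entireOrder_eq_of_polyLE {f : ℂ → ℂ} {Φ : ℝ → ℝ} {q c C : ℝ} (hq : 0 < q) (hc : 0 < c)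
    (hlow : ∀ᶠ r in atTop, Real.exp (c * r ^ q) ≤ Φ r)
    (hupp : ∀ᶠ r in atTop, Φ r ≤ Real.exp (C * r ^ q))
    (h1 : PolyLE (maxModulus f) Φ) (h2 : PolyLE Φ (maxModulus f)) :
    entireOrder f = (q : EReal) := by
  have ho := (isLittleO_log_sub_log hq hc hlow h1 h2).bound (half_pos hc)
  refine entireOrder_eq (c := c / 2) (C := C + c / 2) (q := q) (by positivity) ?_ ?_
  · filter_upwards [ho, hlow, eventually_ge_atTop 0] with r a1 a2 hr
    rw [Real.norm_eq_abs, abs_le, Real.norm_of_nonneg (by positivity : (0 : ℝ) ≤ r ^ q)] at a1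
    have := (Real.le_log_iff_exp_le ((Real.exp_pos _).trans_le a2)).2 a2
    linarith [a1.1]
  · filter_upwards [ho, hlow, hupp, eventually_ge_atTop 0] with r a1 a2 a3 hr
    rw [Real.norm_eq_abs, abs_le, Real.norm_of_nonneg (by positivity : (0 : ℝ) ≤ r ^ q)] at a1
    have := (Real.log_le_iff_le_exp ((Real.exp_pos _).trans_le a2)).2 a3
    linarith [a1.2]

theorem entireOrder_multiZetaFun {p : ℝ} (hp : 3 ≤ p) :
    entireOrder (multiZetaFun p) = ((1 / p : ℝ) : EReal) :=
  entireOrder_eq_of_polyLE (by positivity)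
    (div_pos (Real.log_pos (by norm_num : (1 : ℝ) < 2)) two_pos)
    (exp_le_refGrowth hp) (refGrowth_le_exp hp) (polyLE_maxModulus_multiZetaFun hp)
    (refGrowth_polyLE hp)

/-- An entire function that is polynomially comparable to the scaled reference growth has order
`1 / p`, and its type is the scaled type of `G_p`. -/
theorem entireOrder_entireType_of_polyLE {p κ : ℝ} (hp : 3 ≤ p) (hκ : 0 < κ) {f : ℂ → ℂ}
    (h1 : PolyLE (maxModulus f) fun r => refGrowth p (κ * r))
    (h2 : PolyLE (fun r => refGrowth p (κ * r)) (maxModulus f)) :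
    entireOrder f = ((1 / p : ℝ) : EReal) ∧
      entireType f = ((κ ^ (1 / p) : ℝ) : EReal) * entireType (multiZetaFun p) := by
  have hq : 0 < 1 / p := by positivity
  have hκq : 0 < κ ^ (1 / p) := by positivity
  have hl2 := Real.log_pos (by norm_num : (1 : ℝ) < 2)
  have htop : Tendsto (fun r : ℝ => κ * r) atTop atTop := tendsto_id.const_mul_atTop hκ
  have hlow : ∀ᶠ r in atTop, Real.exp (Real.log 2 / 2 * κ ^ (1 / p) * r ^ (1 / p))
      ≤ refGrowth p (κ * r) := by
    filter_upwards [htop.eventually (exp_le_refGrowth hp), eventually_ge_atTop 0] with r hr h0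
    rwa [Real.mul_rpow hκ.le h0, ← mul_assoc] at hr
  have hupp : ∀ᶠ r in atTop, refGrowth p (κ * r)
      ≤ Real.exp (12 * p * κ ^ (1 / p) * r ^ (1 / p)) := by
    filter_upwards [htop.eventually (refGrowth_le_exp hp), eventually_ge_atTop 0] with r hr h0
    rwa [Real.mul_rpow hκ.le h0, ← mul_assoc] at hr
  have hof := entireOrder_eq_of_polyLE hq (by positivity) hlow hupp h1 h2
  refine ⟨hof, entireType_eq hκ hof (entireOrder_multiZetaFun hp) ?_⟩
  -- Both log M_f(r) and log M_{G_p}(κ r) differ from log `refGrowth` at κ r by o(r^{1/p}).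
  have o1 := isLittleO_log_sub_log hq (by positivity) hlow h1 h2
  have o2 := (isLittleO_log_sub_log hq (div_pos hl2 two_pos) (exp_le_refGrowth hp)
    (polyLE_maxModulus_multiZetaFun hp) (refGrowth_polyLE hp)).comp_tendsto htop
  have o3 : ((fun r : ℝ => r ^ (1 / p)) ∘ fun r => κ * r) =O[atTop] fun r : ℝ => r ^ (1 / p) := by
    refine Asymptotics.IsBigO.of_bound (κ ^ (1 / p)) ?_
    filter_upwards [eventually_ge_atTop 0] with r h0
    simp only [Function.comp]
    rw [Real.mul_rpow hκ.le h0, norm_mul, Real.norm_of_nonneg hκq.le]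
  refine (o1.sub (o2.trans_isBigO o3)).congr_left fun r => ?_
  simp only [Function.comp]
  ring

/-- Rescaling Y to κ Y moves a constant factor of v into the parameter; the initial Y must be 0 for
the rescaled system to have the same start. -/
theorem bdState_const_mul (u v : ℕ → ℝ) (κ r x : ℝ) (n : ℕ) :
    (bdState u (fun n => κ * v n) r (x, 0) n).1 = (bdState u v (κ * r) (x, 0) n).1 ∧
      κ * (bdState u (fun n => κ * v n) r (x, 0) n).2 = (bdState u v (κ * r) (x, 0) n).2 := by
  induction n with
  | zero => simp [bdState_zero]
  | succ n ih =>
    obtain ⟨h1, h2⟩ := ih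
    have h3 : κ * (bdState u (fun n => κ * v n) r (x, 0) (n + 1)).2
        = (bdState u v (κ * r) (x, 0) (n + 1)).2 := by
      rw [bdState_snd_succ, bdState_snd_succ, ← h1, ← h2]; ring
    refine ⟨?_, h3⟩
    rw [bdState_fst_succ, bdState_fst_succ, ← h1, ← h3]; ring

theorem bdLimX_const_mul_refWeight (p κ r : ℝ) :
    bdLimX (refWeight p) (fun n => κ * refWeight p n) (1, 0) r = refGrowth p (κ * r) := by
  unfold refGrowth bdLimX
  simp only [(bdState_const_mul _ _ _ _ _ _).1]

theorem IsGoodWeights.const_mul {u v : ℕ → ℝ} (h : IsGoodWeights u v) {κ : ℝ} (hκ : 0 < κ) :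
    IsGoodWeights u fun n => κ * v n where
  pos_u := h.pos_u
  pos_v n := mul_pos hκ (h.pos_v n)
  summable_v := h.summable_v.mul_left κ
  summable_u := h.summable_u

/-! ### The Nevanlinna matrix of a birth and death process -/

section Nevanlinna

variable {lam mu : ℕ → ℝ}

/-- The weights `π_n θ_n` with `θ_n = ∑_{m < n} 1 / (λ_m π_m)`. -/
def bdSecondWeight (lam mu : ℕ → ℝ) (n : ℕ) : ℝ :=
  bdPotential lam mu n * ∑ m ∈ Finset.range n, bdScale lam mu m

/-- The Nevanlinna matrix of a birth and death process. -/
def bdNevanlinna (lam mu : ℕ → ℝ) (z : ℂ) : Matrix (Fin 2) (Fin 2) ℂ :=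
  !![bdEntire (bdPotential lam mu) (bdScale lam mu) (bdSecondWeight lam mu) (0, 1) 0 1 z,
    bdEntire (bdPotential lam mu) (bdScale lam mu) (bdSecondWeight lam mu) (1, 0) (-1) (-1) z;
    bdEntire (bdPotential lam mu) (bdScale lam mu) (bdPotential lam mu) (0, 1) 1 (-1) z,
    bdEntire (bdPotential lam mu) (bdScale lam mu) (bdPotential lam mu) (1, 0) 0 1 z]

/-- With σ_k = P_k(0) and Q_k(0) = -σ_k θ_k, each summand contains σ_k² = π_k, so signs and square
roots disappear. -/
theorem nevanlinnaApprox_eq (hl : ∀ n, 0 < lam n) (hm : ∀ n, 0 < mu (n + 1)) (hm0 : mu 0 = 0)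
    (n : ℕ) (z : ℂ) :
    nevanlinnaApprox (bdDiag lam mu) (bdOffDiag lam mu) n z =
      !![bdPartial (bdPotential lam mu) (bdScale lam mu) (bdSecondWeight lam mu) (0, 1) 0 1 n z,
        bdPartial (bdPotential lam mu) (bdScale lam mu) (bdSecondWeight lam mu) (1, 0)
          (-1) (-1) n z;
        bdPartial (bdPotential lam mu) (bdScale lam mu) (bdPotential lam mu) (0, 1) 1 (-1) n z,
        bdPartial (bdPotential lam mu) (bdScale lam mu) (bdPotential lam mu) (1, 0) 0 1 n z] := by
  have hσ : ∀ k, (bdSign lam mu k : ℂ) * bdSign lam mu k = bdPotential lam mu k := fun k => by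
    exact_mod_cast bdSign_mul_self hl hm k
  have hP := aeval_orthPoly hl hm hm0
  have hQ := aeval_secondPoly hl hm
  have hP0 : ∀ k, Polynomial.aeval (0 : ℂ) (orthPoly (bdDiag lam mu) (bdOffDiag lam mu) k)
      = bdSign lam mu k := fun k => by
    rw [hP, neg_zero, bdState_zero_fst_one, mul_one]
  have hQ0 : ∀ k, Polynomial.aeval (0 : ℂ) (secondPoly (bdDiag lam mu) (bdOffDiag lam mu) k)
      = -(bdSign lam mu k * ∑ m ∈ Finset.range k, (bdScale lam mu m : ℂ)) := fun k => by
    rw [hQ, neg_zero, bdState_zero_fst_zero]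
  simp only [nevanlinnaApprox, hP0, hQ0, hP, hQ, bdPartial, bdSecondWeight, Finset.mul_sum,
    Complex.ofReal_one, Complex.ofReal_zero]
  ext i j
  fin_cases i <;> fin_cases j
  · simp only [Fin.zero_eta, Matrix.of_apply, Matrix.cons_val_zero, Matrix.cons_val', zero_add]
    refine Finset.sum_congr rfl fun k _ => ?_
    push_cast
    rw [← hσ]
    simp only [← Finset.mul_sum]
    ring
  · simp only [Fin.zero_eta, Fin.mk_one, Matrix.of_apply, Matrix.cons_val_zero,
      Matrix.cons_val_one, Matrix.cons_val']
    congr 1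
    refine Finset.sum_congr rfl fun k _ => ?_
    push_cast
    rw [← hσ]
    simp only [← Finset.mul_sum]
    ring
  · simp only [Fin.zero_eta, Fin.mk_one, Matrix.of_apply, Matrix.cons_val_zero,
      Matrix.cons_val_one, Matrix.cons_val']
    congr 1
    refine Finset.sum_congr rfl fun k _ => ?_
    rw [← hσ]
    ring
  · simp only [Fin.mk_one, Matrix.of_apply, Matrix.cons_val_one, Matrix.cons_val',
      Matrix.cons_val_fin_one, zero_add]
    refine Finset.sum_congr rfl fun k _ => ?_
    rw [← hσ]
    ring

theorem bdSecondWeight_nonneg (h : IsGoodWeights (bdPotential lam mu) (bdScale lam mu)) (n : ℕ) :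
    0 ≤ bdSecondWeight lam mu n :=
  mul_nonneg (h.pos_u n).le (Finset.sum_nonneg fun m _ => (h.pos_v m).le)

theorem summable_bdSecondWeight (h : IsGoodWeights (bdPotential lam mu) (bdScale lam mu)) :
    Summable (bdSecondWeight lam mu) :=
  Summable.of_nonneg_of_le (bdSecondWeight_nonneg h)
    (fun n => mul_le_mul_of_nonneg_left
      (h.summable_v.sum_le_tsum (Finset.range n) fun i _ => (h.pos_v i).le) (h.pos_u n).le)
    (h.summable.mul_right _)

/-- θ_{n+1} is at least its first term; this is the constant m for the lower growth bound of A and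
B. -/
theorem le_bdSecondWeight (h : IsGoodWeights (bdPotential lam mu) (bdScale lam mu)) (n : ℕ) :
    bdScale lam mu 0 * bdPotential lam mu (n + 1) ≤ bdSecondWeight lam mu (n + 1) := by
  rw [bdSecondWeight, mul_comm]
  refine mul_le_mul_of_nonneg_left ?_ (h.pos_u _).le
  exact Finset.single_le_sum (f := bdScale lam mu) (fun i _ => (h.pos_v i).le)
    (Finset.mem_range.2 n.succ_pos)

theorem isNevanlinnaMatrix_bdNevanlinna (hl : ∀ n, 0 < lam n) (hm : ∀ n, 0 < mu (n + 1))
    (hm0 : mu 0 = 0) (h : IsGoodWeights (bdPotential lam mu) (bdScale lam mu)) :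
    IsNevanlinnaMatrix (bdDiag lam mu) (bdOffDiag lam mu) (bdNevanlinna lam mu) := by
  have h1 := bdSecondWeight_nonneg h
  have h2 := summable_bdSecondWeight h
  have h3 := fun n => (h.pos_u n).le
  have h4 := h.summable
  intro i j
  simp only [nevanlinnaApprox_eq hl hm hm0]
  fin_cases i <;> fin_cases j
  · exact tendstoLocallyUniformly_bdPartial h h1 h2 le_rfl zero_le_one 0 (by simp)
  · exact tendstoLocallyUniformly_bdPartial h h1 h2 zero_le_one le_rfl (-1) (by simp)
  · exact tendstoLocallyUniformly_bdPartial h h3 h4 le_rfl zero_le_one 1 (by simp)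
  · exact tendstoLocallyUniformly_bdPartial h h3 h4 zero_le_one le_rfl 0 (by simp)

theorem bdNevanlinna_entry (h : IsGoodWeights (bdPotential lam mu) (bdScale lam mu))
    (i j : Fin 2) :
    Differentiable ℂ (fun z => bdNevanlinna lam mu z i j) ∧
      PolyLE (maxModulus fun z => bdNevanlinna lam mu z i j)
        (bdLimX (bdPotential lam mu) (bdScale lam mu) (1, 0)) ∧
      PolyLE (bdLimX (bdPotential lam mu) (bdScale lam mu) (1, 0))
        (maxModulus fun z => bdNevanlinna lam mu z i j) := by
  have h1 := bdSecondWeight_nonneg h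
  have h2 := summable_bdSecondWeight h
  have h3 := fun n => (h.pos_u n).le
  have h4 := h.summable
  have h5 := le_bdSecondWeight h
  have h6 : ∀ n, 1 * bdPotential lam mu (n + 1) ≤ bdPotential lam mu (n + 1) := by simp
  fin_cases i <;> fin_cases j
  · exact ⟨differentiable_bdEntire h h1 h2 le_rfl zero_le_one 0 (by simp),
      polyLE_maxModulus_bdEntire h h1 h2 (Or.inr rfl) (by simp) (by simp),
      bdLimX_polyLE_maxModulus_bdEntire h h1 h2 (Or.inr rfl) (by simp) (by simp) (h.pos_v 0) h5⟩
  · exact ⟨differentiable_bdEntire h h1 h2 zero_le_one le_rfl (-1) (by simp),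
      polyLE_maxModulus_bdEntire h h1 h2 (Or.inl rfl) (by simp) (by simp),
      bdLimX_polyLE_maxModulus_bdEntire h h1 h2 (Or.inl rfl) (by simp) (by simp) (h.pos_v 0) h5⟩
  · exact ⟨differentiable_bdEntire h h3 h4 le_rfl zero_le_one 1 (by simp),
      polyLE_maxModulus_bdEntire h h3 h4 (Or.inr rfl) (by simp) (by simp),
      bdLimX_polyLE_maxModulus_bdEntire h h3 h4 (Or.inr rfl) (by simp) (by simp) one_pos h6⟩
  · exact ⟨differentiable_bdEntire h h3 h4 zero_le_one le_rfl 0 (by simp),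
      polyLE_maxModulus_bdEntire h h3 h4 (Or.inl rfl) (by simp) (by simp),
      bdLimX_polyLE_maxModulus_bdEntire h h3 h4 (Or.inl rfl) (by simp) (by simp) one_pos h6⟩

end Nevanlinna

/-! ### Asymptotics of polynomial rates -/

theorem NearOne.mul {ρ σ : ℕ → ℝ} (hρ : NearOne ρ) (hσ : NearOne σ) (h : ∀ n, 0 ≤ σ n) :
    NearOne fun n => ρ n * σ n := by
  obtain ⟨C, hC⟩ := hρ
  obtain ⟨D, hD⟩ := hσ
  refine ⟨C + D + C * D, fun n => ?_⟩
  have hn : (0 : ℝ) < (n : ℝ) + 1 := by positivity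
  calc ρ n * σ n ≤ (1 + C / ((n : ℝ) + 1)) * (1 + D / ((n : ℝ) + 1)) :=
        mul_le_mul (hC n) (hD n) (h n) (by positivity)
    _ = 1 + C / ((n : ℝ) + 1) + D / ((n : ℝ) + 1)
        + C * D / ((n : ℝ) + 1) * (1 / ((n : ℝ) + 1)) := by ring
    _ ≤ 1 + C / ((n : ℝ) + 1) + D / ((n : ℝ) + 1) + C * D / ((n : ℝ) + 1) * 1 := by
        gcongr
        rw [div_le_one hn]
        linarith [Nat.cast_nonneg (α := ℝ) n]
    _ = _ := by push_cast; ring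

theorem nearOne_of_le_one {ρ : ℕ → ℝ} (h : ∀ n, ρ n ≤ 1) : NearOne ρ :=
  ⟨0, fun n => by simpa using h n⟩

theorem NearOne.prod {ι : Type*} (s : Finset ι) {ρ : ι → ℕ → ℝ} (hρ : ∀ i, NearOne (ρ i))
    (h : ∀ i n, 0 ≤ ρ i n) : NearOne fun n => ∏ i ∈ s, ρ i n := by
  classical
  induction s using Finset.induction_on with
  | empty => exact nearOne_of_le_one fun n => by simp
  | insert i s hi ih =>
    simp only [Finset.prod_insert hi]
    exact (hρ i).mul ih fun n => Finset.prod_nonneg fun j _ => h j n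

theorem nearOne_div {a b : ℝ} (hb : 0 < b) : NearOne fun n => ((n : ℝ) + a) / ((n : ℝ) + b) := by
  obtain ⟨C, hC⟩ := exists_nat_ge (|a - b| * (1 + 1 / b))
  refine ⟨C, fun n => ?_⟩
  have hn : (0 : ℝ) ≤ (n : ℝ) := Nat.cast_nonneg n
  have hnb : 0 < (n : ℝ) + b := by positivity
  have e : ((n : ℝ) + a) / ((n : ℝ) + b) = 1 + (a - b) / ((n : ℝ) + b) := by field_simp; ring
  change ((n : ℝ) + a) / ((n : ℝ) + b) ≤ _
  rw [e]
  gcongr 1 + ?_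
  have h1 : ((n : ℝ) + 1) ≤ (1 + 1 / b) * ((n : ℝ) + b) := by
    have : 1 / b * b = 1 := by field_simp
    have : 0 ≤ 1 / b * n := by positivity
    nlinarith
  rw [div_le_div_iff₀ hnb (by positivity)]
  calc (a - b) * ((n : ℝ) + 1) ≤ |a - b| * ((n : ℝ) + 1) := by
        gcongr; exact le_abs_self _
    _ ≤ |a - b| * ((1 + 1 / b) * ((n : ℝ) + b)) := by gcongr
    _ = |a - b| * (1 + 1 / b) * ((n : ℝ) + b) := by ring
    _ ≤ _ := by gcongr

/-- Quotient of Euler's limits for Γ(t) and Γ(s); the factorials cancel. -/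
theorem tendsto_prod_ratio {s t : ℝ} (hs : 0 < s) (ht : 0 < t) :
    Tendsto (fun n : ℕ => (∏ i ∈ Finset.range (n + 1), (s + i) / (t + i)) / (n : ℝ) ^ (s - t))
      atTop (𝓝 (Real.Gamma t / Real.Gamma s)) := by
  have h := (Real.GammaSeq_tendsto_Gamma t).div (Real.GammaSeq_tendsto_Gamma s)
    (Real.Gamma_pos_of_pos hs).ne'
  refine h.congr' ?_
  filter_upwards [eventually_gt_atTop 0] with n hn
  have hn' : (0 : ℝ) < n := by exact_mod_cast hn
  have hps : 0 < ∏ i ∈ Finset.range (n + 1), (s + (i : ℝ)) :=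
    Finset.prod_pos fun i _ => by positivity
  have hpt : 0 < ∏ i ∈ Finset.range (n + 1), (t + (i : ℝ)) :=
    Finset.prod_pos fun i _ => by positivity
  have := Nat.cast_pos (α := ℝ).2 n.factorial_pos
  have h1 : 0 < (n : ℝ) ^ s := by positivity
  have h2 : 0 < (n : ℝ) ^ t := by positivity
  simp only [Pi.div_apply, Real.GammaSeq]
  rw [Finset.prod_div_distrib, Real.rpow_sub hn']
  field_simp

section PolyRate

variable {p : ℕ} {e d : Fin p → ℝ}

theorem polyRate_pos (he : ∀ j, 0 < e j) (n : ℕ) : 0 < polyRate p e n :=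
  Finset.prod_pos fun j _ => by have := he j; positivity

theorem polyRate_succ_pos (hd : ∀ j, -(p : ℝ) < d j) (n : ℕ) : 0 < polyRate p d (n + 1) :=
  Finset.prod_pos fun j _ => by
    have := hd j
    have : (0 : ℝ) ≤ p * n := by positivity
    push_cast
    linarith

theorem polyRate_eq (hp : 0 < p) (c : Fin p → ℝ) (n : ℕ) :
    polyRate p c n = (p : ℝ) ^ p * ∏ j, ((n : ℝ) + c j / p) := by
  have hp' : (p : ℝ) ≠ 0 := by positivity
  have : (p : ℝ) ^ p = ∏ _j : Fin p, (p : ℝ) := by simp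
  rw [polyRate, this, ← Finset.prod_mul_distrib]
  refine Finset.prod_congr rfl fun j _ => ?_
  field_simp

theorem one_add_div_pos (hp : 0 < p) (hd : ∀ j, -(p : ℝ) < d j) (j : Fin p) :
    0 < 1 + d j / p := by
  have hp' : (0 : ℝ) < p := by positivity
  have : 1 + d j / p = (p + d j) / p := by field_simp
  rw [this]
  exact div_pos (by linarith [hd j]) hp'

theorem polyRate_div_polyRate (hp : 0 < p) (e d : Fin p → ℝ) (n : ℕ) :
    polyRate p e n / polyRate p d (n + 1)
      = ∏ j, ((n : ℝ) + e j / p) / ((n : ℝ) + (1 + d j / p)) := by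
  rw [polyRate_eq hp, polyRate_eq hp, mul_div_mul_left _ _ (by positivity),
    ← Finset.prod_div_distrib]
  refine Finset.prod_congr rfl fun j _ => ?_
  push_cast
  ring

/-- π_{n+1} is a product of ratios (i + e_j/p)/(i + 1 + d_j/p) over i ≤ n, with one Gamma limit for
each j. The exponents e_j/p - 1 - d_j/p add up to (E - D)/p - p. -/
theorem tendsto_bdPotential (hp : 0 < p) (he : ∀ j, 0 < e j) (hd : ∀ j, -(p : ℝ) < d j) :
    ∃ c : ℝ, 0 < c ∧ Tendsto (fun n : ℕ => bdPotential (polyRate p e) (polyRate p d) (n + 1)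
      / (n : ℝ) ^ ((∑ j, e j - ∑ j, d j) / (p : ℝ) - p)) atTop (𝓝 c) := by
  have hp' : (0 : ℝ) < p := by positivity
  have hs : ∀ j, 0 < e j / p := fun j => div_pos (he j) hp'
  have ht := one_add_div_pos hp hd
  refine ⟨∏ j, Real.Gamma (1 + d j / p) / Real.Gamma (e j / p), Finset.prod_pos fun j _ =>
    div_pos (Real.Gamma_pos_of_pos (ht j)) (Real.Gamma_pos_of_pos (hs j)), ?_⟩
  have h := tendsto_finsetProd Finset.univ fun j _ => tendsto_prod_ratio (hs j) (ht j)
  refine h.congr' ?_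
  filter_upwards [eventually_gt_atTop 0] with n hn
  have hn' : (0 : ℝ) < n := by exact_mod_cast hn
  rw [Finset.prod_div_distrib, ← Real.rpow_sum_of_pos hn', Finset.prod_comm]
  congr 1
  · rw [bdPotential]
    refine Finset.prod_congr rfl fun i _ => ?_
    rw [polyRate_div_polyRate hp]
    refine Finset.prod_congr rfl fun j _ => ?_
    ring
  · congr 1
    simp only [Finset.sum_sub_distrib, Finset.sum_add_distrib, ← Finset.sum_div]
    simp
    ring

/-- With α = (E - D)/p, π_n is of order n^{α-p}, summable with room since α < p - 1, and 1/(λ_n π_n)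
is of order n^{-α}, summable since α > 1. -/
theorem isGoodWeights_polyRate (hp : 0 < p) (he : ∀ j, 0 < e j) (hd : ∀ j, -(p : ℝ) < d j)
    (hlow : 1 < (∑ j, e j - ∑ j, d j) / (p : ℝ))
    (hupp : (∑ j, e j - ∑ j, d j) / (p : ℝ) < (p : ℝ) - 1) :
    IsGoodWeights (bdPotential (polyRate p e) (polyRate p d))
      (bdScale (polyRate p e) (polyRate p d)) := by
  have hl := polyRate_pos he
  have hm := polyRate_succ_pos hd
  obtain ⟨c, hc, hlim⟩ := tendsto_bdPotential hp he hd
  set α := (∑ j, e j - ∑ j, d j) / (p : ℝ)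
  have hup : ∀ᶠ n : ℕ in atTop, bdPotential (polyRate p e) (polyRate p d) (n + 1)
      ≤ 2 * c * (n : ℝ) ^ (α - p) := by
    filter_upwards [hlim.eventually_le_const (by linarith : c < 2 * c), eventually_gt_atTop 0]
      with n h1 hn
    have hn' : (0 : ℝ) < n := by exact_mod_cast hn
    rwa [div_le_iff₀ (by positivity)] at h1
  have hlo : ∀ᶠ n : ℕ in atTop, c / 2 * (n : ℝ) ^ (α - p)
      ≤ bdPotential (polyRate p e) (polyRate p d) (n + 1) := by
    filter_upwards [hlim.eventually_const_le (by linarith : c / 2 < c), eventually_gt_atTop 0]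
      with n h1 hn
    have hn' : (0 : ℝ) < n := by exact_mod_cast hn
    rwa [le_div_iff₀ (by positivity)] at h1
  -- δ is half of the room that α < p - 1 leaves.
  refine ⟨bdPotential_pos hl hm, bdScale_pos hl hm, ?_, (p - 1 - α) / 2, by linarith, ?_⟩
  · rw [← summable_nat_add_iff 1]
    refine summable_of_isBigO_nat (Real.summable_nat_rpow.2 (by linarith : -α < -1))
      (Asymptotics.IsBigO.of_bound (2 / c) ?_)
    filter_upwards [hlo, eventually_gt_atTop 0] with n h1 hn
    have hn' : (0 : ℝ) < n := by exact_mod_cast hn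
    have hlam : (n : ℝ) ^ (p : ℝ) ≤ polyRate p e (n + 1) := by
      rw [Real.rpow_natCast]
      calc (n : ℝ) ^ p = ∏ _j : Fin p, (n : ℝ) := by simp
        _ ≤ _ := by
          refine Finset.prod_le_prod (fun _ _ => hn'.le) fun j _ => ?_
          have := he j
          have : (1 : ℝ) ≤ p := by exact_mod_cast hp
          push_cast
          nlinarith
    rw [Real.norm_of_nonneg (bdScale_pos hl hm _).le, Real.norm_of_nonneg (by positivity), bdScale]
    have : (polyRate p e (n + 1) * bdPotential (polyRate p e) (polyRate p d) (n + 1))⁻¹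
        ≤ ((n : ℝ) ^ (p : ℝ) * (c / 2 * (n : ℝ) ^ (α - p)))⁻¹ := by
      have := hl (n + 1)
      gcongr
    refine this.trans (le_of_eq ?_)
    rw [Real.rpow_sub hn', Real.rpow_neg hn'.le]
    have : 0 < (n : ℝ) ^ (p : ℝ) := by positivity
    field_simp
  · rw [← summable_nat_add_iff 1]
    refine summable_of_isBigO_nat
      (Real.summable_nat_rpow.2 (by linarith : (α - p) + (p - 1 - α) / 2 < -1))
      (Asymptotics.IsBigO.of_bound (2 * c * 3 ^ ((p - 1 - α) / 2)) ?_)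
    filter_upwards [hup, eventually_gt_atTop 0] with n h1 hn
    have hn' : (0 : ℝ) < n := by exact_mod_cast hn
    have hn1 : (1 : ℝ) ≤ n := by exact_mod_cast hn
    have := (bdPotential_pos hl hm (n + 1)).le
    rw [Real.norm_of_nonneg (by positivity), Real.norm_of_nonneg (by positivity),
      Real.rpow_add hn']
    calc _ ≤ 2 * c * (n : ℝ) ^ (α - p) * (3 * (n : ℝ)) ^ ((p - 1 - α) / 2) := by
          refine mul_le_mul h1 ?_ (by positivity) (by positivity)
          -- After the index shift the base is n + 2 ≤ 3n.
          refine Real.rpow_le_rpow (by positivity) ?_ (by linarith)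
          push_cast
          linarith
      _ = _ := by rw [Real.mul_rpow (by norm_num) hn'.le]; ring

theorem refWeight_mul_self (p : ℕ) (n : ℕ) :
    refWeight p n * refWeight p n = (((n : ℝ) + 1) ^ p)⁻¹ := by
  rw [refWeight, ← Real.rpow_add (by positivity), ← Real.rpow_natCast,
    ← Real.rpow_neg (by positivity)]
  congr 1
  ring

theorem bdPotential_mul_bdScale {lam mu : ℕ → ℝ} (hl : ∀ n, 0 < lam n) (hm : ∀ n, 0 < mu (n + 1))
    (n : ℕ) : bdPotential lam mu n * bdScale lam mu n = (lam n)⁻¹ := by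
  have := bdPotential_pos hl hm n
  have := hl n
  rw [bdScale]
  field_simp

theorem refWeight_div_refWeight_succ (p : ℝ) (n : ℕ) :
    refWeight p n / refWeight p (n + 1) = (((n : ℝ) + 2) / ((n : ℝ) + 1)) ^ (p / 2) := by
  rw [refWeight, refWeight, Real.rpow_neg (by positivity), Real.rpow_neg (by positivity),
    Real.div_rpow (by positivity) (by positivity)]
  push_cast
  rw [show (n : ℝ) + 1 + 1 = n + 2 by ring]
  field_simp

theorem nearOne_refWeight_div (p : ℕ) :
    NearOne fun n => refWeight p n / refWeight p (n + 1) := by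
  have h : NearOne fun n => ∏ _i ∈ Finset.range p, ((n : ℝ) + 2) / ((n : ℝ) + 1) :=
    NearOne.prod (Finset.range p) (ρ := fun _ n => ((n : ℝ) + 2) / ((n : ℝ) + 1))
      (fun _ => nearOne_div one_pos) fun _ n => by positivity
  obtain ⟨C, hC⟩ := h
  refine ⟨C, fun n => le_trans ?_ (hC n)⟩
  dsimp only
  rw [refWeight_div_refWeight_succ, Finset.prod_const, Finset.card_range, ← Real.rpow_natCast]
  refine Real.rpow_le_rpow_of_exponent_le ?_ ?_
  · rw [one_le_div (by positivity)]; linarith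
  · have : (0 : ℝ) ≤ p := Nat.cast_nonneg p
    linarith

theorem nearOne_refWeight_succ_div (p : ℕ) :
    NearOne fun n => refWeight p (n + 1) / refWeight p n := by
  refine nearOne_of_le_one fun n => ?_
  rw [div_le_one (refWeight_pos _ _), refWeight, refWeight]
  have : (0 : ℝ) ≤ p := Nat.cast_nonneg p
  refine Real.rpow_le_rpow_of_nonpos (by positivity) (by push_cast; linarith) (by linarith)

/-- The product of the weights is 1/λ_n, whose ratio to p^{-p}(n+1)^{-p} is a product of fractions
(n+1)/(n + e_j/p). The quotients of consecutive π_n are also 1 + O(1/n). The power of n in π_n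
itself plays no role, which is why the type does not depend on e_j and d_j. -/
theorem bdLimX_polyRate_polyLE (hp : 3 ≤ p) (he : ∀ j, 0 < e j) (hd : ∀ j, -(p : ℝ) < d j)
    (hlow : 1 < (∑ j, e j - ∑ j, d j) / (p : ℝ))
    (hupp : (∑ j, e j - ∑ j, d j) / (p : ℝ) < (p : ℝ) - 1) :
    PolyLE (bdLimX (bdPotential (polyRate p e) (polyRate p d))
        (bdScale (polyRate p e) (polyRate p d)) (1, 0))
      (fun r => refGrowth p (((p : ℝ) ^ p)⁻¹ * r)) ∧
    PolyLE (fun r => refGrowth p (((p : ℝ) ^ p)⁻¹ * r))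
      (bdLimX (bdPotential (polyRate p e) (polyRate p d))
        (bdScale (polyRate p e) (polyRate p d)) (1, 0)) := by
  have hp0 : 0 < p := by omega
  have hp' : (0 : ℝ) < p := by positivity
  have hl := polyRate_pos he
  have hm := polyRate_succ_pos hd
  have hs : ∀ j, 0 < e j / p := fun j => div_pos (he j) hp'
  have ht := one_add_div_pos hp0 hd
  have hA : ∀ j (n : ℕ), 0 < (n : ℝ) + e j / p := fun j n =>
    add_pos_of_nonneg_of_pos n.cast_nonneg (hs j)
  have hB : ∀ j (n : ℕ), 0 < (n : ℝ) + (1 + d j / p) := fun j n =>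
    add_pos_of_nonneg_of_pos n.cast_nonneg (ht j)
  have hC : ∀ n : ℕ, 0 < (n : ℝ) + 1 := fun n => by positivity
  have hgood := isGoodWeights_polyRate hp0 he hd hlow hupp
  have hκ : 0 < ((p : ℝ) ^ p)⁻¹ := by positivity
  have href := (isGoodWeights_refWeight (p := p) (by exact_mod_cast hp)).const_mul hκ
  simp only [← bdLimX_const_mul_refWeight]
  have hpow : ∀ n : ℕ, ((n : ℝ) + 1) ^ p = ∏ _j : Fin p, ((n : ℝ) + 1) := fun n => by simp
  have hL : ∀ n : ℕ, 0 < ∏ j, ((n : ℝ) + e j / p) := fun n =>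
    Finset.prod_pos fun j _ => hA j n
  have hp1 : ∀ n, bdPotential (polyRate p e) (polyRate p d) n
      * bdScale (polyRate p e) (polyRate p d) n
        / (refWeight p n * (((p : ℝ) ^ p)⁻¹ * refWeight p n))
      = ∏ j, ((n : ℝ) + 1) / ((n : ℝ) + e j / p) := fun n => by
    rw [bdPotential_mul_bdScale hl hm, mul_left_comm, refWeight_mul_self, polyRate_eq hp0,
      Finset.prod_div_distrib, ← hpow]
    have := hL n
    field_simp
  have hp2 : ∀ n, refWeight p n * (((p : ℝ) ^ p)⁻¹ * refWeight p n)
        / (bdPotential (polyRate p e) (polyRate p d) n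
      * bdScale (polyRate p e) (polyRate p d) n)
      = ∏ j, ((n : ℝ) + e j / p) / ((n : ℝ) + 1) := fun n => by
    rw [← inv_div, hp1, ← Finset.prod_inv_distrib]
    simp only [inv_div]
  have hq1 : ∀ n, bdPotential (polyRate p e) (polyRate p d) n / refWeight p n
      / (bdPotential (polyRate p e) (polyRate p d) (n + 1) / refWeight p (n + 1))
      = (∏ j, ((n : ℝ) + (1 + d j / p)) / ((n : ℝ) + e j / p))
        * (refWeight p (n + 1) / refWeight p n) := fun n => by
    have a := bdPotential_pos hl hm n
    have b := refWeight_pos p n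
    have c := refWeight_pos p (n + 1)
    have e1 : ∏ j, ((n : ℝ) + (1 + d j / p)) / ((n : ℝ) + e j / p)
        = (polyRate p e n / polyRate p d (n + 1))⁻¹ := by
      rw [polyRate_div_polyRate hp0, ← Finset.prod_inv_distrib]
      simp only [inv_div]
    rw [e1, bdPotential_succ]
    have := hl n
    have := hm n
    field_simp
  have hq2 : ∀ n, refWeight p n / bdPotential (polyRate p e) (polyRate p d) n
      / (refWeight p (n + 1) / bdPotential (polyRate p e) (polyRate p d) (n + 1))
      = (∏ j, ((n : ℝ) + e j / p) / ((n : ℝ) + (1 + d j / p)))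
        * (refWeight p n / refWeight p (n + 1)) := fun n => by
    have a := bdPotential_pos hl hm n
    have b := refWeight_pos p n
    have c := refWeight_pos p (n + 1)
    rw [← polyRate_div_polyRate hp0, bdPotential_succ]
    have := hl n
    have := hm n
    field_simp
  have hw1 : ∀ n, 0 ≤ refWeight p (n + 1) / refWeight p n := fun n =>
    div_nonneg (refWeight_pos _ _).le (refWeight_pos _ _).le
  have hw2 : ∀ n, 0 ≤ refWeight p n / refWeight p (n + 1) := fun n =>
    div_nonneg (refWeight_pos _ _).le (refWeight_pos _ _).le
  constructor
  · refine bdLimX_polyLE hgood href ?_ ?_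
    · simp only [hp1]
      exact NearOne.prod _ (fun j => nearOne_div (hs j)) fun j n =>
        (div_pos (hC n) (hA j n)).le
    · simp only [hq1]
      exact NearOne.mul (NearOne.prod _ (fun j => nearOne_div (hs j)) fun j n =>
        (div_pos (hB j n) (hA j n)).le) (nearOne_refWeight_succ_div p) hw1
  · refine bdLimX_polyLE href hgood ?_ ?_
    · simp only [hp2]
      exact NearOne.prod _ (fun j => nearOne_div one_pos) fun j n =>
        (div_pos (hA j n) (hC n)).le
    · simp only [hq2]
      exact NearOne.mul (NearOne.prod _ (fun j => nearOne_div (ht j)) fun j n =>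
        (div_pos (hA j n) (hB j n)).le) (nearOne_refWeight_div p) hw2

end PolyRate

/-! ### Weak limits of measures with convergent moments -/

theorem isTightMeasureSet_of_integral_sq_le {S : Set (Measure ℝ)} {B : ℝ}
    (hS : ∀ μ ∈ S, IsProbabilityMeasure μ ∧ Integrable (fun x : ℝ => x ^ 2) μ ∧
      ∫ x, x ^ 2 ∂μ ≤ B) : IsTightMeasureSet S := by
  refine isTightMeasureSet_of_tendsto_measure_norm_gt ?_
  have h0 : Tendsto (fun r : ℝ => ENNReal.ofReal (B / r ^ 2)) atTop (𝓝 0) := by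
    have := ENNReal.tendsto_ofReal
      ((tendsto_pow_atTop (α := ℝ) (two_ne_zero)).const_div_atTop B)
    simpa using this
  refine tendsto_of_tendsto_of_tendsto_of_le_of_le' tendsto_const_nhds h0
    (Eventually.of_forall fun _ => zero_le) ?_
  filter_upwards [eventually_gt_atTop 0] with r hr
  refine iSup₂_le fun μ hμ => ?_
  obtain ⟨hp, hi, hB⟩ := hS μ hμ
  have hM := mul_meas_ge_le_integral_of_nonneg (μ := μ) (f := fun x : ℝ => x ^ 2)
    (Eventually.of_forall fun x => sq_nonneg x) hi (r ^ 2)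
  have hsub : {x : ℝ | r < ‖x‖} ⊆ {x : ℝ | r ^ 2 ≤ x ^ 2} := fun x hx => by
    have hx' : r < |x| := hx
    change r ^ 2 ≤ x ^ 2
    rw [← sq_abs x]
    exact pow_le_pow_left₀ hr.le hx'.le 2
  refine (measure_mono hsub).trans ?_
  rw [← ENNReal.ofReal_toReal (measure_ne_top μ {x : ℝ | r ^ 2 ≤ x ^ 2})]
  refine ENNReal.ofReal_le_ofReal ?_
  rw [le_div_iff₀' (by positivity)]
  exact hM.trans hB

/-- Truncation of the real line to `[-R, R]`. -/
def clip (R x : ℝ) : ℝ := max (-R) (min x R)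

theorem abs_clip_le {R : ℝ} (hR : 0 ≤ R) (x : ℝ) : |clip R x| ≤ R := by
  unfold clip
  rw [abs_le]
  exact ⟨le_max_left _ _, max_le (by linarith) (min_le_right _ _)⟩

/-- Beyond R the difference is at most 2|x|^k, and |x|^{k+2}/R ≥ 1 there. The exponent 2(k + 1) is
even, so no absolute moments are needed. -/
theorem abs_pow_sub_clip_pow_le {R : ℝ} (hR : 1 ≤ R) (k : ℕ) (x : ℝ) :
    |x ^ k - clip R x ^ k| ≤ 2 / R * x ^ (2 * (k + 1)) := by
  have hR0 : 0 < R := by linarith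
  have hev : x ^ (2 * (k + 1)) = |x| ^ (2 * (k + 1)) := by
    rw [pow_mul, pow_mul, sq_abs]
  rcases le_or_gt |x| R with h | h
  · have : clip R x = x := by
      rw [abs_le] at h
      unfold clip
      rw [min_eq_left h.2, max_eq_right h.1]
    rw [this, sub_self, abs_zero, hev]
    positivity
  · have h1 : 1 ≤ |x| := by linarith
    have a : |x ^ k - clip R x ^ k| ≤ 2 * |x| ^ k := by
      calc |x ^ k - clip R x ^ k| ≤ |x ^ k| + |clip R x ^ k| := abs_sub _ _
        _ = |x| ^ k + |clip R x| ^ k := by rw [abs_pow, abs_pow]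
        _ ≤ |x| ^ k + |x| ^ k := add_le_add le_rfl
          (pow_le_pow_left₀ (abs_nonneg _) ((abs_clip_le hR0.le x).trans h.le) k)
        _ = _ := by ring
    have b : R ≤ |x| ^ (k + 2) := h.le.trans (le_self_pow₀ h1 (by omega))
    refine a.trans ?_
    rw [hev, div_mul_eq_mul_div, le_div_iff₀ hR0]
    calc 2 * |x| ^ k * R ≤ 2 * |x| ^ k * |x| ^ (k + 2) := by gcongr
      _ = _ := by ring

theorem continuous_clip (R : ℝ) : Continuous (clip R) := by
  unfold clip; fun_prop

/-- The bounded continuous function `x ↦ clip R x ^ k`. -/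
def clipPow (R : ℝ) (k : ℕ) : BoundedContinuousFunction ℝ ℝ :=
  BoundedContinuousFunction.ofNormedAddCommGroup (fun x => clip R x ^ k)
    ((continuous_clip R).pow k) (|R| ^ k) fun x => by
      rw [norm_pow, Real.norm_eq_abs]
      refine pow_le_pow_left₀ (abs_nonneg _) ?_ k
      unfold clip
      rw [abs_le]
      rcases abs_cases R with ⟨h, h'⟩ | ⟨h, h'⟩ <;> rw [h]
      · exact ⟨le_max_left _ _, max_le (by linarith) (min_le_right _ _)⟩
      · exact ⟨by simpa using Or.inl (by linarith), max_le (by linarith)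
          ((min_le_right _ _).trans (by linarith))⟩

theorem abs_integral_pow_sub_clip_le {μ : Measure ℝ} [IsProbabilityMeasure μ] {R : ℝ} (hR : 1 ≤ R)
    (k : ℕ) (h1 : Integrable (fun x : ℝ => x ^ k) μ)
    (h2 : Integrable (fun x : ℝ => x ^ (2 * (k + 1))) μ) :
    |∫ x, x ^ k ∂μ - ∫ x, clipPow R k x ∂μ| ≤ 2 / R * ∫ x, x ^ (2 * (k + 1)) ∂μ := by
  rw [← integral_sub h1 ((clipPow R k).integrable μ), ← integral_const_mul]
  refine (abs_integral_le_integral_abs).trans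
    (integral_mono ((h1.sub ((clipPow R k).integrable μ)).abs) (h2.const_mul _) fun x => ?_)
  exact abs_pow_sub_clip_pow_le hR k x

theorem integrable_pow_of_even {μ : Measure ℝ} [IsProbabilityMeasure μ] (k : ℕ)
    (h : Integrable (fun x : ℝ => x ^ (2 * k)) μ) : Integrable (fun x : ℝ => x ^ k) μ := by
  refine Integrable.mono' ((integrable_const (1 : ℝ)).add h) (by fun_prop) (Eventually.of_forall fun x => ?_)
  rw [norm_pow, Real.norm_eq_abs]
  have : x ^ (2 * k) = (|x| ^ k) ^ 2 := by rw [← pow_mul, mul_comm k, pow_mul, pow_mul, sq_abs]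
  simp only [Pi.add_apply]
  rw [this]
  nlinarith [sq_nonneg (|x| ^ k - 1)]

/-- A sequence of probability measures all of whose moments converge has a weakly convergent
subsequence, and the moments of its limit are the limits of the moments. -/
theorem exists_weak_limit_of_tendsto_moments (ν : ℕ → ProbabilityMeasure ℝ)
    (hint : ∀ n k : ℕ, Integrable (fun x : ℝ => x ^ k) (ν n : Measure ℝ))
    (hlim : ∀ k : ℕ, ∃ L : ℝ, Tendsto (fun n => ∫ x, x ^ k ∂(ν n : Measure ℝ)) atTop (𝓝 L)) :
    ∃ φ : ℕ → ℕ, StrictMono φ ∧ ∃ σ : ProbabilityMeasure ℝ, Tendsto (ν ∘ φ) atTop (𝓝 σ) ∧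
      ∀ k : ℕ, Integrable (fun x : ℝ => x ^ k) (σ : Measure ℝ) ∧
        Tendsto (fun n => ∫ x, x ^ k ∂(ν n : Measure ℝ)) atTop
          (𝓝 (∫ x, x ^ k ∂(σ : Measure ℝ))) := by
  choose L hL using hlim
  obtain ⟨B, hB⟩ := (hL 2).bddAbove_range
  have htight : IsTightMeasureSet {((μ : ProbabilityMeasure ℝ) : Measure ℝ) | μ ∈ Set.range ν} := by
    refine isTightMeasureSet_of_integral_sq_le (B := B) ?_
    rintro _ ⟨_, ⟨n, rfl⟩, rfl⟩
    exact ⟨inferInstance, hint n 2, hB ⟨n, rfl⟩⟩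
  obtain ⟨σ, -, φ, hφ, hσ⟩ := (isCompact_closure_of_isTightMeasureSet htight).tendsto_subseq
    (x := ν) fun n => subset_closure ⟨n, rfl⟩
  refine ⟨φ, hφ, σ, hσ, ?_⟩
  have hLφ : ∀ k, Tendsto (fun n => ∫ x, x ^ k ∂(ν (φ n) : Measure ℝ)) atTop (𝓝 (L k)) :=
    fun k => (hL k).comp hφ.tendsto_atTop
  have heven : ∀ k, Integrable (fun x : ℝ => x ^ (2 * k)) (σ : Measure ℝ) ∧
      ∫ x, x ^ (2 * k) ∂(σ : Measure ℝ) ≤ L (2 * k) := by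
    intro k
    have hnn : ∀ x : ℝ, 0 ≤ x ^ (2 * k) := fun x => by rw [pow_mul]; positivity
    -- Even powers are nonnegative and continuous, so a Fatou inequality for weak limits gives
    -- finite even moments of σ.
    have hle := lintegral_le_liminf_lintegral_of_forall_isOpen_measure_le_liminf_measure
      (μ := (σ : Measure ℝ)) (μs := fun n => (ν (φ n) : Measure ℝ)) (f := fun x : ℝ => x ^ (2 * k))
      (by fun_prop) hnn fun G hG => ProbabilityMeasure.le_liminf_measure_open_of_tendsto hσ hG
    have e : ∀ n, ∫⁻ x, ENNReal.ofReal (x ^ (2 * k)) ∂(ν (φ n) : Measure ℝ)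
        = ENNReal.ofReal (∫ x, x ^ (2 * k) ∂(ν (φ n) : Measure ℝ)) := fun n =>
      (ofReal_integral_eq_lintegral_ofReal (hint _ _) (Eventually.of_forall hnn)).symm
    simp only [e] at hle
    rw [(ENNReal.tendsto_ofReal (hLφ (2 * k))).liminf_eq] at hle
    have hi : Integrable (fun x : ℝ => x ^ (2 * k)) (σ : Measure ℝ) := by
      refine ⟨by fun_prop, ?_⟩
      rw [hasFiniteIntegral_iff_ofReal (Eventually.of_forall hnn)]
      exact hle.trans_lt ENNReal.ofReal_lt_top
    refine ⟨hi, ?_⟩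
    rw [← ofReal_integral_eq_lintegral_ofReal hi (Eventually.of_forall hnn)] at hle
    have hL0 : 0 ≤ L (2 * k) := ge_of_tendsto' (hL (2 * k)) fun n => integral_nonneg hnn
    exact (ENNReal.ofReal_le_ofReal_iff hL0).1 hle
  intro k
  have hi := integrable_pow_of_even k (heven k).1
  refine ⟨hi, ?_⟩
  suffices h : L k = ∫ x, x ^ k ∂(σ : Measure ℝ) by rw [← h]; exact hL k
  have hL0 : 0 ≤ L (2 * (k + 1)) :=
    ge_of_tendsto' (hL (2 * (k + 1))) fun n => integral_nonneg fun x => by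
      rw [pow_mul]; positivity
  -- The truncation error 2/R is paid twice, along the sequence and for σ.
  have key : ∀ R : ℝ, 1 ≤ R →
      |L k - ∫ x, x ^ k ∂(σ : Measure ℝ)| ≤ 4 / R * L (2 * (k + 1)) := by
    intro R hR
    have hc := (ProbabilityMeasure.tendsto_iff_forall_integral_tendsto.1 hσ) (clipPow R k)
    have h1 : |L k - ∫ x, clipPow R k x ∂(σ : Measure ℝ)| ≤ 2 / R * L (2 * (k + 1)) :=
      le_of_tendsto_of_tendsto' ((hLφ k).sub hc).abs ((hLφ (2 * (k + 1))).const_mul (2 / R))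
        fun n => abs_integral_pow_sub_clip_le hR k (hint _ _) (hint _ _)
    have h2 := abs_integral_pow_sub_clip_le hR k hi (heven (k + 1)).1
    have h3 : 2 / R * ∫ x, x ^ (2 * (k + 1)) ∂(σ : Measure ℝ) ≤ 2 / R * L (2 * (k + 1)) := by
      have := (heven (k + 1)).2
      gcongr
    rw [abs_le] at h1 h2 ⊢
    have e : 4 / R * L (2 * (k + 1)) = 2 / R * L (2 * (k + 1)) + 2 / R * L (2 * (k + 1)) := by ring
    rw [e]
    constructor <;> linarith [h1.1, h1.2, h2.1, h2.2]
  have hz : Tendsto (fun R : ℝ => 4 / R * L (2 * (k + 1))) atTop (𝓝 0) := by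
    have := (tendsto_id.const_div_atTop (4 : ℝ)).mul_const (L (2 * (k + 1)))
    simpa using this
  have := ge_of_tendsto hz ((eventually_ge_atTop 1).mono key)
  have := abs_nonpos_iff.1 this
  linarith

/-! ### Truncated birth and death processes -/

theorem sum_fin_ite_eq {N : ℕ} (f : Fin N → ℝ) (t : ℕ) :
    ∑ k : Fin N, (if (k : ℕ) = t then f k else 0) = if h : t < N then f ⟨t, h⟩ else 0 := by
  split_ifs with h
  · rw [Finset.sum_eq_single ⟨t, h⟩]
    · simp
    · intro k _ hk
      exact if_neg fun e => hk (Fin.ext e)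
    · simp
  · refine Finset.sum_eq_zero fun k _ => if_neg fun (e : (k : ℕ) = t) => h (e ▸ k.isLt)

/-- Extension of a finite vector by zero. -/
def extendZero {N : ℕ} (v : Fin N → ℝ) (n : ℕ) : ℝ := if h : n < N then v ⟨n, h⟩ else 0

theorem extendZero_val {N : ℕ} (v : Fin N → ℝ) (n : Fin N) : extendZero v n = v n := by
  simp [extendZero]

theorem extendZero_of_le {N : ℕ} (v : Fin N → ℝ) {n : ℕ} (h : N ≤ n) : extendZero v n = 0 := by
  simp [extendZero, h]

/-- The upper bidiagonal matrix with diagonal `α` and superdiagonal `β`. -/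
def bidiagonal (α β : ℕ → ℝ) (N : ℕ) : Matrix (Fin N) (Fin N) ℝ := fun j k =>
  (if (k : ℕ) = j then α j else 0) + if (k : ℕ) = j + 1 then β j else 0

theorem bidiagonal_mulVec (α β : ℕ → ℝ) {N : ℕ} (v : Fin N → ℝ) {j : ℕ} (hj : j < N) :
    extendZero ((bidiagonal α β N).mulVec v) j
      = α j * extendZero v j + β j * extendZero v (j + 1) := by
  have e : extendZero ((bidiagonal α β N).mulVec v) j = (bidiagonal α β N).mulVec v ⟨j, hj⟩ := by
    simp [extendZero, hj]
  rw [e, Matrix.mulVec, dotProduct]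
  simp only [bidiagonal, add_mul, ite_mul, zero_mul]
  rw [Finset.sum_add_distrib, sum_fin_ite_eq (fun k => α j * v k),
    sum_fin_ite_eq (fun k => β j * v k)]
  simp only [extendZero, mul_dite, mul_zero]

theorem bidiagonal_transpose_mulVec_zero (α β : ℕ → ℝ) {N : ℕ} (v : Fin N → ℝ) (hN : 0 < N) :
    extendZero ((bidiagonal α β N).transpose.mulVec v) 0 = α 0 * extendZero v 0 := by
  have e : extendZero ((bidiagonal α β N).transpose.mulVec v) 0
      = (bidiagonal α β N).transpose.mulVec v ⟨0, hN⟩ := by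
    simp [extendZero, hN]
  rw [e, Matrix.mulVec, dotProduct]
  have e2 : ∀ k : Fin N, (bidiagonal α β N).transpose ⟨0, hN⟩ k * v k
      = if (k : ℕ) = 0 then α k * v k else 0 := fun k => by
    simp [bidiagonal, Matrix.transpose_apply, eq_comm]
  simp only [e2]
  rw [sum_fin_ite_eq (fun k => α k * v k)]
  simp [extendZero, hN]

theorem bidiagonal_transpose_mulVec_succ (α β : ℕ → ℝ) {N : ℕ} (v : Fin N → ℝ) {j : ℕ}
    (hj : j + 1 < N) :
    extendZero ((bidiagonal α β N).transpose.mulVec v) (j + 1)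
      = α (j + 1) * extendZero v (j + 1) + β j * extendZero v j := by
  have e : extendZero ((bidiagonal α β N).transpose.mulVec v) (j + 1)
      = (bidiagonal α β N).transpose.mulVec v ⟨j + 1, hj⟩ := by
    simp [extendZero, hj]
  rw [e, Matrix.mulVec, dotProduct]
  have e2 : ∀ k : Fin N, (bidiagonal α β N).transpose ⟨j + 1, hj⟩ k * v k
      = (if (k : ℕ) = j + 1 then α k * v k else 0) + if (k : ℕ) = j then β k * v k else 0 :=
    fun k => by
      simp only [bidiagonal, Matrix.transpose_apply, add_mul, ite_mul, zero_mul]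
      congr 1
      · simp [eq_comm]
      · by_cases h : (k : ℕ) = j
        · simp [h]
        · have : ¬ j = (k : ℕ) := fun e => h e.symm
          simp [h, this]
  simp only [e2]
  rw [Finset.sum_add_distrib, sum_fin_ite_eq (fun k => α k * v k),
    sum_fin_ite_eq (fun k => β k * v k)]
  have hj' : j < N := by omega
  simp [extendZero, hj, hj']

/-- Spectral decomposition of `Cᵀ C`. -/
theorem exists_spectral {N : ℕ} (C : Matrix (Fin N) (Fin N) ℝ) :
    ∃ (x : Fin N → ℝ) (V : Fin N → Fin N → ℝ), (∀ i, 0 ≤ x i) ∧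
      (∀ i, C.transpose.mulVec (C.mulVec (V i)) = x i • V i) ∧
      ∀ j k, ∑ i, V i j * V i k = if j = k then 1 else 0 := by
  have hps := Matrix.posSemidef_conjTranspose_mul_self C
  have hA := hps.isHermitian
  refine ⟨hA.eigenvalues, fun i => hA.eigenvectorBasis i, hps.eigenvalues_nonneg, fun i => ?_,
    fun j k => ?_⟩
  · have := hA.mulVec_eigenvectorBasis i
    rw [Matrix.mulVec_mulVec, ← Matrix.conjTranspose_eq_transpose_of_trivial]
    exact this
  -- Parseval for two coordinate vectors: the eigenvector matrix has orthonormal columns as well as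
  -- rows.
  · have h := hA.eigenvectorBasis.sum_inner_mul_inner (EuclideanSpace.single j (1 : ℝ))
      (EuclideanSpace.single k (1 : ℝ))
    simp only [EuclideanSpace.inner_single_left, EuclideanSpace.inner_single_right] at h
    simpa [Pi.single_apply, eq_comm] using h

section Spectral

variable {N : ℕ} {C : Matrix (Fin N) (Fin N) ℝ} {x : Fin N → ℝ} {V : Fin N → Fin N → ℝ}

theorem spectral_symm (hV : ∀ i, C.transpose.mulVec (C.mulVec (V i)) = x i • V i)
    (y : Fin N → ℝ) (i : Fin N) :
    dotProduct (V i) (C.transpose.mulVec (C.mulVec y)) = x i * dotProduct (V i) y := by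
  have h1 : dotProduct (V i) (C.transpose.mulVec (C.mulVec y))
      = dotProduct (C.mulVec (V i)) (C.mulVec y) := by
    rw [Matrix.dotProduct_mulVec, Matrix.vecMul_transpose]
  have h2 : dotProduct y (C.transpose.mulVec (C.mulVec (V i)))
      = dotProduct (C.mulVec y) (C.mulVec (V i)) := by
    rw [Matrix.dotProduct_mulVec, Matrix.vecMul_transpose]
  rw [h1, dotProduct_comm, ← h2, hV, dotProduct_smul, smul_eq_mul, dotProduct_comm]

theorem spectral_expand (hO : ∀ j k, ∑ i, V i j * V i k = if j = k then 1 else 0)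
    (y : Fin N → ℝ) (j : Fin N) : ∑ i, V i j * dotProduct (V i) y = y j := by
  simp only [dotProduct, Finset.mul_sum]
  rw [Finset.sum_comm]
  have : ∀ k, ∑ i, V i j * (V i k * y k) = (if j = k then 1 else 0) * y k := fun k => by
    rw [← hO, Finset.sum_mul]
    exact Finset.sum_congr rfl fun i _ => by ring
  simp [this]

theorem spectral_norm (hO : ∀ j k, ∑ i, V i j * V i k = if j = k then 1 else 0)
    (y : Fin N → ℝ) : ∑ i, dotProduct (V i) y ^ 2 = dotProduct y y := by
  have : ∀ i, dotProduct (V i) y ^ 2 = ∑ j, y j * (V i j * dotProduct (V i) y) := fun i => by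
    rw [sq, dotProduct, Finset.sum_mul]
    exact Finset.sum_congr rfl fun j _ => by ring
  simp only [this]
  rw [Finset.sum_comm]
  simp only [← Finset.mul_sum, spectral_expand hO]
  rfl

/-- The spectral measure `∑ c_i² δ_{x_i}`. -/
def atomicMeasure (x c : Fin N → ℝ) : Measure ℝ :=
  ∑ i, ENNReal.ofReal (c i ^ 2) • Measure.dirac (x i)

theorem integrable_atomicMeasure (x c : Fin N → ℝ) (f : ℝ → ℝ) :
    Integrable f (atomicMeasure x c) := by
  unfold atomicMeasure
  rw [integrable_finsetSum_measure]
  intro i _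
  refine Integrable.smul_measure ?_ ENNReal.ofReal_ne_top
  exact integrable_dirac (by simp)

theorem integral_atomicMeasure (x c : Fin N → ℝ) (f : ℝ → ℝ) :
    ∫ t, f t ∂(atomicMeasure x c) = ∑ i, c i ^ 2 * f (x i) := by
  unfold atomicMeasure
  rw [integral_finsetSum_measure]
  · refine Finset.sum_congr rfl fun i _ => ?_
    rw [integral_smul_measure, integral_dirac, ENNReal.toReal_ofReal (sq_nonneg _), smul_eq_mul]
  · intro i _
    refine Integrable.smul_measure ?_ ENNReal.ofReal_ne_top
    exact integrable_dirac (by simp)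

theorem isProbabilityMeasure_atomicMeasure (x : Fin N → ℝ) {c : Fin N → ℝ}
    (hc : ∑ i, c i ^ 2 = 1) : IsProbabilityMeasure (atomicMeasure x c) := by
  constructor
  simp only [atomicMeasure, Measure.coe_finsetSum, Finset.sum_apply, Measure.smul_apply,
    measure_univ, smul_eq_mul, mul_one]
  rw [← ENNReal.ofReal_sum_of_nonneg fun i _ => sq_nonneg _, hc, ENNReal.ofReal_one]

theorem atomicMeasure_Iio {x : Fin N → ℝ} (c : Fin N → ℝ) (hx : ∀ i, 0 ≤ x i) :
    atomicMeasure x c (Set.Iio 0) = 0 := by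
  simp only [atomicMeasure, Measure.coe_finsetSum, Finset.sum_apply, Measure.smul_apply,
    smul_eq_mul]
  refine Finset.sum_eq_zero fun i _ => ?_
  rw [Measure.dirac_apply' _ measurableSet_Iio, Set.indicator_of_notMem]
  · simp
  · simpa using hx i

theorem atomicMeasure_singleton_zero (x c : Fin N → ℝ) :
    atomicMeasure x c {0} = ENNReal.ofReal (∑ i, if x i = 0 then c i ^ 2 else 0) := by
  simp only [atomicMeasure, Measure.coe_finsetSum, Finset.sum_apply, Measure.smul_apply,
    smul_eq_mul]
  rw [ENNReal.ofReal_sum_of_nonneg fun i _ => by split_ifs <;> positivity]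
  refine Finset.sum_congr rfl fun i _ => ?_
  rw [Measure.dirac_apply' _ (measurableSet_singleton 0)]
  by_cases h : x i = 0 <;> simp [h, Set.indicator]

/-- A vector in the kernel of `Cᵀ C` produces an atom at the origin. -/
theorem sq_le_atom_mul (hV : ∀ i, C.transpose.mulVec (C.mulVec (V i)) = x i • V i)
    (hO : ∀ j k, ∑ i, V i j * V i k = if j = k then 1 else 0) (y : Fin N → ℝ)
    (hy : C.mulVec y = 0) (j : Fin N) :
    y j ^ 2 ≤ (∑ i, if x i = 0 then V i j ^ 2 else 0) * dotProduct y y := by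
  -- The vector y is orthogonal to eigenvectors with nonzero eigenvalue, so only those for 0 enter
  -- its expansion, to which Cauchy–Schwarz is then applied.
  have h0 : ∀ i, x i ≠ 0 → dotProduct (V i) y = 0 := fun i hi => by
    have := spectral_symm hV y i
    rw [hy, Matrix.mulVec_zero, dotProduct_zero] at this
    exact (mul_eq_zero.1 this.symm).resolve_left hi
  have e : y j = ∑ i, (if x i = 0 then V i j else 0) * dotProduct (V i) y := by
    rw [← spectral_expand hO y j]
    refine Finset.sum_congr rfl fun i _ => ?_
    split_ifs with h
    · rfl
    · rw [h0 i h]; simp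
  rw [e, ← spectral_norm hO y]
  refine (Finset.sum_mul_sq_le_sq_mul_sq _ _ _).trans (le_of_eq ?_)
  congr 1
  refine Finset.sum_congr rfl fun i _ => ?_
  split_ifs <;> simp

/-- A solution of `Cᵀ C y = e_j` bounds the integral of `1 / (x + ε)`. -/
theorem sum_div_add_le (hx : ∀ i, 0 ≤ x i)
    (hV : ∀ i, C.transpose.mulVec (C.mulVec (V i)) = x i • V i)
    (hO : ∀ j k, ∑ i, V i j * V i k = if j = k then 1 else 0) (y : Fin N → ℝ) (j : Fin N)
    (hy : C.transpose.mulVec (C.mulVec y) = Pi.single j 1) {ε : ℝ} (hε : 0 < ε) :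
    ∑ i, V i j ^ 2 * (1 / (|x i| + ε)) ≤ y j := by
  rw [← spectral_expand hO y j]
  refine Finset.sum_le_sum fun i _ => ?_
  have h := spectral_symm hV y i
  -- Now V_ij = x_i ⟨V_i, y⟩, so V_ij = 0 when x_i = 0, and y_j is the sum of V_ij²/x_i over the
  -- other i.
  rw [hy, dotProduct_single, mul_one] at h
  rw [abs_of_nonneg (hx i)]
  have hpos : 0 < x i + ε := by have := hx i; positivity
  rw [mul_one_div, div_le_iff₀ hpos]
  set D := dotProduct (V i) y
  rcases (hx i).eq_or_lt with h0 | h0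
  · rw [← h0, zero_mul] at h
    simp [h]
  · have : V i j * D = V i j ^ 2 / x i := by rw [h]; field_simp
    have h2 : 0 ≤ V i j * D := by rw [this]; positivity
    have h3 : V i j * D * x i = V i j ^ 2 := by rw [this]; field_simp
    nlinarith

end Spectral

theorem eval_orthPoly_of_recurrence {a b : ℕ → ℝ} (hb : ∀ n, b n ≠ 0) {x : ℝ} {y : ℕ → ℝ} {M : ℕ}
    (h0 : 1 ≤ M → b 0 * y 1 = (x - a 0) * y 0)
    (h : ∀ j, j + 2 ≤ M → b (j + 1) * y (j + 2) = (x - a (j + 1)) * y (j + 1) - b j * y j)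
    (m : ℕ) (hm : m ≤ M) : y m = (orthPoly a b m).eval x * y 0 := by
  induction m using Nat.strong_induction_on with
  | _ m ih =>
    match m with
    | 0 => simp [orthPoly, jacobiRec]
    | 1 =>
      have := h0 hm
      have hb0 := hb 0
      simp only [orthPoly, jacobiRec, Polynomial.eval_mul, Polynomial.eval_C, Polynomial.eval_sub,
        Polynomial.eval_X]
      rw [mul_assoc, eq_inv_mul_iff_mul_eq₀ hb0, this]
    | j + 2 =>
      have i1 := ih (j + 1) (by omega) (by omega)
      have i0 := ih j (by omega) (by omega)
      have := h j hm
      have hb0 := hb (j + 1)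
      simp only [orthPoly] at i1 i0 ⊢
      rw [jacobiRec]
      simp only [Polynomial.eval_mul, Polynomial.eval_C, Polynomial.eval_sub, Polynomial.eval_X]
      rw [mul_assoc, eq_inv_mul_iff_mul_eq₀ hb0, this, i1, i0]
      ring

section Truncated

variable {lam mu : ℕ → ℝ}

/-- The factor `C` of the truncated Jacobi matrix `Cᵀ C` of a birth and death process whose last
birth rate is replaced by `l`. -/
def truncFactor (lam mu : ℕ → ℝ) (M : ℕ) (l : ℝ) : Matrix (Fin (M + 1)) (Fin (M + 1)) ℝ :=
  bidiagonal (fun j => √(if j < M then lam j else l)) (fun j => √(mu (j + 1))) (M + 1)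

/-- Since b_j = √λ_j √μ_{j+1}, the rows before the last of CᵀC are those of the Jacobi matrix, and
they determine an eigenvector from its first entry. The last row, which contains `l`, is not needed.
-/
theorem truncFactor_eigenvector (hl : ∀ n, 0 < lam n) (hm : ∀ n, 0 < mu (n + 1)) (hm0 : mu 0 = 0)
    {M : ℕ} {l x : ℝ} {v : Fin (M + 1) → ℝ}
    (hv : (truncFactor lam mu M l).transpose.mulVec ((truncFactor lam mu M l).mulVec v) = x • v)
    (m : Fin (M + 1)) :
    v m = (orthPoly (bdDiag lam mu) (bdOffDiag lam mu) m).eval x * v 0 := by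
  set w := (truncFactor lam mu M l).mulVec v
  have hw : ∀ j, j < M → extendZero w j
      = √(lam j) * extendZero v j + √(mu (j + 1)) * extendZero v (j + 1) := fun j hj => by
    have := bidiagonal_mulVec (fun j => √(if j < M then lam j else l)) (fun j => √(mu (j + 1))) v
      (j := j) (by omega)
    change extendZero w j = _ at this
    simpa [hj] using this
  have hx : ∀ j, extendZero (x • v) j = x * extendZero v j := fun j => by
    simp [extendZero]
  have h0 : 0 < M → √(lam 0) * extendZero w 0 = x * extendZero v 0 := fun hM => by
    have := bidiagonal_transpose_mulVec_zero (fun j => √(if j < M then lam j else l))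
      (fun j => √(mu (j + 1))) w (by omega)
    rw [← hx, ← hv, truncFactor, this]
    simp [hM]
  have h1 : ∀ j, j + 1 < M → √(lam (j + 1)) * extendZero w (j + 1)
      + √(mu (j + 1)) * extendZero w j = x * extendZero v (j + 1) := fun j hj => by
    have := bidiagonal_transpose_mulVec_succ (fun j => √(if j < M then lam j else l))
      (fun j => √(mu (j + 1))) w (j := j) (by omega)
    rw [← hx, ← hv, truncFactor, this]
    simp [hj]
  have hsl : ∀ j, √(lam j) * √(lam j) = lam j := fun j => Real.mul_self_sqrt (hl j).le
  have hsm : ∀ j, √(mu (j + 1)) * √(mu (j + 1)) = mu (j + 1) := fun j =>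
    Real.mul_self_sqrt (hm j).le
  have hb : ∀ j, bdOffDiag lam mu j = √(lam j) * √(mu (j + 1)) := fun j =>
    Real.sqrt_mul (hl j).le _
  have key := eval_orthPoly_of_recurrence (a := bdDiag lam mu) (b := bdOffDiag lam mu)
    (fun n => (bdOffDiag_pos hl hm n).ne') (x := x) (y := extendZero v) (M := M)
    (fun hM => by
      have a := h0 hM
      rw [hw 0 hM] at a
      rw [hb, bdDiag, hm0]
      linear_combination a - extendZero v 0 * hsl 0)
    (fun j hj => by
      have a := h1 j (by omega)
      rw [hw j (by omega), hw (j + 1) (by omega)] at a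
      rw [hb, hb, bdDiag]
      linear_combination a - extendZero v (j + 1) * hsl (j + 1) - extendZero v (j + 1) * hsm j)
    m (Nat.lt_succ_iff.1 m.isLt)
  rw [extendZero_val] at key
  rw [key]
  congr 1

/-- The truncated processes solve the truncated moment problems. -/
theorem exists_truncated (hl : ∀ n, 0 < lam n) (hm : ∀ n, 0 < mu (n + 1)) (hm0 : mu 0 = 0)
    (M : ℕ) (l : ℝ) :
    ∃ (x : Fin (M + 1) → ℝ) (V : Fin (M + 1) → Fin (M + 1) → ℝ), (∀ i, 0 ≤ x i) ∧
      (∀ i, (truncFactor lam mu M l).transpose.mulVec ((truncFactor lam mu M l).mulVec (V i))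
        = x i • V i) ∧
      (∀ j k, ∑ i, V i j * V i k = if j = k then 1 else 0) ∧
      IsProbabilityMeasure (atomicMeasure x fun i => V i 0) ∧
      ∀ m n, m ≤ M → n ≤ M →
        ∫ t, (orthPoly (bdDiag lam mu) (bdOffDiag lam mu) m).eval t
          * (orthPoly (bdDiag lam mu) (bdOffDiag lam mu) n).eval t
            ∂(atomicMeasure x fun i => V i 0) = if m = n then 1 else 0 := by
  obtain ⟨x, V, hx, hV, hO⟩ := exists_spectral (truncFactor lam mu M l)
  refine ⟨x, V, hx, hV, hO, isProbabilityMeasure_atomicMeasure x ?_, fun m n hmM hnM => ?_⟩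
  · have := hO 0 0
    simpa [sq] using this
  · rw [integral_atomicMeasure]
    have := hO ⟨m, by omega⟩ ⟨n, by omega⟩
    simp only [Fin.mk.injEq] at this
    rw [← this]
    -- As V_im = P_m(x_i) V_i0, orthonormality of the columns is orthonormality of the P_m for the
    -- weights V_i0².
    refine Finset.sum_congr rfl fun i _ => ?_
    have e := fun m => truncFactor_eigenvector hl hm hm0 (hV i) m
    rw [e ⟨m, by omega⟩, e ⟨n, by omega⟩]
    ring

theorem sqrt_mul_bdSign (hl : ∀ n, 0 < lam n) (hm : ∀ n, 0 < mu (n + 1)) (n : ℕ) :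
    √(mu (n + 1)) * bdSign lam mu (n + 1) = -(√(lam n) * bdSign lam mu n) := by
  have h := bdOffDiag_mul_bdSign_succ hl hm n
  have h1 := Real.sqrt_pos.2 (hl n)
  rw [bdOffDiag, Real.sqrt_mul (hl n).le] at h
  have h2 := Real.mul_self_sqrt (hl n).le
  have : √(lam n) * (√(mu (n + 1)) * bdSign lam mu (n + 1))
      = √(lam n) * -(√(lam n) * bdSign lam mu n) := by
    linear_combination h + bdSign lam mu n * h2
  exact mul_left_cancel₀ h1.ne' this

theorem eq_of_extendZero_eq {N : ℕ} {v w : Fin N → ℝ}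
    (h : ∀ j < N, extendZero v j = extendZero w j) : v = w := by
  funext j
  have := h j j.isLt
  rwa [extendZero_val, extendZero_val] at this

/-- Rows before the last kill P_k(0) by `sqrt_mul_bdSign`; the last row vanishes because its only
entry is √0. -/
theorem truncFactor_kernel (hl : ∀ n, 0 < lam n) (hm : ∀ n, 0 < mu (n + 1)) (M : ℕ) :
    (truncFactor lam mu M 0).mulVec (fun k => bdSign lam mu k) = 0 := by
  refine eq_of_extendZero_eq fun j hj => ?_
  rw [truncFactor, bidiagonal_mulVec _ _ _ hj]
  have h0 : extendZero (0 : Fin (M + 1) → ℝ) j = 0 := by simp [extendZero]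
  rw [h0]
  by_cases h : j < M
  · have := sqrt_mul_bdSign hl hm j
    simp [extendZero, h, hj]
    linarith
  · have : extendZero (fun k : Fin (M + 1) => bdSign lam mu k) (j + 1) = 0 :=
      extendZero_of_le _ (by omega)
    simp [h, this]

/-- In C y the partial sums telescope and leave √λ_j P_j(0)/(λ_j π_j), which Cᵀ maps to e_0. What
matters later is y_0 = Σ_{m ≤ M} 1/(λ_m π_m). -/
theorem truncFactor_solution (hl : ∀ n, 0 < lam n) (hm : ∀ n, 0 < mu (n + 1)) (M : ℕ) :
    (truncFactor lam mu M (lam M)).transpose.mulVec ((truncFactor lam mu M (lam M)).mulVec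
      (fun k => bdSign lam mu k * ∑ m ∈ Finset.Ico (k : ℕ) (M + 1), bdScale lam mu m))
      = Pi.single 0 1 := by
  set y : Fin (M + 1) → ℝ := fun k =>
    bdSign lam mu k * ∑ m ∈ Finset.Ico (k : ℕ) (M + 1), bdScale lam mu m
  set w := (truncFactor lam mu M (lam M)).mulVec y
  have hα : ∀ j, j < M + 1 → √(if j < M then lam j else lam M) = √(lam j) := fun j hj => by
    split_ifs with h
    · rfl
    · rw [show j = M by omega]
  -- At j = M + 1 both sides are 0, so the last row of C needs no separate treatment.
  have hy : ∀ j, j ≤ M + 1 → extendZero y j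
      = bdSign lam mu j * ∑ m ∈ Finset.Ico j (M + 1), bdScale lam mu m := fun j hj => by
    rcases hj.lt_or_eq with h | h
    · simp [extendZero, h, y]
    · rw [extendZero_of_le _ h.ge, h]; simp
  have hw : ∀ j, j < M + 1 → extendZero w j = √(lam j) * bdSign lam mu j * bdScale lam mu j :=
    fun j hj => by
      have := bidiagonal_mulVec (fun j => √(if j < M then lam j else lam M))
        (fun j => √(mu (j + 1))) y hj
      change extendZero w j = _ at this
      rw [this, hα j hj, hy j hj.le, hy (j + 1) hj, Finset.sum_eq_sum_Ico_succ_bot hj]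
      linear_combination (∑ m ∈ Finset.Ico (j + 1) (M + 1), bdScale lam mu m)
        * sqrt_mul_bdSign hl hm j
  refine eq_of_extendZero_eq fun j hj => ?_
  match j with
  | 0 =>
    have := bidiagonal_transpose_mulVec_zero (fun j => √(if j < M then lam j else lam M))
      (fun j => √(mu (j + 1))) w hj
    rw [truncFactor, this]
    rw [hα 0 hj, hw 0 hj]
    have e : extendZero (Pi.single 0 1 : Fin (M + 1) → ℝ) 0 = 1 := by simp [extendZero]
    have h1 := Real.mul_self_sqrt (hl 0).le
    have h2 := (hl 0).ne'
    rw [e, bdScale, bdSign, bdPotential]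
    simp
    rw [← mul_assoc, h1, mul_inv_cancel₀ h2]
  | j + 1 =>
    have := bidiagonal_transpose_mulVec_succ (fun j => √(if j < M then lam j else lam M))
      (fun j => √(mu (j + 1))) w hj
    rw [truncFactor, this]
    rw [hα (j + 1) hj, hw (j + 1) hj, hw j (by omega)]
    have e : extendZero (Pi.single 0 1 : Fin (M + 1) → ℝ) (j + 1) = 0 := by
      simp only [extendZero]
      split_ifs
      exact Pi.single_eq_of_ne (by simp [Fin.ext_iff]) 1
    rw [e]
    have h1 := Real.mul_self_sqrt (hl (j + 1)).le
    have h2 := sqrt_mul_bdSign hl hm j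
    have h3 := Real.mul_self_sqrt (hm j).le
    have h4 : lam (j + 1) * bdScale lam mu (j + 1) = mu (j + 1) * bdScale lam mu j := by
      have p1 := (hl (j + 1)).ne'
      have p2 := (hl j).ne'
      have p3 := (hm j).ne'
      have p4 := (bdPotential_pos hl hm j).ne'
      rw [bdScale, bdScale, bdPotential_succ]
      field_simp
    linear_combination bdSign lam mu (j + 1) * bdScale lam mu (j + 1) * h1
      + √(mu (j + 1)) * bdScale lam mu j * h2 + bdSign lam mu (j + 1) * h4
      - bdScale lam mu j * bdSign lam mu (j + 1) * h3

end Truncated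

/-! ### Indeterminacy -/

/-- The recurrence makes the span closed under multiplication by `X`, and it contains P_0 = 1. -/
theorem span_orthPoly_eq_top {a b : ℕ → ℝ} (hb : ∀ n, b n ≠ 0) :
    Submodule.span ℝ (Set.range (orthPoly a b)) = ⊤ := by
  set S := Submodule.span ℝ (Set.range (orthPoly a b))
  have hP : ∀ n, orthPoly a b n ∈ S := fun n => Submodule.subset_span ⟨n, rfl⟩
  have hX : ∀ q ∈ S, Polynomial.X * q ∈ S := by
    intro q hq
    refine Submodule.span_induction (p := fun q _ => Polynomial.X * q ∈ S) ?_ ?_ ?_ ?_ hq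
    · rintro _ ⟨n, rfl⟩
      have hc : ∀ n, (Polynomial.C (b n) : Polynomial ℝ) * Polynomial.C (b n)⁻¹ = 1 := fun n => by
        rw [← Polynomial.C_mul, mul_inv_cancel₀ (hb n), Polynomial.C_1]
      match n with
      | 0 =>
        have e : Polynomial.X * orthPoly a b 0
            = b 0 • orthPoly a b 1 + a 0 • orthPoly a b 0 := by
          simp only [orthPoly, jacobiRec, Polynomial.smul_eq_C_mul]
          linear_combination (-(Polynomial.X - Polynomial.C (a 0))) * hc 0
        rw [e]
        exact S.add_mem (S.smul_mem _ (hP 1)) (S.smul_mem _ (hP 0))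
      | n + 1 =>
        have e : Polynomial.X * orthPoly a b (n + 1) = b (n + 1) • orthPoly a b (n + 2)
            + (a (n + 1) • orthPoly a b (n + 1) + b n • orthPoly a b n) := by
          have e1 : orthPoly a b (n + 2) = Polynomial.C (b (n + 1))⁻¹ *
              ((Polynomial.X - Polynomial.C (a (n + 1))) * orthPoly a b (n + 1)
                - Polynomial.C (b n) * orthPoly a b n) := by
            simp only [orthPoly]
            rw [jacobiRec]
          rw [e1]
          simp only [Polynomial.smul_eq_C_mul]
          linear_combination (-((Polynomial.X - Polynomial.C (a (n + 1))) * orthPoly a b (n + 1)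
                - Polynomial.C (b n) * orthPoly a b n)) * hc (n + 1)
        rw [e]
        exact S.add_mem (S.smul_mem _ (hP _)) (S.add_mem (S.smul_mem _ (hP _)) (S.smul_mem _ (hP _)))
    · simp
    · intro x y _ _ hx hy
      rw [mul_add]
      exact S.add_mem hx hy
    · intro c x _ hx
      rw [mul_smul_comm]
      exact S.smul_mem c hx
  have hXn : ∀ n : ℕ, (Polynomial.X : Polynomial ℝ) ^ n ∈ S := by
    intro n
    induction n with
    | zero => simpa [orthPoly, jacobiRec] using hP 0
    | succ n ih => rw [pow_succ']; exact hX _ ih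
  refine eq_top_iff.2 fun q _ => ?_
  rw [q.as_sum_range_C_mul_X_pow]
  refine S.sum_mem fun i _ => ?_
  rw [← Polynomial.smul_eq_C_mul]
  exact S.smul_mem _ (hXn i)

/-- Solutions of the truncated problems have a weak limit, which solves the full problem. -/
theorem exists_solution_of_truncated {a b : ℕ → ℝ} (hb : ∀ n, b n ≠ 0)
    (ν : ℕ → ProbabilityMeasure ℝ)
    (hint : ∀ (n : ℕ) (q : Polynomial ℝ), Integrable (fun x => q.eval x) (ν n : Measure ℝ))
    (hneg : ∀ n, (ν n : Measure ℝ) (Set.Iio 0) = 0)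
    (horth : ∀ M m n, m ≤ M → n ≤ M →
      ∫ x, (orthPoly a b m).eval x * (orthPoly a b n).eval x ∂(ν M : Measure ℝ)
        = if m = n then 1 else 0) :
    ∃ φ : ℕ → ℕ, StrictMono φ ∧ ∃ σ : ProbabilityMeasure ℝ, Tendsto (ν ∘ φ) atTop (𝓝 σ) ∧
      IsStieltjesSolution a b σ := by
  -- The integral of P_n = P_n P_0 is prescribed once M ≥ n, and the P_n span, so each polynomial
  -- has an eventually constant integral.
  have hlim : ∀ q : Polynomial ℝ, ∃ L : ℝ,
      ∀ᶠ M in atTop, ∫ x, q.eval x ∂(ν M : Measure ℝ) = L := by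
    intro q
    have hq : q ∈ Submodule.span ℝ (Set.range (orthPoly a b)) := by
      rw [span_orthPoly_eq_top hb]; trivial
    refine Submodule.span_induction (p := fun q _ => ∃ L : ℝ,
      ∀ᶠ M in atTop, ∫ x, q.eval x ∂(ν M : Measure ℝ) = L) ?_ ?_ ?_ ?_ hq
    · rintro _ ⟨n, rfl⟩
      refine ⟨if n = 0 then 1 else 0, ?_⟩
      filter_upwards [eventually_ge_atTop n] with M hM
      have := horth M n 0 hM (Nat.zero_le M)
      simpa [orthPoly, jacobiRec] using this
    · exact ⟨0, Eventually.of_forall fun M => by simp⟩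
    · rintro x y _ _ ⟨L1, h1⟩ ⟨L2, h2⟩
      refine ⟨L1 + L2, ?_⟩
      filter_upwards [h1, h2] with M a1 a2
      simp only [Polynomial.eval_add]
      rw [integral_add (hint M x) (hint M y), a1, a2]
    · rintro c x _ ⟨L, h⟩
      refine ⟨c * L, ?_⟩
      filter_upwards [h] with M a1
      simp only [Polynomial.eval_smul, smul_eq_mul]
      rw [integral_const_mul, a1]
  obtain ⟨φ, hφ, σ, hσ, hmom⟩ := exists_weak_limit_of_tendsto_moments ν
    (fun n k => by simpa using hint n (Polynomial.X ^ k))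
    (fun k => by
      obtain ⟨L, hL⟩ := hlim (Polynomial.X ^ k)
      simp only [Polynomial.eval_pow, Polynomial.eval_X] at hL
      exact ⟨L, tendsto_const_nhds.congr' (hL.mono fun _ h => h.symm)⟩)
  have hpoly : ∀ q : Polynomial ℝ, Integrable (fun x => q.eval x) (σ : Measure ℝ) ∧
      Tendsto (fun n => ∫ x, q.eval x ∂(ν n : Measure ℝ)) atTop
        (𝓝 (∫ x, q.eval x ∂(σ : Measure ℝ))) := by
    intro q
    induction q using Polynomial.induction_on' with
    | add x y hx hy =>
      simp only [Polynomial.eval_add]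
      refine ⟨hx.1.add hy.1, ?_⟩
      rw [integral_add hx.1 hy.1]
      refine (hx.2.add hy.2).congr fun n => ?_
      rw [integral_add (hint n x) (hint n y)]
    | monomial k c =>
      simp only [Polynomial.eval_monomial, integral_const_mul]
      exact ⟨(hmom k).1.const_mul c, (hmom k).2.const_mul c⟩
  refine ⟨φ, hφ, σ, hσ, ?_, fun k => (hmom k).1, fun m n => ?_⟩
  · have := ProbabilityMeasure.le_liminf_measure_open_of_tendsto hσ (isOpen_Iio (a := (0 : ℝ)))
    simpa [hneg] using this
  · have h := (hpoly (orthPoly a b m * orthPoly a b n)).2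
    simp only [Polynomial.eval_mul] at h
    refine tendsto_nhds_unique h (tendsto_const_nhds.congr' ?_)
    filter_upwards [eventually_ge_atTop (max m n)] with M hM
    exact (horth M m n (le_of_max_le_left hM) (le_of_max_le_right hM)).symm

/-- The bounded continuous function `x ↦ 1 / (|x| + ε)`. -/
def invAbsAdd {ε : ℝ} (hε : 0 < ε) : BoundedContinuousFunction ℝ ℝ :=
  BoundedContinuousFunction.ofNormedAddCommGroup (fun x => 1 / (|x| + ε))
    (continuous_const.div (by fun_prop) fun x => by positivity) (1 / ε) fun x => by
      rw [Real.norm_of_nonneg (by positivity)]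
      refine one_div_le_one_div_of_le hε ?_
      linarith [abs_nonneg x]

/-- The integrand is 1/ε at 0, so the atom has mass at most ε B for every ε > 0. -/
theorem measure_singleton_zero_of_integral_le {σ : ProbabilityMeasure ℝ} {B : ℝ}
    (h : ∀ ε : ℝ, ∀ hε : 0 < ε, ∫ x, invAbsAdd hε x ∂(σ : Measure ℝ) ≤ B) :
    (σ : Measure ℝ) {0} = 0 := by
  have hreal : ∀ ε : ℝ, 0 < ε → (σ : Measure ℝ).real {0} ≤ ε * B := by
    intro ε hε
    have hM := mul_meas_ge_le_integral_of_nonneg (μ := (σ : Measure ℝ)) (f := invAbsAdd hε)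
      (Eventually.of_forall fun x => by
        change (0 : ℝ) ≤ 1 / (|x| + ε)
        positivity)
      ((invAbsAdd hε).integrable (σ : Measure ℝ)) (1 / ε)
    have hsub : ({0} : Set ℝ) ⊆ {x | 1 / ε ≤ invAbsAdd hε x} := by
      rintro x rfl
      change 1 / ε ≤ 1 / (|(0 : ℝ)| + ε)
      simp
    have h1 : (σ : Measure ℝ).real {0} ≤ (σ : Measure ℝ).real {x | 1 / ε ≤ invAbsAdd hε x} :=
      measureReal_mono hsub
    have h2 : 1 / ε * (σ : Measure ℝ).real {0} ≤ B :=
      (mul_le_mul_of_nonneg_left h1 (by positivity)).trans (hM.trans (h ε hε))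
    rw [one_div, inv_mul_le_iff₀ hε] at h2
    exact h2
  have hz : (σ : Measure ℝ).real {0} ≤ 0 := by
    have : Tendsto (fun ε : ℝ => ε * B) (𝓝[>] 0) (𝓝 0) := by
      have : Tendsto (fun ε : ℝ => ε * B) (𝓝 0) (𝓝 (0 * B)) := tendsto_id.mul_const B
      rw [zero_mul] at this
      exact this.mono_left nhdsWithin_le_nhds
    exact ge_of_tendsto this (eventually_mem_nhdsWithin.mono fun ε hε => hreal ε hε)
  exact (measureReal_eq_zero_iff).1 (le_antisymm hz measureReal_nonneg)

section

variable {lam mu : ℕ → ℝ}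

/-- A solution with an atom at the origin. -/
theorem exists_solution_atom (hl : ∀ n, 0 < lam n) (hm : ∀ n, 0 < mu (n + 1)) (hm0 : mu 0 = 0)
    (h : Summable (bdPotential lam mu)) :
    ∃ σ : Measure ℝ, IsStieltjesSolution (bdDiag lam mu) (bdOffDiag lam mu) σ ∧ σ {0} ≠ 0 := by
  choose x V hx hV hO hprob horth using fun M => exists_truncated hl hm hm0 M 0
  obtain ⟨φ, -, σ, hσ, hsol⟩ := exists_solution_of_truncated
    (fun n => (bdOffDiag_pos hl hm n).ne') (fun M => ⟨_, hprob M⟩)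
    (fun M q => integrable_atomicMeasure _ _ _) (fun M => atomicMeasure_Iio _ (hx M)) horth
  refine ⟨σ, hsol, ?_⟩
  set U := ∑' k, bdPotential lam mu k
  have hU : 0 < U := h.tsum_pos (fun k => (bdPotential_pos hl hm k).le) 0
    (bdPotential_pos hl hm 0)
  -- The kernel vector P_k(0) has first entry 1 and squared norm Σ_{k ≤ M} π_k ≤ U. The resulting
  -- mass bound is uniform in M and survives the weak limit because {0} is closed.
  have hatom : ∀ M, ENNReal.ofReal (1 / U) ≤ atomicMeasure (x M) (fun i => V M i 0) {0} := by
    intro M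
    rw [atomicMeasure_singleton_zero]
    refine ENNReal.ofReal_le_ofReal ?_
    have h1 := sq_le_atom_mul (hV M) (hO M) _ (truncFactor_kernel hl hm M) 0
    have e : dotProduct (fun k : Fin (M + 1) => bdSign lam mu k) (fun k => bdSign lam mu k)
        = ∑ k ∈ Finset.range (M + 1), bdPotential lam mu k := by
      rw [← Fin.sum_univ_eq_sum_range, dotProduct]
      exact Finset.sum_congr rfl fun k _ => bdSign_mul_self hl hm k
    rw [e] at h1
    have h2 := h.sum_le_tsum (Finset.range (M + 1)) fun k _ => (bdPotential_pos hl hm k).le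
    have h3 : 0 ≤ ∑ i, if x M i = 0 then V M i 0 ^ 2 else 0 :=
      Finset.sum_nonneg fun i _ => by split_ifs <;> positivity
    have h4 : bdSign lam mu ((0 : Fin (M + 1)) : ℕ) = 1 := by simp [bdSign, bdPotential]
    rw [h4, one_pow] at h1
    rw [div_le_iff₀ hU]
    exact h1.trans (mul_le_mul_of_nonneg_left h2 h3)
  have hle := ProbabilityMeasure.limsup_measure_closed_le_of_tendsto hσ
    (isClosed_singleton (x := (0 : ℝ)))
  have hge : ENNReal.ofReal (1 / U) ≤ (σ : Measure ℝ) {0} :=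
    (le_limsup_of_frequently_le' (Frequently.of_forall fun n => hatom (φ n))).trans hle
  exact ((ENNReal.ofReal_pos.2 (by positivity)).trans_le hge).ne'

/-- A solution without an atom at the origin. -/
theorem exists_solution_no_atom (hl : ∀ n, 0 < lam n) (hm : ∀ n, 0 < mu (n + 1)) (hm0 : mu 0 = 0)
    (h : Summable (bdScale lam mu)) :
    ∃ σ : Measure ℝ, IsStieltjesSolution (bdDiag lam mu) (bdOffDiag lam mu) σ ∧ σ {0} = 0 := by
  choose x V hx hV hO hprob horth using fun M => exists_truncated hl hm hm0 M (lam M)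
  obtain ⟨φ, -, σ, hσ, hsol⟩ := exists_solution_of_truncated
    (fun n => (bdOffDiag_pos hl hm n).ne') (fun M => ⟨_, hprob M⟩)
    (fun M q => integrable_atomicMeasure _ _ _) (fun M => atomicMeasure_Iio _ (hx M)) horth
  refine ⟨σ, hsol, measure_singleton_zero_of_integral_le (B := ∑' k, bdScale lam mu k) ?_⟩
  intro ε hε
  refine le_of_tendsto' ((ProbabilityMeasure.tendsto_iff_forall_integral_tendsto.1 hσ)
    (invAbsAdd hε)) fun n => ?_
  set M := φ n
  change ∫ t, 1 / (|t| + ε) ∂(atomicMeasure (x M) fun i => V M i 0) ≤ _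
  rw [integral_atomicMeasure]
  -- The bound is the entry y_0 of the explicit solution, a partial sum of the convergent series.
  refine (sum_div_add_le (hx M) (hV M) (hO M) _ 0 (truncFactor_solution hl hm M) hε).trans ?_
  have h4 : bdSign lam mu ((0 : Fin (M + 1)) : ℕ) = 1 := by simp [bdSign, bdPotential]
  rw [h4, one_mul]
  exact h.sum_le_tsum _ fun k _ => (bdScale_pos hl hm k).le

theorem isStieltjesIndeterminate_of_summable (hl : ∀ n, 0 < lam n) (hm : ∀ n, 0 < mu (n + 1))
    (hm0 : mu 0 = 0) (h1 : Summable (bdPotential lam mu)) (h2 : Summable (bdScale lam mu)) :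
    IsStieltjesIndeterminate (bdDiag lam mu) (bdOffDiag lam mu) := by
  obtain ⟨σ₁, hs1, ha1⟩ := exists_solution_atom hl hm hm0 h1
  obtain ⟨σ₂, hs2, ha2⟩ := exists_solution_no_atom hl hm hm0 h2
  exact ⟨σ₁, σ₂, hs1, hs2, fun e => ha1 (e ▸ ha2)⟩

end

end

theorem mainTheorem3 (p : ℕ) (e d : Fin p → ℝ)
    (he : ∀ j, 0 < e j) (hd : ∀ j, -(p : ℝ) < d j) (hd0 : ∏ j, d j = 0)
    (hlow : 1 < (∑ j, e j - ∑ j, d j) / (p : ℝ))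
    (hupp : (∑ j, e j - ∑ j, d j) / (p : ℝ) < (p : ℝ) - 1)
    (a b : ℕ → ℝ)
    (ha : a = bdDiag (polyRate p e) (polyRate p d))
    (hb : b = bdOffDiag (polyRate p e) (polyRate p d)) :
    -- the Stieltjes moment problem is indeterminate
    IsStieltjesIndeterminate a b ∧
    -- the multi-zeta values converge, and `G_p` is an entire function of order `1 / p`
    (∀ n : ℕ, Summable fun k : alternatingTuples n => multiZetaTerm p n k) ∧
    (∀ z : ℂ, Summable fun n : ℕ => (multiZeta p (n + 1) : ℂ) * z ^ (n + 1)) ∧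
    Differentiable ℂ (multiZetaFun p) ∧
    entireOrder (multiZetaFun p) = ((1 / (p : ℝ) : ℝ) : EReal) ∧
    -- the entries of the Nevanlinna matrix have order `1 / p` and type `τ_p / p`
    ∃ N : ℂ → Matrix (Fin 2) (Fin 2) ℂ, IsNevanlinnaMatrix a b N ∧
      ∀ i j : Fin 2,
        Differentiable ℂ (fun z => N z i j) ∧
        entireOrder (fun z => N z i j) = ((1 / (p : ℝ) : ℝ) : EReal) ∧
        entireType (fun z => N z i j) = entireType (multiZetaFun p) / ((p : ℝ) : EReal) := by
  subst ha hb
  have hp2 : (2 : ℝ) < p := by linarith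
  have hp : 3 ≤ p := by exact_mod_cast hp2
  have hpr : (3 : ℝ) ≤ p := by exact_mod_cast hp
  have hp0 : 0 < p := by omega
  have hl := polyRate_pos he
  have hm := polyRate_succ_pos hd
  -- The condition d_1⋯d_p = 0 is precisely μ_0 = 0.
  have hm0 : polyRate p d 0 = 0 := by simpa [polyRate] using hd0
  have hgood := isGoodWeights_polyRate hp0 he hd hlow hupp
  obtain ⟨hc1, hc2⟩ := bdLimX_polyRate_polyLE hp he hd hlow hupp
  refine ⟨isStieltjesIndeterminate_of_summable hl hm hm0 hgood.summable hgood.summable_v,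
    summable_multiZetaTerm hpr, summable_multiZeta_mul_pow hpr, differentiable_multiZetaFun hpr,
    entireOrder_multiZetaFun hpr, bdNevanlinna (polyRate p e) (polyRate p d),
    isNevanlinnaMatrix_bdNevanlinna hl hm hm0 hgood, fun i j => ?_⟩
  obtain ⟨hdiff, h1, h2⟩ := bdNevanlinna_entry hgood i j
  have hκ : 0 < ((p : ℝ) ^ p)⁻¹ := by positivity
  have hM0 : ∀ᶠ r : ℝ in atTop,
      0 ≤ maxModulus (fun z => bdNevanlinna (polyRate p e) (polyRate p d) z i j) r := by
    filter_upwards [eventually_ge_atTop 0] with r hr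
    exact (norm_nonneg _).trans
      (norm_le_maxModulus hdiff.continuous (z := (r : ℂ)) (by simpa using hr))
  have hR0 : ∀ᶠ r : ℝ in atTop, 0 ≤ refGrowth p (((p : ℝ) ^ p)⁻¹ * r) := by
    filter_upwards [eventually_ge_atTop 0] with r hr
    exact zero_le_one.trans ((isGoodWeights_refWeight hpr).fst_le_lim (s := (1, 0))
      (by positivity) zero_le_one le_rfl 0)
  obtain ⟨ho, ht⟩ := entireOrder_entireType_of_polyLE hpr hκ (h1.trans hc1 hR0)
    (hc2.trans h2 hM0)
  refine ⟨hdiff, ho, ?_⟩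
  -- The leading coefficient p^p of the rates, raised to the power -1/p, gives the factor 1/p in the
  -- type.
  have hκp : (((p : ℝ) ^ p)⁻¹) ^ (1 / (p : ℝ)) = (p : ℝ)⁻¹ := by
    rw [← inv_pow, ← Real.rpow_natCast, ← Real.rpow_mul (by positivity),
      mul_one_div_cancel (by positivity), Real.rpow_one]
  rw [ht, hκp, EReal.div_eq_inv_mul, EReal.coe_inv]
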